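/- Let $0<\beta<2$, let $N>6$ and $L>N-6$ be integers. For $f=(f_n)_{2\le n\le N}$ let $(Jf)_2=3(\beta+1)f_3-2\beta f_2$, $(Jf)_n=(\beta+1)(n+1)f_{n+1}-(2\beta+1)nf_n+\beta(n-1)f_{n-1}$ for $2<n<N$, $(Jf)_N=\beta(N-1)f_{N-1}-(\beta+1)Nf_N$, and for $2<n\le N$ let $\kappa_n$ be the modulus of the $n$-th diagonal coefficient of $J$, i.e. $\kappa_n=(2\beta+1)n$ for $2<n<N$ and $\kappa_N=(\beta+1)N$. *Discrete steady states.* For a positive multiple $K$ of $L$ let $\varepsilon=L/K$, $\xi_k=k\varepsilon$. A normalized steady state is a family of numbers $g_n^k$ with $g_n^k\ge0$ ($2\le n\le N$, $1\le k\le K-1$), $g_n^0=0$ ($7\le n\le N$), $g_n^K=0$ ($2\le n\le N$), and $$-2g_n^k-(\xi_k+6-n)_+\frac{g_n^{k+1}-g_n^k}{\varepsilon}+(\xi_k+6-n)_-\frac{g_n^k-g_n^{k-1}}{\varepsilon}+\mathbf 1_{\{\xi_k=n-6\}}g_n^k=\Gamma^\varepsilon (Jg^k)_n$$ for $2\le n\le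 N$, $1\le k\le K-1$, where, with $X_n^\varepsilon=\varepsilon\sum_{k=1}^{K-1}g_n^k$, $$\Gamma^\varepsilon=\frac{\sum_{n=2}^5(6-n)(6-n-\varepsilon)g_n^1}{\sum_{n=2}^N(6-n)(JX^\varepsilon)_n-\varepsilon^2\sum_{n=2}^N\sum_{k=1}^{K-1}\mathrm{sgn}(\xi_k+6-n)(Jg^k)_n},$$ and such that $\sum_{n=2}^N(n-6)X_n^\varepsilon+\varepsilon^2\sum_{n=2}^N\sum_{k=1}^{K-1}\mathrm{sgn}(\xi_k+6-n)g_n^k=0$ and $\sum_{n=2}^NX_n^\varepsilon=1$. Its interpolation $g_n^\varepsilon$ on $[0,L]$ is the step function equal to $g_n^k$ on the cell of width $\varepsilon$ centred at $\xi_k$ ($1\le k\le K-1$), to $0$ on the half cell at $L$, and, on the half cell at $0$, to $g_n^1$ if $n\le5$ and to $0$ if $n\ge6$. *Limit.* Suppose that along some sequence $K\to\infty$ (so $\varepsilon\to0$) of multiples of $L$ there are normalized steady states with $\Gamma^\varepsilon\to\Gamma$, $g_n^\varepsilon(0)\to\bar g_n$ for $n=2,\dots,5$, and $g_n^\varepsilon\,d\xi\rightharpoonup\mu_n$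 weakly-$\star$ as Radon measures on $[0,L]$ for $n=2,\dots,N$. For $6\le n\le N$ let $m_n=\mu_n(\{n-6\})$ be the weight of the possible Dirac mass of $\mu_n$ at $\xi=n-6$. *Claim.* For every $n=6,\dots,N$ one has $\Gamma\kappa_n>1$ and $m_n=0$. Moreover, there are functions $g_n$ ($2\le n\le N$) on $[0,\infty)$ with $\mu_n=g_n\,d\xi$ such that, for every $n=2,\dots,N$, $g_n$ is positive and continuous on $(0,N-6)\setminus\{n-6\}$, continuously differentiable on $(0,N-6)\setminus\{n-7,n-6,n-5\}$, and $g_n=0$ on $(N-6,\infty)$. Finally, $g=(g_n)_{n=2}^N$ is a genuine weak self-similar profile: it is nonnegative and nontrivial ($\sum_n X_n>0$, where $X_n=\int_0^\infty g_n\,d\xi$), each $g_n$ and $\xi g_n$ is integrable on $(0,\infty)$, $\lim_{\xi\searrow0}g_n(\xi)=g_n(0)$ for $n\ne6$ with $g_n(0)=\bar g_n$ for $n\le5$ and $g_n(0)=0$ for $n\ge7$, the numbers $$\Gamma_{\rm num}(g)=\sum_{n=2}^5(n-6)^2g_n(0),\qquad \Gamma_{\rm den}(g)=\beta NX_N-2(\beta+1)X_2+\sum_{n=2}^NnX_n$$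 are positive, $\Gamma=\Gamma(g):=\Gamma_{\rm num}(g)/\Gamma_{\rm den}(g)$, and for every $n=2,\dots,N$ and every smooth compactly supported $\phi:\mathbb R\to\mathbb R$ $$\int_0^\infty g_n\big((\xi+6-n)\phi'-\phi\big)\,d\xi+(6-n)_+\,g_n(0)\,\phi(0)=\Gamma(g)\int_0^\infty(Jg)_n\,\phi\,d\xi .$$ -/

import Mathlib

open Set Filter Topology MeasureTheory
open scoped ContDiff

namespace Fradkov

noncomputable section

/-! ### The coupling operator -/

/-- The coupling operator `J` of the model with topological classes `2, …, N`. -/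
def coupling (β : ℝ) (N : ℕ) (f : ℕ → ℝ) (n : ℕ) : ℝ :=
  if n = 2 then 3 * (β + 1) * f 3 - 2 * β * f 2
  else if n = N then β * ((N : ℝ) - 1) * f (N - 1) - (β + 1) * N * f N
  else (β + 1) * ((n : ℝ) + 1) * f (n + 1) - (2 * β + 1) * n * f n
    + β * ((n : ℝ) - 1) * f (n - 1)

/-- The modulus `κ_n` of the `n`-th diagonal element of `J`. -/
def kappa (β : ℝ) (N n : ℕ) : ℝ :=
  if n = 2 then 2 * β
  else if n = N then (β + 1) * N
  else (2 * β + 1) * n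

/-! ### The discrete model on the grid `ξ_k = k L / K`, `k = 0, …, K`

A discrete state is `g : ℕ → ℕ → ℝ`, where `g n k` stands for `g_n^k`; only the values with
`2 ≤ n ≤ N` and `k ≤ K` matter. -/

/-- The mesh size `ε = L / K`. -/
def mesh (L K : ℕ) : ℝ := (L : ℝ) / K

/-- The grid points `ξ_k = k ε`. -/
def gridPoint (L K k : ℕ) : ℝ := (k : ℝ) * mesh L K

/-- The discrete moment `X_n`. -/
def discreteX (L K : ℕ) (g : ℕ → ℕ → ℝ) (n : ℕ) : ℝ :=
  mesh L K * ∑ k ∈ Finset.Icc 1 (K - 1), g n k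

/-- The discrete polyhedral defect `P`. -/
def discreteP (N L K : ℕ) (g : ℕ → ℕ → ℝ) : ℝ :=
  ∑ n ∈ Finset.Icc 2 N, ((n : ℝ) - 6) * discreteX L K g n

/-- The auxiliary quantity `Q`. -/
def discreteQ (N L K : ℕ) (g : ℕ → ℕ → ℝ) : ℝ :=
  mesh L K * ∑ n ∈ Finset.Icc 2 N, ∑ k ∈ Finset.Icc 1 (K - 1),
    Real.sign (gridPoint L K k + 6 - n) * g n k

/-- The numerator of the discrete coupling weight; the sign of the `ε`-term is the one for which
`P + ε Q = 0` is preserved by the discrete dynamics (and hence compatible with steady states). -/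
def discreteGammaNum (L K : ℕ) (g : ℕ → ℕ → ℝ) : ℝ :=
  ∑ n ∈ Finset.Icc (2 : ℕ) 5, (6 - (n : ℝ)) * (6 - (n : ℝ) - mesh L K) * g n 1

/-- The denominator of the discrete coupling weight. -/
def discreteGammaDen (β : ℝ) (N L K : ℕ) (g : ℕ → ℕ → ℝ) : ℝ :=
  ∑ n ∈ Finset.Icc 2 N, (6 - (n : ℝ)) * coupling β N (discreteX L K g) n
    - mesh L K ^ 2 * ∑ n ∈ Finset.Icc 2 N, ∑ k ∈ Finset.Icc 1 (K - 1),
        Real.sign (gridPoint L K k + 6 - n) * coupling β N (fun m => g m k) n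

/-- The discrete coupling weight `Γ^ε`. -/
def discreteGamma (β : ℝ) (N L K : ℕ) (g : ℕ → ℕ → ℝ) : ℝ :=
  discreteGammaNum L K g / discreteGammaDen β N L K g

/-- The upwind discretization of `-(ξ + 6 - n) g_n'` at the grid point `ξ_k`, including the
Kronecker delta term at `ξ_k = n - 6`. -/
def upwind (L K : ℕ) (g : ℕ → ℕ → ℝ) (n k : ℕ) : ℝ :=
  - max (gridPoint L K k + 6 - n) 0 * ((g n (k + 1) - g n k) / mesh L K)
    + max (-(gridPoint L K k + 6 - n)) 0 * ((g n k - g n (k - 1)) / mesh L K)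
    + (if gridPoint L K k = (n : ℝ) - 6 then g n k else 0)

/-- Nonnegative steady states of the discrete model (with `P + ε Q = 0`), rescaled such that the
total number of grains is one. -/
structure IsNormalizedSteadyState (β : ℝ) (N L K : ℕ) (g : ℕ → ℕ → ℝ) : Prop where
  nonneg : ∀ n ∈ Finset.Icc 2 N, ∀ k ∈ Finset.Icc 1 (K - 1), 0 ≤ g n k
  defect : discreteP N L K g + mesh L K * discreteQ N L K g = 0
  left_boundary : ∀ n ∈ Finset.Icc 7 N, g n 0 = 0
  right_boundary : ∀ n ∈ Finset.Icc 2 N, g n K = 0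
  steady : ∀ n ∈ Finset.Icc 2 N, ∀ k ∈ Finset.Icc 1 (K - 1),
    -2 * g n k + upwind L K g n k
      = discreteGamma β N L K g * coupling β N (fun m => g m k) n
  normalized : ∑ n ∈ Finset.Icc 2 N, discreteX L K g n = 1

/-- The piecewise constant interpolation `g_n^ε` on `[0, L]`: the value is `g_n^k` on the cell of
width `ε` centred at `ξ_k`, `1 ≤ k ≤ K - 1`; on the half cell at `0` it is `g_n^1` for `n ≤ 5` and
`0` for `n ≥ 6`; on the half cell at `L` it is `0`. -/
def interpolation (L K : ℕ) (g : ℕ → ℕ → ℝ) (n : ℕ) (ξ : ℝ) : ℝ :=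
  let k := ⌊ξ / mesh L K + 1 / 2⌋₊
  if k = 0 then (if n ≤ 5 then g n 1 else 0)
  else if k < K then g n k
  else 0

/-- `(Γ, ḡ, μ)` is a limit of normalized steady states as `ε → 0` (along some sequence of meshes):
`Γ^ε → Γ`, `g_n^ε(0) → ḡ_n` for `n = 2, …, 5`, and `g_n^ε dξ → μ_n` weakly-⋆ as Radon measures on
`[0, L]` for `n = 2, …, N`. -/
def IsSteadyStateLimit (β : ℝ) (N L : ℕ) (Γ : ℝ) (gbar : ℕ → ℝ) (μ : ℕ → Measure ℝ) : Prop :=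
  ∃ (K : ℕ → ℕ) (g : ℕ → ℕ → ℕ → ℝ),
    (∀ j, 0 < K j ∧ L ∣ K j) ∧
    Tendsto K atTop atTop ∧
    (∀ j, IsNormalizedSteadyState β N L (K j) (g j)) ∧
    Tendsto (fun j => discreteGamma β N L (K j) (g j)) atTop (𝓝 Γ) ∧
    (∀ n ∈ Finset.Icc 2 5,
      Tendsto (fun j => interpolation L (K j) (g j) n 0) atTop (𝓝 (gbar n))) ∧
    (∀ n ∈ Finset.Icc 2 N,
      IsFiniteMeasure (μ n) ∧ μ n (Icc 0 (L : ℝ))ᶜ = 0 ∧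
      ∀ φ : ℝ → ℝ, Continuous φ →
        Tendsto (fun j => ∫ ξ in Icc 0 (L : ℝ), φ ξ * interpolation L (K j) (g j) n ξ)
          atTop (𝓝 (∫ ξ, φ ξ ∂(μ n))))

/-! ### Weak self-similar profiles -/

/-- The moment `X_n` of a profile. -/
def momentX (g : ℕ → ℝ → ℝ) (n : ℕ) : ℝ := ∫ ξ in Ioi (0 : ℝ), g n ξ

/-- The numerator of the self-consistent coupling weight. -/
def gammaNum (g : ℕ → ℝ → ℝ) : ℝ := ∑ n ∈ Finset.Icc (2 : ℕ) 5, ((n : ℝ) - 6) ^ 2 * g n 0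

/-- The denominator of the self-consistent coupling weight. -/
def gammaDen (β : ℝ) (N : ℕ) (g : ℕ → ℝ → ℝ) : ℝ :=
  β * N * momentX g N - 2 * (β + 1) * momentX g 2 + ∑ n ∈ Finset.Icc 2 N, (n : ℝ) * momentX g n

/-- The self-consistent coupling weight `Γ(g)`. -/
def gamma (β : ℝ) (N : ℕ) (g : ℕ → ℝ → ℝ) : ℝ := gammaNum g / gammaDen β N g

/-- Nonnegative, nontrivial, weak self-similar profiles with finite area of the model with classes
`2, …, N`. The value `g_n(0)` is the trace of `g_n` at `0` for `n ≠ 6` (it is not used for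
`n = 6`). -/
structure IsWeakProfile (β : ℝ) (N : ℕ) (g : ℕ → ℝ → ℝ) : Prop where
  nonneg : ∀ n ∈ Finset.Icc 2 N, ∀ ξ : ℝ, 0 ≤ ξ → 0 ≤ g n ξ
  nontrivial : 0 < ∑ n ∈ Finset.Icc 2 N, momentX g n
  integrable : ∀ n ∈ Finset.Icc 2 N, IntegrableOn (g n) (Ioi 0)
  area_finite : ∀ n ∈ Finset.Icc 2 N, IntegrableOn (fun ξ => ξ * g n ξ) (Ioi 0)
  trace : ∀ n ∈ Finset.Icc 2 N, n ≠ 6 → Tendsto (g n) (𝓝[>] 0) (𝓝 (g n 0))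
  boundary : ∀ n ∈ Finset.Icc 7 N, g n 0 = 0
  gammaNum_pos : 0 < gammaNum g
  gammaDen_pos : 0 < gammaDen β N g
  weak : ∀ n ∈ Finset.Icc 2 N, ∀ φ : ℝ → ℝ, ContDiff ℝ ∞ φ → HasCompactSupport φ →
    (∫ ξ in Ioi (0 : ℝ), g n ξ * ((ξ + 6 - n) * deriv φ ξ - φ ξ))
        + max (6 - (n : ℝ)) 0 * g n 0 * φ 0
      = gamma β N g * ∫ ξ in Ioi (0 : ℝ), coupling β N (fun m => g m ξ) n * φ ξ

end

end Fradkov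

open scoped ENNReal NNReal

/-! ### Test functions adapted to a transport operator with a singular point -/

namespace Fradkov

/-! Summation by parts moves every difference in the scheme onto the test function, so weak
convergence alone yields the limit equations (`IsSteadyStateLimit.isMeasureProfile`): for φ of class
C¹ on [0, L], ∫ ((ξ+6-n)φ' - φ) dμ_n + (6-n)_+ ḡ_n φ(0) = Γ (J ∫φ dμ)_n. The formula for Γ also
survives, since the limit of its denominator is positive: zero defect and total mass one bound it
below by 6 - 2(β+1) > 0. This is where β < 2 enters.

Put c = n-6 and σ = Γκ_n. With the diagonal of J moved to the left, each equation becomes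
-((ξ-c)μ_n)' + (σ-1)μ_n = S_n away from the boundary at 0, where S_n ≥ 0 is a combination of the
neighbours μ_{n±1}. Solving the adjoint ODE for the test function and exchanging integrals gives the
variation of constants formula: on each side of c, μ_n has density |ξ-c|^(σ-2) times the integral of
|s-c|^(1-σ) dS_n over the part of the line beyond ξ, seen from c (`restrict_Ioi_eq_withDensity`).

The decisive point is σ > 1 for n ≥ 6. If S_n has mass beyond some point on one side of c, the
density there is at least C|ξ-c|^(σ-2) with C > 0 near c, and finite mass of μ_n forces σ > 1. That
mass comes from a chain of positivity. Testing with φ = 1 and summing, the coupling cancels and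
Σ(6-n)_+ ḡ_n = 1, so some class n ≤ 5 has positive trace and hence a nonzero source. Charge near ξ =
0 then spreads upward through the classes to N-1, and positivity on all of (0, N-6) spreads back
down from N to 2 (`IsMeasureProfile.source_pos_and_pos`, `IsMeasureProfile.one_lt`).

Test functions concentrating at c give (σ-1) m_n = S_n({c}). The neighbours can have atoms only at c
± 1, so the right side vanishes, and σ > 1 gives m_n = 0 (`IsMeasureProfile.measure_singleton`).
With no atoms left, the densities are continuous off c. Inserting them into the sources makes each
one C¹ wherever its neighbours are continuous. The trace at 0 for n ≤ 5 results from testing with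
(ξ-c)^(1-σ), a solution of the homogeneous adjoint equation. -/

/-- The solution `φ` of `x φ' + (σ - 1) φ = ψ` on `(0, ∞)` that vanishes on `(-∞, δ]`, for `ψ`
vanishing on `(-∞, δ]`. -/
noncomputable def transportTest (σ δ : ℝ) (ψ : ℝ → ℝ) (x : ℝ) : ℝ :=
  max x (δ / 2) ^ (1 - σ) * ∫ t in δ..x, max t (δ / 2) ^ (σ - 2) * ψ t

section transportTest

variable {σ δ : ℝ} {ψ : ℝ → ℝ}

/-- Truncating the base at δ/2 changes nothing on [δ, ∞), where ψ may be nonzero, and removes the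
singularity at 0, so that `transportTest` is a global C¹ function. -/
theorem continuous_max_rpow (hδ : 0 < δ) (s : ℝ) : Continuous fun t : ℝ => max t (δ / 2) ^ s := by
  refine (continuous_id.max continuous_const).rpow_const fun x => Or.inl ?_
  have : δ / 2 ≤ max (id x) (δ / 2) := le_max_right _ _
  intro h
  linarith

theorem transportTest_of_le (hψ0 : ∀ x ≤ δ, ψ x = 0) {x : ℝ} (hx : x ≤ δ) :
    transportTest σ δ ψ x = 0 := by
  have : ∫ t in δ..x, max t (δ / 2) ^ (σ - 2) * ψ t = 0 := by
    rw [intervalIntegral.integral_symm, neg_eq_zero]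
    refine (intervalIntegral.integral_congr (g := fun _ => 0) fun t ht => ?_).trans (by simp)
    rw [uIcc_of_le hx] at ht
    simp [hψ0 t ht.2]
  simp [transportTest, this]

theorem transportTest_of_ge (hδ : 0 < δ) {x : ℝ} (hx : δ ≤ x) :
    transportTest σ δ ψ x = x ^ (1 - σ) * ∫ t in Ioc δ x, t ^ (σ - 2) * ψ t := by
  have h1 : max x (δ / 2) = x := max_eq_left (by linarith)
  rw [transportTest, h1, intervalIntegral.integral_of_le hx]
  congr 1
  refine setIntegral_congr_fun measurableSet_Ioc fun t ht => ?_
  have : max t (δ / 2) = t := max_eq_left (by linarith [ht.1])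
  simp [this]

theorem hasDerivAt_transportTest (hδ : 0 < δ) (hψ : Continuous ψ) (hψ0 : ∀ x ≤ δ, ψ x = 0)
    (x : ℝ) :
    HasDerivAt (transportTest σ δ ψ) ((ψ x - (σ - 1) * transportTest σ δ ψ x) / x) x := by
  rcases lt_or_ge x δ with hx | hx
  · have h0 : transportTest σ δ ψ =ᶠ[𝓝 x] fun _ => 0 := by
      filter_upwards [Iio_mem_nhds hx] with y hy using transportTest_of_le hψ0 (le_of_lt hy)
    -- Left of δ both the function and its claimed derivative vanish. This includes x = 0, where the
    -- quotient is 0 by convention.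
    rw [hψ0 x hx.le, transportTest_of_le hψ0 hx.le]
    simpa using (hasDerivAt_const x (0 : ℝ)).congr_of_eventuallyEq h0
  · have hx0 : 0 < x := by linarith
    have hc : Continuous fun t : ℝ => max t (δ / 2) ^ (σ - 2) * ψ t :=
      (continuous_max_rpow hδ _).mul hψ
    have hI : HasDerivAt (fun y => ∫ t in δ..y, max t (δ / 2) ^ (σ - 2) * ψ t)
        (max x (δ / 2) ^ (σ - 2) * ψ x) x :=
      intervalIntegral.integral_hasDerivAt_right (hc.intervalIntegrable _ _)
        (hc.stronglyMeasurableAtFilter _ _) hc.continuousAt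
    have hp : HasDerivAt (fun y : ℝ => max y (δ / 2) ^ (1 - σ)) ((1 - σ) * x ^ (1 - σ - 1)) x := by
      refine (Real.hasDerivAt_rpow_const (Or.inl hx0.ne')).congr_of_eventuallyEq ?_
      filter_upwards [Ioi_mem_nhds (show δ / 2 < x by linarith)] with y hy
      rw [max_eq_left (le_of_lt hy)]
    have hmax : max x (δ / 2) = x := max_eq_left (by linarith)
    refine (hp.mul hI).congr_deriv ?_
    rw [transportTest, hmax]
    have e1 : x ^ (1 - σ - 1) = x ^ (1 - σ) / x := by rw [Real.rpow_sub_one hx0.ne']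
    have e2 : x ^ (1 - σ) * x ^ (σ - 2) = 1 / x := by
      rw [← Real.rpow_add hx0, show 1 - σ + (σ - 2) = -1 by ring, Real.rpow_neg_one, one_div]
    rw [e1, ← mul_assoc (x ^ (1 - σ)) (x ^ (σ - 2)), e2]
    field_simp
    ring

theorem continuous_transportTest (hδ : 0 < δ) (hψ : Continuous ψ) (hψ0 : ∀ x ≤ δ, ψ x = 0) :
    Continuous (transportTest σ δ ψ) :=
  continuous_iff_continuousAt.2 fun x => (hasDerivAt_transportTest hδ hψ hψ0 x).continuousAt

theorem continuous_deriv_transportTest (hδ : 0 < δ) (hψ : Continuous ψ)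
    (hψ0 : ∀ x ≤ δ, ψ x = 0) :
    Continuous fun x => (ψ x - (σ - 1) * transportTest σ δ ψ x) / x := by
  refine continuous_iff_continuousAt.2 fun x => ?_
  rcases lt_or_ge x δ with hx | hx
  · refine (continuousAt_const (y := (0 : ℝ))).congr ?_
    filter_upwards [Iio_mem_nhds hx] with y hy
    rw [hψ0 y (le_of_lt hy), transportTest_of_le hψ0 (le_of_lt hy)]
    simp
  · exact (hψ.sub (continuous_const.mul
      (continuous_transportTest hδ hψ hψ0))).continuousAt.div continuousAt_id (by simp; linarith)

end transportTest

/-! ### Variation of constants for finite measures -/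

/-- A continuous function is integrable against a finite measure of compact support. -/
theorem integrable_of_compl_Icc {μ : Measure ℝ} [IsFiniteMeasure μ] {a b : ℝ}
    (hμ : μ (Icc a b)ᶜ = 0) {f : ℝ → ℝ} (hf : ContinuousOn f (Icc a b)) : Integrable f μ := by
  have h : μ.restrict (Icc a b) = μ := by
    rw [Measure.restrict_eq_self_of_ae_mem]
    exact measure_eq_zero_iff_ae_notMem.1 hμ |>.mono fun x hx => by simpa using hx
  rw [← h]
  exact hf.integrableOn_Icc

/-- A finite measure that solves the weak form of `-(x μ)' + (σ - 1) μ = S` on `(r, ∞)` is given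
there by the variation of constants formula. -/
theorem restrict_Ioi_eq_withDensity {σ r a b : ℝ} (hr : 0 ≤ r) (μ S : Measure ℝ)
    [IsFiniteMeasure μ] [IsFiniteMeasure S] (hμ : μ (Icc a b)ᶜ = 0) (hS : S (Icc a b)ᶜ = 0)
    (hw : ∀ δ > r, ∀ φ φ' : ℝ → ℝ, (∀ x, HasDerivAt φ (φ' x) x) → Continuous φ' →
      (∀ x ≤ δ, φ x = 0) → ∫ x, (x * φ' x + (σ - 1) * φ x) ∂μ = ∫ x, φ x ∂S) :
    μ.restrict (Ioi r) = (volume.restrict (Ioi r)).withDensity (fun t =>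
      ENNReal.ofReal (t ^ (σ - 2)) * ∫⁻ x in Ioi t, ENNReal.ofReal (x ^ (1 - σ)) ∂S) := by
  set D : ℝ → ℝ≥0∞ := fun t =>
    ENNReal.ofReal (t ^ (σ - 2)) * ∫⁻ x in Ioi t, ENNReal.ofReal (x ^ (1 - σ)) ∂S with hD
  have hmeasD : Measurable D := by
    refine Measurable.mul (by fun_prop) ?_
    have : (fun t => ∫⁻ x in Ioi t, ENNReal.ofReal (x ^ (1 - σ)) ∂S) =
        fun t => ∫⁻ x, (Ioi t).indicator (fun x => ENNReal.ofReal (x ^ (1 - σ))) x ∂S := by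
      funext t; rw [lintegral_indicator measurableSet_Ioi]
    rw [this]
    refine Measurable.lintegral_prod_right' (f := fun p : ℝ × ℝ =>
      (Ioi p.1).indicator (fun x => ENNReal.ofReal (x ^ (1 - σ))) p.2) ?_
    have : (fun p : ℝ × ℝ => (Ioi p.1).indicator (fun x => ENNReal.ofReal (x ^ (1 - σ))) p.2) =
        {p : ℝ × ℝ | p.1 < p.2}.indicator (fun p => ENNReal.ofReal (p.2 ^ (1 - σ))) := by
      funext p; simp [indicator]
    rw [this]
    exact Measurable.indicator (by fun_prop) (measurableSet_lt measurable_fst measurable_snd)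
  -- the formula against continuous functions supported away from `r`
  have key : ∀ δ > r, ∀ ψ : ℝ → ℝ, Continuous ψ → (∀ x, 0 ≤ ψ x) → (∀ x ≤ δ, ψ x = 0) →
      ∫⁻ x, ENNReal.ofReal (ψ x) ∂μ = ∫⁻ t, ENNReal.ofReal (ψ t) * D t := by
    intro δ hδr ψ hψ hψn hψ0
    have hδ : 0 < δ := lt_of_le_of_lt hr hδr
    have hφc := continuous_transportTest (σ := σ) hδ hψ hψ0
    have hint : ∫ x, ψ x ∂μ = ∫ x, transportTest σ δ ψ x ∂S := by
      rw [← hw δ hδr _ _ (hasDerivAt_transportTest hδ hψ hψ0)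
        (continuous_deriv_transportTest hδ hψ hψ0) fun x hx => transportTest_of_le hψ0 hx]
      refine integral_congr_ae (Eventually.of_forall fun x => ?_)
      -- The derivative is a quotient by x, so x φ' + (σ-1) φ = ψ needs a separate check at x = 0,
      -- where all terms vanish.
      rcases eq_or_ne x 0 with rfl | hx
      · simp [hψ0 0 hδ.le, transportTest_of_le hψ0 hδ.le]
      · simp only
        field_simp
        ring
    have hφn : ∀ x, 0 ≤ transportTest σ δ ψ x := by
      intro x
      rcases le_total x δ with hx | hx
      · rw [transportTest_of_le hψ0 hx]
      · rw [transportTest_of_ge hδ hx]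
        refine mul_nonneg (Real.rpow_nonneg (by linarith) _) (setIntegral_nonneg measurableSet_Ioc
          fun t ht => mul_nonneg (Real.rpow_nonneg (by linarith [ht.1]) _) (hψn t))
    have hiμ : Integrable ψ μ := integrable_of_compl_Icc hμ hψ.continuousOn
    have hiS : Integrable (transportTest σ δ ψ) S :=
      integrable_of_compl_Icc hS hφc.continuousOn
    rw [← ofReal_integral_eq_lintegral_ofReal hiμ (Eventually.of_forall hψn), hint,
      ofReal_integral_eq_lintegral_ofReal hiS (Eventually.of_forall hφn)]
    -- Writing the inner integral over the region t < x prepares Tonelli. The lower limit δ can be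
    -- dropped from the region because ψ vanishes on (-∞, δ].
    have h1 : ∀ x, ENNReal.ofReal (transportTest σ δ ψ x) =
        ∫⁻ t, {p : ℝ × ℝ | p.1 < p.2}.indicator (fun p =>
          ENNReal.ofReal (p.2 ^ (1 - σ)) *
            (ENNReal.ofReal (p.1 ^ (σ - 2)) * ENNReal.ofReal (ψ p.1))) (t, x) := by
      intro x
      have h2 : ∀ t, {p : ℝ × ℝ | p.1 < p.2}.indicator (fun p =>
          ENNReal.ofReal (p.2 ^ (1 - σ)) *
            (ENNReal.ofReal (p.1 ^ (σ - 2)) * ENNReal.ofReal (ψ p.1))) (t, x) =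
          (Ioo δ x).indicator (fun t => ENNReal.ofReal (x ^ (1 - σ)) *
            (ENNReal.ofReal (t ^ (σ - 2)) * ENNReal.ofReal (ψ t))) t := by
        intro t
        rcases le_or_gt t δ with ht | ht
        · simp [indicator, hψ0 t ht]
        · simp [indicator, ht]
      simp_rw [h2]
      rw [lintegral_indicator measurableSet_Ioo]
      rcases le_total x δ with hx | hx
      · simp [transportTest_of_le hψ0 hx, Ioo_eq_empty_of_le hx]
      · have hx0 : 0 < x := by linarith
        rw [transportTest_of_ge hδ hx, ENNReal.ofReal_mul (Real.rpow_nonneg hx0.le _),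
          lintegral_const_mul _ (by fun_prop), ofReal_integral_eq_lintegral_ofReal,
          restrict_Ioo_eq_restrict_Ioc]
        · congr 1
          refine setLIntegral_congr_fun measurableSet_Ioc fun t ht => ?_
          exact ENNReal.ofReal_mul (Real.rpow_nonneg (by linarith [ht.1]) _)
        · refine (ContinuousOn.integrableOn_Icc (a := δ) (b := x) ?_).mono_set Ioc_subset_Icc_self
          refine ContinuousOn.mul (fun t ht => ?_) hψ.continuousOn
          exact (Real.continuousAt_rpow_const _ _
            (Or.inl (by linarith [ht.1]))).continuousWithinAt
        · refine (ae_restrict_mem measurableSet_Ioc).mono fun t ht => ?_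
          exact mul_nonneg (Real.rpow_nonneg (by linarith [ht.1]) _) (hψn t)
    simp_rw [h1]
    rw [lintegral_lintegral_swap]
    · refine lintegral_congr fun t => ?_
      have h3 : ∀ x, {p : ℝ × ℝ | p.1 < p.2}.indicator (fun p =>
          ENNReal.ofReal (p.2 ^ (1 - σ)) *
            (ENNReal.ofReal (p.1 ^ (σ - 2)) * ENNReal.ofReal (ψ p.1))) (t, x) =
          (Ioi t).indicator (fun x => ENNReal.ofReal (x ^ (1 - σ)) *
            (ENNReal.ofReal (t ^ (σ - 2)) * ENNReal.ofReal (ψ t))) x := by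
        intro x; simp [indicator]
      simp_rw [h3]
      rw [lintegral_indicator measurableSet_Ioi, lintegral_mul_const _ (by fun_prop)]
      simp only [hD]
      ring
    · refine Measurable.aemeasurable ?_
      have : (Function.uncurry fun x t => {p : ℝ × ℝ | p.1 < p.2}.indicator (fun p =>
          ENNReal.ofReal (p.2 ^ (1 - σ)) *
            (ENNReal.ofReal (p.1 ^ (σ - 2)) * ENNReal.ofReal (ψ p.1))) (t, x)) =
          {p : ℝ × ℝ | p.1 < p.2}.indicator (fun p =>
          ENNReal.ofReal (p.2 ^ (1 - σ)) *
            (ENNReal.ofReal (p.1 ^ (σ - 2)) * ENNReal.ofReal (ψ p.1))) ∘ Prod.swap := by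
        funext ⟨x, t⟩; rfl
      rw [this]
      refine (Measurable.indicator ?_ (measurableSet_lt measurable_fst measurable_snd)).comp
        measurable_swap
      fun_prop
  set ν := (volume.restrict (Ioi r)).withDensity D with hν
  have hcut : ∀ s > r, μ.restrict (Ioi s) = ν.restrict (Ioi s) := by
    intro s hs
    set δ := (r + s) / 2 with hδd
    have hδr : r < δ := by linarith
    have hδs : δ < s := by linarith
    -- A continuous cutoff, 0 up to δ and 1 beyond s: w times any bounded continuous function is
    -- admissible in `key`, and these products determine the measures on (s, ∞).
    set w : ℝ → ℝ≥0 := fun x => min 1 (Real.toNNReal ((x - δ) / (s - δ))) with hwd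
    have hwc : Continuous w := by fun_prop
    have hw0 : ∀ x ≤ δ, w x = 0 := by
      intro x hx
      have : (x - δ) / (s - δ) ≤ 0 := div_nonpos_of_nonpos_of_nonneg (by linarith) (by linarith)
      simp [hwd, Real.toNNReal_of_nonpos this]
    have hw1 : ∀ x > s, w x = 1 := by
      intro x hx
      have : 1 ≤ (x - δ) / (s - δ) := by rw [le_div_iff₀ (by linarith)]; linarith
      simp only [hwd, min_eq_left_iff]
      exact Real.one_le_toNNReal.2 this
    have hmeasw : Measurable fun x => (w x : ℝ≥0∞) := by fun_prop
    have : IsFiniteMeasure (μ.withDensity fun x => (w x : ℝ≥0∞)) := by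
      refine isFiniteMeasure_withDensity ?_
      refine ne_top_of_le_ne_top (measure_ne_top μ univ) ?_
      calc ∫⁻ x, (w x : ℝ≥0∞) ∂μ ≤ ∫⁻ _, 1 ∂μ :=
            lintegral_mono fun x => ENNReal.coe_le_one_iff.2 (min_le_left _ _)
        _ = μ univ := by simp
    have hEq : μ.withDensity (fun x => (w x : ℝ≥0∞)) = ν.withDensity fun x => (w x : ℝ≥0∞) := by
      refine ext_of_forall_lintegral_eq_of_IsFiniteMeasure fun f => ?_
      have hf : Continuous f := f.continuous
      have hmf : Measurable fun x => (f x : ℝ≥0∞) := by fun_prop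
      rw [lintegral_withDensity_eq_lintegral_mul _ hmeasw hmf,
        lintegral_withDensity_eq_lintegral_mul _ hmeasw hmf, hν,
        lintegral_withDensity_eq_lintegral_mul _ hmeasD (hmeasw.mul hmf)]
      have h := key δ hδr (fun x => ((w x * f x : ℝ≥0) : ℝ)) (by fun_prop) (fun x => NNReal.coe_nonneg _)
        (fun x hx => by simp [hw0 x hx])
      simp only [ENNReal.ofReal_coe_nnreal, ENNReal.coe_mul] at h
      simp only [Pi.mul_apply]
      rw [h, ← lintegral_indicator measurableSet_Ioi]
      refine lintegral_congr fun t => ?_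
      by_cases ht : r < t
      · simp only [indicator, mem_Ioi, ht, if_true]; ring
      · simp [indicator, ht, hw0 t (by linarith)]
    have hone : ∀ ρ : Measure ℝ, (ρ.withDensity fun x => (w x : ℝ≥0∞)).restrict (Ioi s) =
        ρ.restrict (Ioi s) := by
      intro ρ
      rw [restrict_withDensity measurableSet_Ioi]
      conv_rhs => rw [← withDensity_one (μ := ρ.restrict (Ioi s))]
      refine withDensity_congr_ae ((ae_restrict_mem measurableSet_Ioi).mono fun x hx => ?_)
      simp [hw1 x hx]
    rw [← hone μ, ← hone ν, hEq]
  have hU : Ioi r = ⋃ m : ℕ, Ioi (r + 1 / ((m : ℝ) + 1)) := by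
    ext x
    simp only [mem_Ioi, mem_iUnion]
    constructor
    · intro hx
      obtain ⟨m, hm⟩ := exists_nat_one_div_lt (sub_pos.2 hx)
      exact ⟨m, by linarith⟩
    · rintro ⟨m, hm⟩
      have : 0 < 1 / ((m : ℝ) + 1) := by positivity
      linarith
  have hνr : ν.restrict (Ioi r) = ν := by
    rw [hν, restrict_withDensity measurableSet_Ioi, Measure.restrict_restrict measurableSet_Ioi,
      inter_self]
  rw [← hνr, hU, Measure.restrict_iUnion_congr]
  exact fun m => hcut _ (by have : 0 < 1 / ((m : ℝ) + 1) := by positivity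
                            linarith)

/-- The variation of constants formula for `-((ξ - c) g)' + (σ - 1) g = S` on `(c, ∞)`. -/
noncomputable def rightDensity (σ c : ℝ) (S : Measure ℝ) (ξ : ℝ) : ℝ :=
  (ξ - c) ^ (σ - 2) * ∫ s in Ioi ξ, (s - c) ^ (1 - σ) ∂S

/-- The variation of constants formula for `-((ξ - c) g)' + (σ - 1) g = S` on `(-∞, c)`. -/
noncomputable def leftDensity (σ c : ℝ) (S : Measure ℝ) (ξ : ℝ) : ℝ :=
  (c - ξ) ^ (σ - 2) * ∫ s in Iio ξ, (c - s) ^ (1 - σ) ∂S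

theorem restrict_Icc_of_compl {S : Measure ℝ} {a b : ℝ} (hS : S (Icc a b)ᶜ = 0) :
    S.restrict (Icc a b) = S := by
  rw [Measure.restrict_eq_self_of_ae_mem]
  exact measure_eq_zero_iff_ae_notMem.1 hS |>.mono fun x hx => by simpa using hx

theorem integrableOn_of_compl_Icc {S : Measure ℝ} [IsFiniteMeasure S] {a b : ℝ}
    (hS : S (Icc a b)ᶜ = 0) {f : ℝ → ℝ} {U V : Set ℝ} (hU : IsClosed U) (hVU : V ⊆ U)
    (hf : ContinuousOn f U) : IntegrableOn f V S := by
  have h1 : IntegrableOn f (U ∩ Icc a b) S :=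
    (hf.mono inter_subset_left).integrableOn_compact (isCompact_Icc.inter_left hU)
  refine IntegrableOn.mono_set ?_ hVU
  rw [IntegrableOn, ← Measure.restrict_restrict hU.measurableSet, restrict_Icc_of_compl hS] at h1
  exact h1

theorem integrableOn_Ioi_sub_rpow {S : Measure ℝ} [IsFiniteMeasure S] {a b : ℝ}
    (hS : S (Icc a b)ᶜ = 0) {c ξ : ℝ} (s : ℝ) (h : c < ξ) :
    IntegrableOn (fun x => (x - c) ^ s) (Ioi ξ) S := by
  refine integrableOn_of_compl_Icc hS isClosed_Ici Ioi_subset_Ici_self fun x hx => ?_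
  refine ContinuousAt.continuousWithinAt ?_
  exact ContinuousAt.rpow_const (by fun_prop) (Or.inl (by have := mem_Ici.1 hx; linarith))

theorem integrableOn_Iio_sub_rpow {S : Measure ℝ} [IsFiniteMeasure S] {a b : ℝ}
    (hS : S (Icc a b)ᶜ = 0) {c ξ : ℝ} (s : ℝ) (h : ξ < c) :
    IntegrableOn (fun x => (c - x) ^ s) (Iio ξ) S := by
  refine integrableOn_of_compl_Icc hS isClosed_Iic Iio_subset_Iic_self fun x hx => ?_
  refine ContinuousAt.continuousWithinAt ?_
  exact ContinuousAt.rpow_const (by fun_prop) (Or.inl (by have := mem_Iic.1 hx; linarith))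

theorem rightDensity_nonneg {σ c : ℝ} {S : Measure ℝ} {ξ : ℝ} (h : c ≤ ξ) :
    0 ≤ rightDensity σ c S ξ :=
  mul_nonneg (Real.rpow_nonneg (by linarith) _) (setIntegral_nonneg measurableSet_Ioi
    fun s hs => Real.rpow_nonneg (by have := mem_Ioi.1 hs; linarith) _)

theorem leftDensity_nonneg {σ c : ℝ} {S : Measure ℝ} {ξ : ℝ} (h : ξ ≤ c) :
    0 ≤ leftDensity σ c S ξ :=
  mul_nonneg (Real.rpow_nonneg (by linarith) _) (setIntegral_nonneg measurableSet_Iio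
    fun s hs => Real.rpow_nonneg (by have := mem_Iio.1 hs; linarith) _)

/-- Used with a translation and with a reflection of the line, to carry the formula with singular
point 0 over to either side of an arbitrary c. -/
theorem restrict_preimage_eq_withDensity (e : ℝ ≃ᵐ ℝ) (he : MeasurePreserving e volume volume)
    {μ : Measure ℝ} {U : Set ℝ} (hU : MeasurableSet U) {D : ℝ → ℝ≥0∞}
    (h : (μ.map e).restrict U = (volume.restrict U).withDensity D) :
    μ.restrict (e ⁻¹' U) = (volume.restrict (e ⁻¹' U)).withDensity fun ξ => D (e ξ) := by
  ext E hE
  have hE' : MeasurableSet (e.symm ⁻¹' E) := e.symm.measurable hE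
  have hpre : e ⁻¹' (e.symm ⁻¹' E) = E := by ext; simp
  have h1 := congrArg (fun ρ : Measure ℝ => ρ (e.symm ⁻¹' E)) h
  simp only [Measure.restrict_apply hE', withDensity_apply _ hE', MeasurableEquiv.map_apply,
    preimage_inter, hpre] at h1
  rw [Measure.restrict_apply hE, withDensity_apply _ hE, h1,
    ← (he.restrict_preimage hU).setLIntegral_comp_preimage_emb e.measurableEmbedding, hpre]

/-- Translation by c reduces this to singular point 0. The separate bound r ≥ c serves the classes n
≤ 5, where c < 0 but test functions have to vanish near ξ = 0 to avoid the boundary term. -/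
theorem restrict_Ioi_eq_withDensity_rightDensity {σ c r a b : ℝ} (hr : c ≤ r) (μ S : Measure ℝ)
    [IsFiniteMeasure μ] [IsFiniteMeasure S] (hμ : μ (Icc a b)ᶜ = 0) (hS : S (Icc a b)ᶜ = 0)
    (hw : ∀ δ > r, ∀ φ φ' : ℝ → ℝ, (∀ x, HasDerivAt φ (φ' x) x) → Continuous φ' →
      (∀ x ≤ δ, φ x = 0) → ∫ x, ((x - c) * φ' x + (σ - 1) * φ x) ∂μ = ∫ x, φ x ∂S) :
    μ.restrict (Ioi r) = (volume.restrict (Ioi r)).withDensity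
      fun ξ => ENNReal.ofReal (rightDensity σ c S ξ) := by
  set e : ℝ ≃ᵐ ℝ := MeasurableEquiv.subRight c
  have hee : ∀ x, e x = x - c := fun x => rfl
  have hpre : ∀ s, e ⁻¹' (Ioi s) = Ioi (s + c) := by
    intro s; ext x; simp [hee, lt_sub_iff_add_lt]
  have hsupp : e ⁻¹' (Icc (a - c) (b - c))ᶜ = (Icc a b)ᶜ := by
    ext x; simp [hee]
  have hmap := restrict_Ioi_eq_withDensity (σ := σ) (r := r - c) (a := a - c) (b := b - c)
    (by linarith) (μ.map e) (S.map e) (by rw [e.map_apply, hsupp, hμ])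
    (by rw [e.map_apply, hsupp, hS]) (by
      intro δ hδ φ φ' hφ hφ' h0
      have h := hw (δ + c) (by linarith) (fun x => φ (x - c)) (fun x => φ' (x - c))
        (fun x => (hφ (x - c)).comp_sub_const x c)
        (by fun_prop) (fun x hx => h0 _ (by linarith))
      rw [integral_map_equiv, integral_map_equiv]
      exact h)
  have h := restrict_preimage_eq_withDensity e (measurePreserving_sub_right volume c)
    measurableSet_Ioi hmap
  rw [hpre, sub_add_cancel] at h
  rw [h]
  refine withDensity_congr_ae ((ae_restrict_mem measurableSet_Ioi).mono fun ξ hξ => ?_)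
  have hξc : c < ξ := lt_of_le_of_lt hr hξ
  simp only [hee]
  rw [setLIntegral_map measurableSet_Ioi (by fun_prop) e.measurable, hpre, sub_add_cancel,
    rightDensity, ENNReal.ofReal_mul (Real.rpow_nonneg (by linarith) _),
    ofReal_integral_eq_lintegral_ofReal (integrableOn_Ioi_sub_rpow hS _ hξc)]
  · rfl
  · exact (ae_restrict_mem measurableSet_Ioi).mono fun s hs =>
      Real.rpow_nonneg (by have := mem_Ioi.1 hs; linarith) _

/-- The operator (x-c)φ' is invariant under the reflection x ↦ c-x composed with translation to c =
0, so the left side follows from the right one. -/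
theorem restrict_Iio_eq_withDensity_leftDensity {σ c a b : ℝ} (μ S : Measure ℝ)
    [IsFiniteMeasure μ] [IsFiniteMeasure S] (hμ : μ (Icc a b)ᶜ = 0) (hS : S (Icc a b)ᶜ = 0)
    (hw : ∀ δ < c, ∀ φ φ' : ℝ → ℝ, (∀ x, HasDerivAt φ (φ' x) x) → Continuous φ' →
      (∀ x ≥ δ, φ x = 0) → ∫ x, ((x - c) * φ' x + (σ - 1) * φ x) ∂μ = ∫ x, φ x ∂S) :
    μ.restrict (Iio c) = (volume.restrict (Iio c)).withDensity
      fun ξ => ENNReal.ofReal (leftDensity σ c S ξ) := by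
  set e : ℝ ≃ᵐ ℝ := MeasurableEquiv.subLeft c
  have hee : ∀ x, e x = c - x := fun x => rfl
  have hpre : ∀ s, e ⁻¹' (Ioi s) = Iio (c - s) := by
    intro s; ext x; simp only [mem_preimage, hee, mem_Ioi, mem_Iio]; constructor <;> intro <;> linarith
  have hsupp : e ⁻¹' (Icc (c - b) (c - a))ᶜ = (Icc a b)ᶜ := by
    ext x
    simp only [mem_preimage, hee, mem_compl_iff, mem_Icc, not_iff_not]
    constructor <;> rintro ⟨_, _⟩ <;> constructor <;> linarith
  have hmap := restrict_Ioi_eq_withDensity (σ := σ) (r := 0) (a := c - b) (b := c - a)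
    le_rfl (μ.map e) (S.map e) (by rw [e.map_apply, hsupp, hμ])
    (by rw [e.map_apply, hsupp, hS]) (by
      intro δ hδ φ φ' hφ hφ' h0
      have h := hw (c - δ) (by linarith) (fun x => φ (c - x)) (fun x => -φ' (c - x))
        (fun x => (hφ (c - x)).comp_const_sub c x)
        (by fun_prop) (fun x hx => h0 _ (by linarith))
      rw [integral_map_equiv, integral_map_equiv]
      simp only [hee]
      rw [← h]
      exact integral_congr_ae (Eventually.of_forall fun x => by simp only; ring))
  have h := restrict_preimage_eq_withDensity e (Measure.measurePreserving_sub_left volume c)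
    measurableSet_Ioi hmap
  rw [hpre, sub_zero] at h
  rw [h]
  refine withDensity_congr_ae ((ae_restrict_mem measurableSet_Iio).mono fun ξ hξ => ?_)
  have hξc : ξ < c := hξ
  simp only [hee]
  rw [setLIntegral_map measurableSet_Ioi (by fun_prop) e.measurable, hpre, sub_sub_cancel,
    leftDensity, ENNReal.ofReal_mul (Real.rpow_nonneg (by linarith) _),
    ofReal_integral_eq_lintegral_ofReal (integrableOn_Iio_sub_rpow hS _ hξc)]
  · rfl
  · exact (ae_restrict_mem measurableSet_Iio).mono fun s hs =>
      Real.rpow_nonneg (by have := mem_Iio.1 hs; linarith) _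

/-! ### Positivity, integrability at the singular point -/

theorem rightDensity_pos {S : Measure ℝ} [IsFiniteMeasure S] {a b : ℝ} (hS : S (Icc a b)ᶜ = 0)
    {σ c ξ : ℝ} (h : c < ξ) (hpos : 0 < S (Ioi ξ)) : 0 < rightDensity σ c S ξ := by
  refine mul_pos (Real.rpow_pos_of_pos (by linarith) _) ?_
  have hp : ∀ x ∈ Ioi ξ, 0 < (x - c) ^ (1 - σ) := fun x hx =>
    Real.rpow_pos_of_pos (by have := mem_Ioi.1 hx; linarith) _
  rw [setIntegral_pos_iff_support_of_nonneg_ae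
    ((ae_restrict_mem measurableSet_Ioi).mono fun x hx => (hp x hx).le)
    (integrableOn_Ioi_sub_rpow hS _ h)]
  refine hpos.trans_le (measure_mono fun x hx => ⟨(hp x hx).ne', hx⟩)

theorem leftDensity_pos {S : Measure ℝ} [IsFiniteMeasure S] {a b : ℝ} (hS : S (Icc a b)ᶜ = 0)
    {σ c ξ : ℝ} (h : ξ < c) (hpos : 0 < S (Iio ξ)) : 0 < leftDensity σ c S ξ := by
  refine mul_pos (Real.rpow_pos_of_pos (by linarith) _) ?_
  have hp : ∀ x ∈ Iio ξ, 0 < (c - x) ^ (1 - σ) := fun x hx =>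
    Real.rpow_pos_of_pos (by have := mem_Iio.1 hx; linarith) _
  rw [setIntegral_pos_iff_support_of_nonneg_ae
    ((ae_restrict_mem measurableSet_Iio).mono fun x hx => (hp x hx).le)
    (integrableOn_Iio_sub_rpow hS _ h)]
  refine hpos.trans_le (measure_mono fun x hx => ⟨(hp x hx).ne', hx⟩)

/-- A power `x ^ (σ - 2)` with positive factor has finite mass near `0` only if `1 < σ`. -/
theorem one_lt_of_lintegral_rpow_ne_top {σ t C : ℝ} (ht : 0 < t) (hC : 0 < C)
    (h : ∫⁻ x in Ioo 0 t, ENNReal.ofReal (x ^ (σ - 2) * C) ≠ ⊤) : 1 < σ := by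
  have h1 : IntegrableOn (fun x : ℝ => x ^ (σ - 2) * C) (Ioo 0 t) := by
    refine (lintegral_ofReal_ne_top_iff_integrable ?_ ?_).1 h
    · exact Measurable.aestronglyMeasurable (by fun_prop)
    · exact (ae_restrict_mem measurableSet_Ioo).mono fun x hx =>
        mul_nonneg (Real.rpow_nonneg hx.1.le _) hC.le
  have h2 : IntegrableOn (fun x : ℝ => x ^ (σ - 2)) (Ioo 0 t) := by
    refine (h1.mul_const C⁻¹).congr (Eventually.of_forall fun x => ?_)
    simp only
    field_simp
  have := (intervalIntegral.integrableOn_Ioo_rpow_iff ht).1 h2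
  linarith

/-- On (c, ξ) the integral factor is at least its value C > 0 at ξ. Hence C(x-c)^(σ-2) is dominated
by the density of the finite measure μ and must be integrable at c. -/
theorem one_lt_of_rightDensity {S : Measure ℝ} [IsFiniteMeasure S] {a b : ℝ}
    (hS : S (Icc a b)ᶜ = 0) {μ : Measure ℝ} [IsFiniteMeasure μ] {σ c ξ : ℝ} (hξ : c < ξ)
    (hμ : μ.restrict (Ioi c) = (volume.restrict (Ioi c)).withDensity
      fun ξ => ENNReal.ofReal (rightDensity σ c S ξ)) (hpos : 0 < S (Ioi ξ)) : 1 < σ := by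
  have hp := rightDensity_pos hS (σ := σ) hξ hpos
  have hC : 0 < ∫ s in Ioi ξ, (s - c) ^ (1 - σ) ∂S :=
    (pos_iff_pos_of_mul_pos hp).1 (Real.rpow_pos_of_pos (by linarith) _)
  refine one_lt_of_lintegral_rpow_ne_top (t := ξ - c) (by linarith) hC ?_
  refine ne_top_of_le_ne_top (measure_ne_top μ (Ioo c ξ)) ?_
  have hmp := measurePreserving_sub_right (volume : Measure ℝ) c
  have hpre : (fun x => x - c) ⁻¹' Ioo 0 (ξ - c) = Ioo c ξ := by ext x; simp
  rw [← hmp.setLIntegral_comp_preimage_emb (MeasurableEquiv.subRight c).measurableEmbedding, hpre]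
  have : μ (Ioo c ξ) = ∫⁻ x in Ioo c ξ, ENNReal.ofReal (rightDensity σ c S x) := by
    have h1 := congrArg (fun ρ : Measure ℝ => ρ (Ioo c ξ)) hμ
    simpa only [Measure.restrict_apply measurableSet_Ioo, withDensity_apply _ measurableSet_Ioo,
      Measure.restrict_restrict measurableSet_Ioo,
      inter_eq_left.2 (Ioo_subset_Ioi_self : Ioo c ξ ⊆ Ioi c)] using h1
  rw [this]
  refine setLIntegral_mono' measurableSet_Ioo fun x hx => ENNReal.ofReal_le_ofReal ?_
  refine mul_le_mul_of_nonneg_left ?_ (Real.rpow_nonneg (by linarith [hx.1]) _)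
  exact setIntegral_mono_set (integrableOn_Ioi_sub_rpow hS _ hx.1)
    ((ae_restrict_mem measurableSet_Ioi).mono fun s hs =>
      Real.rpow_nonneg (by have := mem_Ioi.1 hs; linarith [hx.1]) _)
    (Ioi_subset_Ioi hx.2.le).eventuallyLE

theorem one_lt_of_leftDensity {S : Measure ℝ} [IsFiniteMeasure S] {a b : ℝ}
    (hS : S (Icc a b)ᶜ = 0) {μ : Measure ℝ} [IsFiniteMeasure μ] {σ c ξ : ℝ} (hξ : ξ < c)
    (hμ : μ.restrict (Iio c) = (volume.restrict (Iio c)).withDensity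
      fun ξ => ENNReal.ofReal (leftDensity σ c S ξ)) (hpos : 0 < S (Iio ξ)) : 1 < σ := by
  have hp := leftDensity_pos hS (σ := σ) hξ hpos
  have hC : 0 < ∫ s in Iio ξ, (c - s) ^ (1 - σ) ∂S :=
    (pos_iff_pos_of_mul_pos hp).1 (Real.rpow_pos_of_pos (by linarith) _)
  refine one_lt_of_lintegral_rpow_ne_top (t := c - ξ) (by linarith) hC ?_
  refine ne_top_of_le_ne_top (measure_ne_top μ (Ioo ξ c)) ?_
  have hmp := Measure.measurePreserving_sub_left (volume : Measure ℝ) c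
  have hpre : (fun x => c - x) ⁻¹' Ioo 0 (c - ξ) = Ioo ξ c := by ext x; simp
  rw [← hmp.setLIntegral_comp_preimage_emb (MeasurableEquiv.subLeft c).measurableEmbedding, hpre]
  have : μ (Ioo ξ c) = ∫⁻ x in Ioo ξ c, ENNReal.ofReal (leftDensity σ c S x) := by
    have h1 := congrArg (fun ρ : Measure ℝ => ρ (Ioo ξ c)) hμ
    simpa only [Measure.restrict_apply measurableSet_Ioo, withDensity_apply _ measurableSet_Ioo,
      Measure.restrict_restrict measurableSet_Ioo,
      inter_eq_left.2 (Ioo_subset_Iio_self : Ioo ξ c ⊆ Iio c)] using h1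
  rw [this]
  refine setLIntegral_mono' measurableSet_Ioo fun x hx => ENNReal.ofReal_le_ofReal ?_
  refine mul_le_mul_of_nonneg_left ?_ (Real.rpow_nonneg (by linarith [hx.2]) _)
  exact setIntegral_mono_set (integrableOn_Iio_sub_rpow hS _ hx.2)
    ((ae_restrict_mem measurableSet_Iio).mono fun s hs =>
      Real.rpow_nonneg (by have := mem_Iio.1 hs; linarith [hx.2]) _)
    (Iio_subset_Iio hx.1.le).eventuallyLE

/-! ### Regularity of the variation of constants formula -/

/-- The tail integral jumps only at atoms of S. It is a constant minus a primitive based at an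
intermediate point p, because integrability is available only away from c. -/
theorem continuousOn_setIntegral_Ioi {S : Measure ℝ} [NullSingletonClass S] {f : ℝ → ℝ} {c : ℝ}
    (hf : ∀ p > c, IntegrableOn f (Ioi p) S) :
    ContinuousOn (fun ξ => ∫ s in Ioi ξ, f s ∂S) (Ioi c) := by
  intro ξ hξ
  refine ContinuousAt.continuousWithinAt ?_
  obtain ⟨p, hcp, hpξ⟩ := exists_between (mem_Ioi.1 hξ)
  have hint : Integrable ((Ioi p).indicator f) S :=
    (integrable_indicator_iff measurableSet_Ioi).2 (hf p hcp)
  have hc : Continuous fun y => ∫ s in p..y, (Ioi p).indicator f s ∂S :=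
    intervalIntegral.continuous_primitive (fun _ _ => hint.intervalIntegrable) p
  refine ((continuous_const (y := ∫ s in Ioi p, f s ∂S)).sub hc).continuousAt.congr ?_
  filter_upwards [Ioi_mem_nhds hpξ] with y hy
  have hy' : p ≤ y := le_of_lt hy
  have : ∫ s in p..y, (Ioi p).indicator f s ∂S = ∫ s in p..y, f s ∂S := by
    rw [intervalIntegral.integral_of_le hy', intervalIntegral.integral_of_le hy']
    exact setIntegral_congr_fun measurableSet_Ioc fun s hs => by simp [hs.1]
  rw [Pi.sub_apply, this, ← intervalIntegral.integral_Ioi_sub_Ioi (hf p hcp) hy']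
  ring

theorem continuousOn_setIntegral_Iio {S : Measure ℝ} [NullSingletonClass S] {f : ℝ → ℝ} {c : ℝ}
    (hf : ∀ p < c, IntegrableOn f (Iio p) S) :
    ContinuousOn (fun ξ => ∫ s in Iio ξ, f s ∂S) (Iio c) := by
  intro ξ hξ
  refine ContinuousAt.continuousWithinAt ?_
  obtain ⟨p, hpξ, hcp⟩ := exists_between (mem_Iio.1 hξ)
  have hf' : ∀ q ≤ p, IntegrableOn f (Iic q) S := fun q hq => by
    rw [integrableOn_Iic_iff_integrableOn_Iio]
    exact hf q (hq.trans_lt hcp)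
  have hint : Integrable ((Iic p).indicator f) S :=
    (integrable_indicator_iff measurableSet_Iic).2 (hf' p le_rfl)
  have hc : Continuous fun y => ∫ s in p..y, (Iic p).indicator f s ∂S :=
    intervalIntegral.continuous_primitive (fun _ _ => hint.intervalIntegrable) p
  refine ((continuous_const (y := ∫ s in Iic p, f s ∂S)).add hc).continuousAt.congr ?_
  filter_upwards [Iio_mem_nhds hpξ] with y hy
  have hy' : y ≤ p := le_of_lt hy
  have : ∫ s in p..y, (Iic p).indicator f s ∂S = ∫ s in p..y, f s ∂S := by
    rw [intervalIntegral.integral_of_ge hy', intervalIntegral.integral_of_ge hy']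
    congr 1
    exact setIntegral_congr_fun measurableSet_Ioc fun s hs => by simp [hs.2]
  rw [Pi.add_apply, this, ← intervalIntegral.integral_Iic_sub_Iic (hf' p le_rfl) (hf' y hy'),
    ← integral_Iic_eq_integral_Iio]
  ring

theorem continuousOn_rightDensity {S : Measure ℝ} [IsFiniteMeasure S] [NullSingletonClass S]
    {a b : ℝ} (hS : S (Icc a b)ᶜ = 0) (σ c : ℝ) :
    ContinuousOn (rightDensity σ c S) (Ioi c) := by
  refine ContinuousOn.mul (fun x hx => ContinuousAt.continuousWithinAt ?_)
    (continuousOn_setIntegral_Ioi fun p hp => integrableOn_Ioi_sub_rpow hS _ hp)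
  exact ContinuousAt.rpow_const (by fun_prop) (Or.inl (by have := mem_Ioi.1 hx; linarith))

theorem continuousOn_leftDensity {S : Measure ℝ} [IsFiniteMeasure S] [NullSingletonClass S]
    {a b : ℝ} (hS : S (Icc a b)ᶜ = 0) (σ c : ℝ) :
    ContinuousOn (leftDensity σ c S) (Iio c) := by
  refine ContinuousOn.mul (fun x hx => ContinuousAt.continuousWithinAt ?_)
    (continuousOn_setIntegral_Iio fun p hp => integrableOn_Iio_sub_rpow hS _ hp)
  exact ContinuousAt.rpow_const (by fun_prop) (Or.inl (by have := mem_Iio.1 hx; linarith))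

theorem setIntegral_withDensity_ofReal {s : ℝ → ℝ} (hs : Measurable s) (hs0 : ∀ x, 0 ≤ s x)
    (f : ℝ → ℝ) {E : Set ℝ} (hE : MeasurableSet E) :
    ∫ x in E, f x ∂(volume.withDensity fun x => ENNReal.ofReal (s x)) = ∫ x in E, s x * f x := by
  rw [restrict_withDensity hE, integral_withDensity_eq_integral_toReal_smul (by fun_prop)
    (Eventually.of_forall fun x => ENNReal.ofReal_lt_top)]
  refine integral_congr_ae (Eventually.of_forall fun x => ?_)
  simp [ENNReal.toReal_ofReal (hs0 x)]

theorem integrableOn_withDensity_ofReal {s : ℝ → ℝ} (hs : Measurable s) (hs0 : ∀ x, 0 ≤ s x)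
    {f : ℝ → ℝ} {E : Set ℝ} (hE : MeasurableSet E)
    (hf : IntegrableOn f E (volume.withDensity fun x => ENNReal.ofReal (s x))) :
    IntegrableOn (fun x => s x * f x) E := by
  rw [IntegrableOn, restrict_withDensity hE, integrable_withDensity_iff_integrable_smul'
    (by fun_prop) (Eventually.of_forall fun x => ENNReal.ofReal_lt_top)] at hf
  refine hf.congr (Eventually.of_forall fun x => ?_)
  simp [ENNReal.toReal_ofReal (hs0 x)]

theorem hasDerivAt_setIntegral_Ioi {f : ℝ → ℝ} (hm : Measurable f) {p ξ : ℝ} (hpξ : p < ξ)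
    (hf : IntegrableOn f (Ioi p)) (hc : ContinuousAt f ξ) :
    HasDerivAt (fun y => ∫ s in Ioi y, f s) (-f ξ) ξ := by
  have h1 : HasDerivAt (fun y => ∫ s in p..y, f s) (f ξ) ξ :=
    intervalIntegral.integral_hasDerivAt_right
      ((intervalIntegrable_iff_integrableOn_Ioc_of_le hpξ.le).2 (hf.mono_set Ioc_subset_Ioi_self))
      hm.stronglyMeasurable.stronglyMeasurableAtFilter hc
  refine (h1.const_sub (∫ s in Ioi p, f s)).congr_of_eventuallyEq ?_
  filter_upwards [Ioi_mem_nhds hpξ] with y hy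
  rw [← intervalIntegral.integral_Ioi_sub_Ioi hf (le_of_lt hy)]
  ring

theorem hasDerivAt_setIntegral_Iio {f : ℝ → ℝ} (hm : Measurable f) {p ξ : ℝ} (hpξ : ξ < p)
    (hf : IntegrableOn f (Iio p)) (hc : ContinuousAt f ξ) :
    HasDerivAt (fun y => ∫ s in Iio y, f s) (f ξ) ξ := by
  have hf' : ∀ q ≤ p, IntegrableOn f (Iic q) := fun q hq => by
    rw [integrableOn_Iic_iff_integrableOn_Iio]
    exact hf.mono_set (Iio_subset_Iio hq)
  have h1 : HasDerivAt (fun y => ∫ s in p..y, f s) (f ξ) ξ :=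
    intervalIntegral.integral_hasDerivAt_right
      (intervalIntegrable_iff_integrableOn_Ioc_of_le hpξ.le |>.2
        ((hf' p le_rfl).mono_set Ioc_subset_Iic_self)).symm
      hm.stronglyMeasurable.stronglyMeasurableAtFilter hc
  refine (h1.const_add (∫ s in Iic p, f s)).congr_of_eventuallyEq ?_
  filter_upwards [Iio_mem_nhds hpξ] with y hy
  rw [← intervalIntegral.integral_Iic_sub_Iic (hf' p le_rfl) (hf' y (le_of_lt hy)),
    ← integral_Iic_eq_integral_Iio]
  ring

/-- The product rule recovers the pointwise ODE: the prefactor contributes (σ-2)/(ξ-c) times the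
density, and the powers in the other term collapse to s/(ξ-c). Continuity of s is needed only at ξ.
-/
theorem hasDerivAt_rightDensity {s : ℝ → ℝ} (hs : Measurable s) (hs0 : ∀ x, 0 ≤ s x)
    {S : Measure ℝ} [IsFiniteMeasure S] (hSs : S = volume.withDensity fun x => ENNReal.ofReal (s x))
    {a b : ℝ} (hS : S (Icc a b)ᶜ = 0) {σ c ξ : ℝ} (hξ : c < ξ) (hc : ContinuousAt s ξ) :
    HasDerivAt (rightDensity σ c S) (((σ - 2) * rightDensity σ c S ξ - s ξ) / (ξ - c)) ξ := by
  have hx : 0 < ξ - c := by linarith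
  obtain ⟨p, hcp, hpξ⟩ := exists_between hξ
  have hint := integrableOn_Ioi_sub_rpow hS (1 - σ) hcp
  have hI : HasDerivAt (fun y => ∫ x in Ioi y, (x - c) ^ (1 - σ) ∂S)
      (-(s ξ * (ξ - c) ^ (1 - σ))) ξ := by
    simp_rw [hSs, setIntegral_withDensity_ofReal hs hs0 _ measurableSet_Ioi]
    refine hasDerivAt_setIntegral_Ioi (by fun_prop) hpξ
      (integrableOn_withDensity_ofReal hs hs0 measurableSet_Ioi (hSs ▸ hint)) ?_
    exact hc.mul (ContinuousAt.rpow_const (by fun_prop) (Or.inl hx.ne'))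
  have hp : HasDerivAt (fun y : ℝ => (y - c) ^ (σ - 2)) ((σ - 2) * (ξ - c) ^ (σ - 2 - 1)) ξ :=
    (Real.hasDerivAt_rpow_const (Or.inl hx.ne')).comp_sub_const ξ c
  refine (hp.mul hI).congr_deriv ?_
  have e2 : (ξ - c) ^ (σ - 2) * (ξ - c) ^ (1 - σ) = 1 / (ξ - c) := by
    rw [← Real.rpow_add hx, show σ - 2 + (1 - σ) = -1 by ring, Real.rpow_neg_one, one_div]
  rw [rightDensity, Real.rpow_sub_one hx.ne',
    show ∀ A B C D E : ℝ, A * D + B * -(C * E) = A * D - C * (B * E) by intros; ring, e2]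
  field_simp

theorem hasDerivAt_leftDensity {s : ℝ → ℝ} (hs : Measurable s) (hs0 : ∀ x, 0 ≤ s x)
    {S : Measure ℝ} [IsFiniteMeasure S] (hSs : S = volume.withDensity fun x => ENNReal.ofReal (s x))
    {a b : ℝ} (hS : S (Icc a b)ᶜ = 0) {σ c ξ : ℝ} (hξ : ξ < c) (hc : ContinuousAt s ξ) :
    HasDerivAt (leftDensity σ c S) (((σ - 2) * leftDensity σ c S ξ - s ξ) / (ξ - c)) ξ := by
  have hx : 0 < c - ξ := by linarith
  have hx' : ξ - c ≠ 0 := by linarith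
  obtain ⟨p, hpξ, hcp⟩ := exists_between hξ
  have hint := integrableOn_Iio_sub_rpow hS (1 - σ) hcp
  have hI : HasDerivAt (fun y => ∫ x in Iio y, (c - x) ^ (1 - σ) ∂S)
      (s ξ * (c - ξ) ^ (1 - σ)) ξ := by
    simp_rw [hSs, setIntegral_withDensity_ofReal hs hs0 _ measurableSet_Iio]
    refine hasDerivAt_setIntegral_Iio (by fun_prop) hpξ
      (integrableOn_withDensity_ofReal hs hs0 measurableSet_Iio (hSs ▸ hint)) ?_
    exact hc.mul (ContinuousAt.rpow_const (by fun_prop) (Or.inl hx.ne'))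
  have hp : HasDerivAt (fun y : ℝ => (c - y) ^ (σ - 2)) (-((σ - 2) * (c - ξ) ^ (σ - 2 - 1))) ξ :=
    (Real.hasDerivAt_rpow_const (Or.inl hx.ne')).comp_const_sub c ξ
  refine (hp.mul hI).congr_deriv ?_
  have e2 : (c - ξ) ^ (σ - 2) * (c - ξ) ^ (1 - σ) = 1 / (c - ξ) := by
    rw [← Real.rpow_add hx, show σ - 2 + (1 - σ) = -1 by ring, Real.rpow_neg_one, one_div]
  rw [leftDensity, Real.rpow_sub_one hx.ne',
    show ∀ A B C D E : ℝ, A * D + B * (C * E) = A * D + C * (B * E) by intros; ring, e2,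
    show ξ - c = -(c - ξ) by ring]
  field_simp
  ring

/-! ### The coupling operator -/

/-- The coefficient of `f_{n+1}` in `(J f)_n`. -/
noncomputable def upCoeff (β : ℝ) (N n : ℕ) : ℝ := if n = N then 0 else (β + 1) * ((n : ℝ) + 1)

/-- The coefficient of `f_{n-1}` in `(J f)_n`. -/
noncomputable def downCoeff (β : ℝ) (n : ℕ) : ℝ := if n = 2 then 0 else β * ((n : ℝ) - 1)

theorem upCoeff_nonneg {β : ℝ} (hβ : 0 < β) (N n : ℕ) : 0 ≤ upCoeff β N n := by
  unfold upCoeff; split_ifs <;> positivity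

theorem downCoeff_nonneg {β : ℝ} (hβ : 0 < β) {n : ℕ} (hn : 2 ≤ n) : 0 ≤ downCoeff β n := by
  have : (2 : ℝ) ≤ n := by exact_mod_cast hn
  unfold downCoeff; split_ifs
  · exact le_rfl
  · exact mul_nonneg hβ.le (by linarith)

theorem upCoeff_pos {β : ℝ} (hβ : 0 < β) {N n : ℕ} (hn : n ≠ N) : 0 < upCoeff β N n := by
  rw [upCoeff, if_neg hn]; positivity

theorem downCoeff_pos {β : ℝ} (hβ : 0 < β) {n : ℕ} (hn : 2 < n) : 0 < downCoeff β n := by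
  have : (2 : ℝ) < n := by exact_mod_cast hn
  rw [downCoeff, if_neg hn.ne']
  exact mul_pos hβ (by linarith)

theorem coupling_eq (β : ℝ) {N : ℕ} (hN : 2 < N) (f : ℕ → ℝ) (n : ℕ) :
    coupling β N f n =
      upCoeff β N n * f (n + 1) + downCoeff β n * f (n - 1) - kappa β N n * f n := by
  unfold coupling upCoeff downCoeff kappa
  by_cases h2 : n = 2
  · subst h2
    simp only [if_true, if_neg hN.ne]
    push_cast; ring
  · by_cases hn : n = N
    · subst hn; simp [h2]
    · simp only [h2, hn, if_false]; ring

theorem tendsto_coupling {ι : Type*} {l : Filter ι} {β : ℝ} {N : ℕ} (hN : 2 < N)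
    {f : ι → ℕ → ℝ} {F : ℕ → ℝ} (h : ∀ m ∈ Finset.Icc 2 N, Tendsto (fun j => f j m) l (𝓝 (F m)))
    {n : ℕ} (hn : n ∈ Finset.Icc 2 N) :
    Tendsto (fun j => coupling β N (f j) n) l (𝓝 (coupling β N F n)) := by
  rw [Finset.mem_Icc] at hn
  simp_rw [coupling_eq β hN]
  refine ((?_ : Tendsto _ _ _).add ?_).sub ((h n (Finset.mem_Icc.2 hn)).const_mul _)
  · by_cases hnN : n = N
    · simpa [upCoeff, hnN] using tendsto_const_nhds
    · exact (h _ (Finset.mem_Icc.2 (by omega))).const_mul _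
  · by_cases hn2 : n = 2
    · simpa [downCoeff, hn2] using tendsto_const_nhds
    · exact (h _ (Finset.mem_Icc.2 (by omega))).const_mul _

/-- J is a discrete divergence, so partial sums telescope to the net flux from class M+1 into class
M. The flux out of the top class is zero, hence grains are conserved. -/
theorem sum_coupling_lt (β : ℝ) {N : ℕ} (f : ℕ → ℝ) {M : ℕ} (hM : 2 ≤ M) (hMN : M < N) :
    ∑ n ∈ Finset.Icc 2 M, coupling β N f n =
      (β + 1) * (M + 1) * f (M + 1) - β * M * f M := by
  induction M, hM using Nat.le_induction with
  | base => simp [coupling]; ring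
  | succ M hM ih =>
    rw [Finset.sum_Icc_succ_top (by omega), ih (by omega), coupling, if_neg (by omega),
      if_neg (by omega)]
    push_cast
    ring

theorem sum_coupling (β : ℝ) {N : ℕ} (hN : 2 < N) (f : ℕ → ℝ) :
    ∑ n ∈ Finset.Icc 2 N, coupling β N f n = 0 := by
  obtain ⟨M, rfl⟩ : ∃ M, N = M + 1 := ⟨N - 1, by omega⟩
  rw [Finset.sum_Icc_succ_top (by omega), sum_coupling_lt β f (by omega) (by omega), coupling,
    if_neg (by omega), if_pos rfl]
  push_cast
  ring

/-- Abel summation of the fluxes. The term in f 2 appears because the gain part of the flux starts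
at class 3 and the loss part at class 2. -/
theorem sum_mul_coupling_lt (β : ℝ) {N : ℕ} (f : ℕ → ℝ) {M : ℕ} (hM : 2 ≤ M) (hMN : M < N) :
    ∑ n ∈ Finset.Icc 2 M, (n : ℝ) * coupling β N f n =
      (M + 1) * ((β + 1) * (M + 1) * f (M + 1) - β * M * f M)
        - ∑ n ∈ Finset.Icc 2 M, (n : ℝ) * f n - (β + 1) * (M + 1) * f (M + 1)
        + 2 * (β + 1) * f 2 := by
  induction M, hM using Nat.le_induction with
  | base => simp [coupling]; ring
  | succ M hM ih =>
    rw [Finset.sum_Icc_succ_top (by omega), Finset.sum_Icc_succ_top (by omega), ih (by omega),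
      coupling, if_neg (by omega), if_neg (by omega)]
    push_cast
    ring

/-- Conservation removes the constant weight 6, which turns the leading part of the discrete
denominator into the expression used in `gammaDen`. -/
theorem sum_defect_mul_coupling (β : ℝ) {N : ℕ} (hN : 2 < N) (f : ℕ → ℝ) :
    ∑ n ∈ Finset.Icc 2 N, (6 - (n : ℝ)) * coupling β N f n =
      β * N * f N - 2 * (β + 1) * f 2 + ∑ n ∈ Finset.Icc 2 N, (n : ℝ) * f n := by
  have h : ∑ n ∈ Finset.Icc 2 N, (6 - (n : ℝ)) * coupling β N f n =
      6 * ∑ n ∈ Finset.Icc 2 N, coupling β N f n -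
        ∑ n ∈ Finset.Icc 2 N, (n : ℝ) * coupling β N f n := by
    rw [Finset.mul_sum, ← Finset.sum_sub_distrib]
    exact Finset.sum_congr rfl fun n _ => by ring
  rw [h, sum_coupling β hN]
  obtain ⟨M, rfl⟩ : ∃ M, N = M + 1 := ⟨N - 1, by omega⟩
  rw [Finset.sum_Icc_succ_top (by omega), Finset.sum_Icc_succ_top (by omega),
    sum_mul_coupling_lt β f (by omega) (by omega), coupling, if_neg (by omega), if_pos rfl]
  push_cast
  ring

/-! ### Summation by parts -/

theorem sum_mul_forward_sub (u g : ℕ → ℝ) (m : ℕ) :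
    ∑ k ∈ Finset.Icc 1 m, u k * (g (k + 1) - g k) =
      u m * g (m + 1) - u 0 * g 1 - ∑ k ∈ Finset.Icc 1 m, (u k - u (k - 1)) * g k := by
  induction m with
  | zero => simp
  | succ m ih =>
    rw [Finset.sum_Icc_succ_top (by omega), Finset.sum_Icc_succ_top (by omega), ih]
    simp only [Nat.add_sub_cancel]
    ring

theorem sum_mul_backward_sub (u g : ℕ → ℝ) (m : ℕ) :
    ∑ k ∈ Finset.Icc 1 m, u k * (g k - g (k - 1)) =
      u (m + 1) * g m - u 1 * g 0 + ∑ k ∈ Finset.Icc 1 m, (u k - u (k + 1)) * g k := by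
  induction m with
  | zero => simp
  | succ m ih =>
    rw [Finset.sum_Icc_succ_top (by omega), Finset.sum_Icc_succ_top (by omega), ih]
    simp only [Nat.add_sub_cancel]
    ring

/-! ### Sums over the grid -/

/-- The Riemann sum `ε ∑ φ(ξ_k) u_k`. -/
noncomputable def gridSum (L K : ℕ) (φ : ℝ → ℝ) (u : ℕ → ℝ) : ℝ :=
  mesh L K * ∑ k ∈ Finset.Icc 1 (K - 1), φ (gridPoint L K k) * u k

/-- The operator dual to `-2 + upwind`. -/
noncomputable def dualUpwind (L K n : ℕ) (φ : ℝ → ℝ) (k : ℕ) : ℝ :=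
  -2 * φ (gridPoint L K k)
    + (max (gridPoint L K k + 6 - n) 0 * φ (gridPoint L K k)
      - max (gridPoint L K (k - 1) + 6 - n) 0 * φ (gridPoint L K (k - 1))) / mesh L K
    + (max (-(gridPoint L K k + 6 - n)) 0 * φ (gridPoint L K k)
      - max (-(gridPoint L K (k + 1) + 6 - n)) 0 * φ (gridPoint L K (k + 1))) / mesh L K
    + (if gridPoint L K k = (n : ℝ) - 6 then φ (gridPoint L K k) else 0)

section grid

variable {L K : ℕ}

theorem exists_mesh_mul_eq_one (hK : 0 < K) (hLK : L ∣ K) :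
    ∃ p : ℕ, 0 < p ∧ K = L * p ∧ mesh L K * p = 1 := by
  obtain ⟨p, rfl⟩ := hLK
  have hp : 0 < p := Nat.pos_of_mul_pos_left hK
  have hL : 0 < L := Nat.pos_of_mul_pos_right hK
  refine ⟨p, hp, rfl, ?_⟩
  rw [mesh]
  push_cast
  field_simp

theorem mesh_pos (hK : 0 < K) (hLK : L ∣ K) : 0 < mesh L K := by
  have hL : 0 < L := Nat.pos_of_dvd_of_pos hLK hK
  rw [mesh]; positivity

theorem gridPoint_self (hK : 0 < K) : gridPoint L K K = L := by
  rw [gridPoint, mesh]; field_simp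

theorem gridPoint_succ (k : ℕ) : gridPoint L K (k + 1) = gridPoint L K k + mesh L K := by
  rw [gridPoint, gridPoint]; push_cast; ring

theorem gridPoint_mem (hK : 0 < K) (hLK : L ∣ K) {k : ℕ} (hk : k ≤ K) :
    gridPoint L K k ∈ Icc (0 : ℝ) L := by
  have hε := mesh_pos hK hLK
  refine ⟨by rw [gridPoint]; positivity, ?_⟩
  rw [← gridPoint_self (L := L) hK, gridPoint, gridPoint]
  exact mul_le_mul_of_nonneg_right (by exact_mod_cast hk) hε.le

/-- Since L divides K, 1/ε is an integer. The coefficient ξ_k + 6 - n therefore changes sign by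
passing exactly through zero at a grid point, never inside a cell. -/
theorem gridPoint_add_eq_mul_int (hK : 0 < K) (hLK : L ∣ K) (n : ℕ) :
    ∃ z : ℕ → ℤ, (∀ k, z (k + 1) = z k + 1) ∧
      ∀ k, gridPoint L K k + 6 - n = mesh L K * z k := by
  obtain ⟨p, hp, hKp, hmp⟩ := exists_mesh_mul_eq_one hK hLK
  refine ⟨fun k => k + (6 - n) * p, fun k => by push_cast; ring, fun k => ?_⟩
  rw [gridPoint]
  push_cast
  linear_combination -(6 - (n : ℝ)) * hmp

/-- Of the four boundary terms only the outflow of the classes n ≤ 5 through ξ = 0 survives. -/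
theorem sum_mul_upwind {N : ℕ} {g : ℕ → ℕ → ℝ} (hK : 0 < K) (hLK : L ∣ K) (hL : N < L + 6)
    (hl : ∀ n ∈ Finset.Icc 7 N, g n 0 = 0) (hr : ∀ n ∈ Finset.Icc 2 N, g n K = 0) {n : ℕ}
    (hn : n ∈ Finset.Icc 2 N) (φ : ℝ → ℝ) :
    mesh L K * ∑ k ∈ Finset.Icc 1 (K - 1),
        φ (gridPoint L K k) * (-2 * g n k + upwind L K g n k) =
      mesh L K * ∑ k ∈ Finset.Icc 1 (K - 1), dualUpwind L K n φ k * g n k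
        + max (6 - (n : ℝ)) 0 * φ 0 * g n 1 := by
  have hε := mesh_pos hK hLK
  have hn' := Finset.mem_Icc.1 hn
  obtain ⟨m, rfl⟩ : ∃ m, K = m + 1 := ⟨K - 1, by omega⟩
  set ε := mesh L (m + 1) with hεd
  set a : ℕ → ℝ := fun k => gridPoint L (m + 1) k + 6 - n with ha
  set f : ℕ → ℝ := fun k => φ (gridPoint L (m + 1) k) with hf
  simp only [Nat.add_sub_cancel]
  have h1 := sum_mul_forward_sub (fun k => max (a k) 0 * f k) (g n) m
  have h2 := sum_mul_backward_sub (fun k => max (-a k) 0 * f k) (g n) m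
  have hb1 : g n (m + 1) = 0 := hr n hn
  -- For n ≥ 7 the boundary value is zero; for n ≤ 6 the upwind coefficient is, so no value of g at
  -- 0 is required.
  have hb2 : max (-a 1) 0 * g n 0 = 0 := by
    rcases le_or_gt 7 n with h7 | h7
    · rw [hl n (Finset.mem_Icc.2 ⟨h7, hn'.2⟩), mul_zero]
    · have h7' : (n : ℝ) ≤ 6 := by exact_mod_cast (by omega : n ≤ 6)
      have : -a 1 ≤ 0 := by
        simp only [ha, gridPoint, Nat.cast_one, one_mul]
        linarith
      rw [max_eq_right this, zero_mul]
  have hb3 : max (-a (m + 1)) 0 = 0 := by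
    have hn6 : (n : ℝ) ≤ L + 6 := by exact_mod_cast (by omega : n ≤ L + 6)
    refine max_eq_right ?_
    simp only [ha]
    rw [gridPoint_self hK]
    linarith
  have ha0 : a 0 = 6 - n := by simp [ha, gridPoint]
  have hf0 : f 0 = φ 0 := by simp [hf, gridPoint]
  simp only [hb1, hb3, ha0, hf0] at h1 h2
  have e1 : ∑ k ∈ Finset.Icc 1 m, f k * (-2 * g n k + upwind L (m + 1) g n k) =
      ∑ k ∈ Finset.Icc 1 m, (-2 * f k * g n k + (if gridPoint L (m + 1) k = (n : ℝ) - 6 then f k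
        else 0) * g n k) - (∑ k ∈ Finset.Icc 1 m, max (a k) 0 * f k * (g n (k + 1) - g n k)) / ε
      + (∑ k ∈ Finset.Icc 1 m, max (-a k) 0 * f k * (g n k - g n (k - 1))) / ε := by
    rw [Finset.sum_div, Finset.sum_div, ← Finset.sum_sub_distrib, ← Finset.sum_add_distrib]
    refine Finset.sum_congr rfl fun k _ => ?_
    simp only [upwind, ha]
    split_ifs <;> ring
  have e2 : ∑ k ∈ Finset.Icc 1 m, dualUpwind L (m + 1) n φ k * g n k =
      ∑ k ∈ Finset.Icc 1 m, (-2 * f k * g n k + (if gridPoint L (m + 1) k = (n : ℝ) - 6 then f k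
        else 0) * g n k)
      + (∑ k ∈ Finset.Icc 1 m, (max (a k) 0 * f k - max (a (k - 1)) 0 * f (k - 1)) * g n k) / ε
      + (∑ k ∈ Finset.Icc 1 m, (max (-a k) 0 * f k - max (-a (k + 1)) 0 * f (k + 1)) * g n k)
        / ε := by
    rw [Finset.sum_div, Finset.sum_div, ← Finset.sum_add_distrib, ← Finset.sum_add_distrib]
    refine Finset.sum_congr rfl fun k _ => ?_
    simp only [dualUpwind, ha, hf, hεd]
    ring
  simp only [hf] at e1 e2
  rw [e1, e2]
  simp only [hf] at h1 h2
  rw [h1, h2]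
  have hb2' : max (-a 1) 0 * φ (gridPoint L (m + 1) 1) * g n 0 = 0 := by
    rw [mul_right_comm, hb2, zero_mul]
  rw [hb2']
  field_simp
  ring

end grid

/-! ### Consistency of the dual scheme and quadrature errors -/

section convergence

variable {L K : ℕ}

theorem abs_slope_sub_le {φ φ' : ℝ → ℝ} {R x y ε η : ℝ} (hφ : ∀ ξ ∈ Icc 0 R, HasDerivAt φ (φ' ξ) ξ)
    (hη : ∀ x ∈ Icc 0 R, ∀ y ∈ Icc 0 R, |x - y| ≤ ε → |φ' x - φ' y| ≤ η) (hxy : x < y)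
    (hx : x ∈ Icc 0 R) (hy : y ∈ Icc 0 R) (hε : y - x = ε) {z : ℝ} (hz : z = x ∨ z = y) :
    |(φ y - φ x) / ε - φ' z| ≤ η := by
  have hsub : Icc x y ⊆ Icc 0 R := Icc_subset_Icc hx.1 hy.2
  obtain ⟨w, hw, hw'⟩ := exists_hasDerivAt_eq_slope φ φ' hxy
    (fun t ht => (hφ t (hsub ht)).continuousAt.continuousWithinAt)
    (fun t ht => hφ t (hsub (Ioo_subset_Icc_self ht)))
  rw [← hε, ← hw']
  refine hη w (hsub (Ioo_subset_Icc_self hw)) z (by rcases hz with rfl | rfl <;> assumption) ?_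
  rw [abs_le]
  rcases hz with rfl | rfl <;> constructor <;> linarith [hw.1, hw.2]

/-- The discrete product rule leaves one increment of φ and one difference quotient of φ, each with
error η. Uniform continuity of φ and φ' suffices, so C¹ test functions are enough. -/
theorem abs_dualUpwind_sub_le (hK : 0 < K) (hLK : L ∣ K) {φ φ' : ℝ → ℝ} {η C : ℝ}
    (hφ : ∀ ξ ∈ Icc (0 : ℝ) L, HasDerivAt φ (φ' ξ) ξ)
    (hη : ∀ x ∈ Icc (0 : ℝ) L, ∀ y ∈ Icc (0 : ℝ) L, |x - y| ≤ mesh L K → |φ x - φ y| ≤ η)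
    (hη' : ∀ x ∈ Icc (0 : ℝ) L, ∀ y ∈ Icc (0 : ℝ) L, |x - y| ≤ mesh L K → |φ' x - φ' y| ≤ η)
    {n k : ℕ} (hC : |gridPoint L K k + 6 - n| ≤ C) (hk : k ∈ Finset.Icc 1 (K - 1)) :
    |dualUpwind L K n φ k - ((gridPoint L K k + 6 - n) * φ' (gridPoint L K k)
      - φ (gridPoint L K k))| ≤ η * (1 + C) := by
  have hε := mesh_pos hK hLK
  obtain ⟨hk1, hk2⟩ := Finset.mem_Icc.1 hk
  obtain ⟨i, rfl⟩ : ∃ i, k = i + 1 := ⟨k - 1, by omega⟩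
  obtain ⟨z, hz, ha⟩ := gridPoint_add_eq_mul_int hK hLK n
  have m0 := gridPoint_mem hK hLK (show i ≤ K by omega)
  have m1 := gridPoint_mem hK hLK (show i + 1 ≤ K by omega)
  have m2 := gridPoint_mem hK hLK (show i + 1 + 1 ≤ K by omega)
  have s1 := gridPoint_succ (L := L) (K := K) i
  have s2 := gridPoint_succ (L := L) (K := K) (i + 1)
  have ha0 := ha i
  have ha1 := ha (i + 1)
  have ha2 := ha (i + 1 + 1)
  have hη0 : 0 ≤ η := (abs_nonneg _).trans (hη _ m0 _ m0 (by simpa using hε.le))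
  simp only [dualUpwind, Nat.add_sub_cancel]
  generalize gridPoint L K i = x0 at *
  generalize gridPoint L K (i + 1) = x1 at *
  generalize gridPoint L K (i + 1 + 1) = x2 at *
  generalize mesh L K = ε at *
  have hC0 : 0 ≤ C := (abs_nonneg _).trans hC
  have split : ∀ d e : ℝ, |d| ≤ η → |e| ≤ η → |d + (x1 + 6 - n) * e| ≤ η * (1 + C) := by
    intro d e hd he
    calc |d + (x1 + 6 - n) * e| ≤ |d| + |x1 + 6 - n| * |e| := by
          rw [← abs_mul]; exact abs_add_le _ _
      _ ≤ η + C * η := add_le_add hd (mul_le_mul hC he (abs_nonneg _) hC0)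
      _ = η * (1 + C) := by ring
  rw [hz i] at ha1
  rw [hz (i + 1), hz i] at ha2
  push_cast at ha1 ha2
  rcases lt_trichotomy (z i + 1) 0 with hneg | hzero | hpos
  · have hz2 : ((z i : ℤ) : ℝ) + 2 ≤ 0 := by exact_mod_cast (by omega : z i + 2 ≤ 0)
    have b0 : x0 + 6 - n ≤ 0 := by rw [ha0]; nlinarith
    have b1 : x1 + 6 - n < 0 := by rw [ha1]; nlinarith
    have b2 : x2 + 6 - n ≤ 0 := by rw [ha2]; nlinarith
    rw [max_eq_right b0, max_eq_right b1.le, max_eq_left (by linarith : 0 ≤ -(x1 + 6 - n)),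
      max_eq_left (by linarith : 0 ≤ -(x2 + 6 - n)), if_neg (by intro h; linarith)]
    have e : -2 * φ x1 + (0 * φ x1 - 0 * φ x0) / ε +
        (-(x1 + 6 - n) * φ x1 - -(x2 + 6 - n) * φ x2) / ε + 0 -
          ((x1 + 6 - n) * φ' x1 - φ x1) =
        (φ x2 - φ x1) + (x1 + 6 - n) * ((φ x2 - φ x1) / ε - φ' x1) := by
      rw [s2]; field_simp; ring
    rw [e]
    exact split _ _ (hη _ m2 _ m1 (by rw [s2, add_sub_cancel_left, abs_of_pos hε]))
      (abs_slope_sub_le hφ hη' (by linarith) m1 m2 (by linarith) (Or.inl rfl))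
  -- At ξ_k = n-6 both dual differences vanish, so -2φ alone would be wrong by -φ. The Kronecker
  -- term makes the scheme exact there.
  · have hz1 : ((z i : ℤ) : ℝ) + 1 = 0 := by exact_mod_cast hzero
    have hz0 : ((z i : ℤ) : ℝ) = -1 := by linarith
    have b1 : x1 + 6 - n = 0 := by rw [ha1, hz1, mul_zero]
    have b0 : x0 + 6 - n ≤ 0 := by rw [ha0, hz0]; linarith
    have b2 : -(x2 + 6 - n) ≤ 0 := by rw [ha2, hz0]; linarith
    rw [max_eq_right b0, b1, max_eq_right b2, if_pos (by linarith)]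
    have e : -2 * φ x1 + (max 0 0 * φ x1 - 0 * φ x0) / ε + (max (-0) 0 * φ x1 - 0 * φ x2) / ε
        + φ x1 - (0 * φ' x1 - φ x1) = 0 := by
      simp only [neg_zero, max_self]; ring
    rw [e, abs_zero]
    positivity
  · have hz1 : (0 : ℝ) ≤ ((z i : ℤ) : ℝ) := by exact_mod_cast (by omega : 0 ≤ z i)
    have b0 : 0 ≤ x0 + 6 - n := by rw [ha0]; positivity
    have b1 : 0 < x1 + 6 - n := by rw [ha1]; positivity
    have b2 : 0 ≤ x2 + 6 - n := by rw [ha2]; positivity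
    rw [max_eq_left b0, max_eq_left b1.le, max_eq_right (by linarith : -(x1 + 6 - n) ≤ 0),
      max_eq_right (by linarith : -(x2 + 6 - n) ≤ 0), if_neg (by intro h; linarith)]
    have e : -2 * φ x1 + ((x1 + 6 - n) * φ x1 - (x0 + 6 - n) * φ x0) / ε +
        (0 * φ x1 - 0 * φ x2) / ε + 0 - ((x1 + 6 - n) * φ' x1 - φ x1) =
        (φ x0 - φ x1) + (x1 + 6 - n) * ((φ x1 - φ x0) / ε - φ' x1) := by
      rw [show x0 = x1 - ε by linarith]; field_simp; ring
    rw [e]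
    exact split _ _ (hη _ m0 _ m1 (by rw [s1, sub_add_cancel_left, abs_neg, abs_of_pos hε]))
      (abs_slope_sub_le hφ hη' (by linarith) m0 m1 (by linarith) (Or.inr rfl))

theorem abs_gridSum_sub_gridSum_le (hK : 0 < K) (hLK : L ∣ K) {u v w : ℕ → ℝ}
    (hu : ∀ k ∈ Finset.Icc 1 (K - 1), 0 ≤ u k)
    (hX : mesh L K * ∑ k ∈ Finset.Icc 1 (K - 1), u k ≤ 1) {η : ℝ} (hη0 : 0 ≤ η)
    (hη : ∀ k ∈ Finset.Icc 1 (K - 1), |v k - w k| ≤ η) :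
    |mesh L K * ∑ k ∈ Finset.Icc 1 (K - 1), v k * u k -
      mesh L K * ∑ k ∈ Finset.Icc 1 (K - 1), w k * u k| ≤ η := by
  have hε := mesh_pos hK hLK
  rw [← mul_sub, ← Finset.sum_sub_distrib, abs_mul, abs_of_pos hε]
  calc mesh L K * |∑ k ∈ Finset.Icc 1 (K - 1), (v k * u k - w k * u k)|
      ≤ mesh L K * ∑ k ∈ Finset.Icc 1 (K - 1), η * u k := by
        refine mul_le_mul_of_nonneg_left ((Finset.abs_sum_le_sum_abs _ _).trans
          (Finset.sum_le_sum fun k hk => ?_)) hε.le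
        rw [← sub_mul, abs_mul, abs_of_nonneg (hu k hk)]
        exact mul_le_mul_of_nonneg_right (hη k hk) (hu k hk)
    _ = η * (mesh L K * ∑ k ∈ Finset.Icc 1 (K - 1), u k) := by
        rw [← Finset.mul_sum]; ring
    _ ≤ η * 1 := mul_le_mul_of_nonneg_left hX hη0
    _ = η := mul_one η

/-- The grid cell of width `ε` centred at `ξ_k`. -/
def gridCell (L K k : ℕ) : Set ℝ :=
  Ico (gridPoint L K k - mesh L K / 2) (gridPoint L K k + mesh L K / 2)

theorem measurableSet_gridCell (L K k : ℕ) : MeasurableSet (gridCell L K k) := measurableSet_Ico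

theorem volume_gridCell_ne_top (L K k : ℕ) : volume (gridCell L K k) ≠ ⊤ :=
  measure_Ico_lt_top.ne

theorem interpolation_eq (hK : 0 < K) (hLK : L ∣ K) (g : ℕ → ℕ → ℝ) (n : ℕ) {ξ : ℝ}
    (hξ : 0 ≤ ξ) :
    interpolation L K g n ξ = (∑ k ∈ Finset.Icc 1 (K - 1), (gridCell L K k).indicator
        (fun _ => g n k) ξ) +
      (Ico 0 (mesh L K / 2)).indicator (fun _ => if n ≤ 5 then g n 1 else 0) ξ := by
  have hε := mesh_pos hK hLK
  have hmem : ∀ k : ℕ, 1 ≤ k → (ξ ∈ gridCell L K k ↔ ⌊ξ / mesh L K + 1 / 2⌋₊ = k) := by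
    intro k hk
    rw [Nat.floor_eq_iff (by positivity), gridCell, gridPoint, mem_Ico, ← sub_le_iff_le_add,
      le_div_iff₀ hε, ← lt_sub_iff_add_lt, div_lt_iff₀ hε]
    constructor <;> rintro ⟨h1, h2⟩ <;> constructor <;> linarith
  have h0 : ξ ∈ Ico 0 (mesh L K / 2) ↔ ⌊ξ / mesh L K + 1 / 2⌋₊ = 0 := by
    rw [Nat.floor_eq_zero, mem_Ico, ← lt_sub_iff_add_lt, div_lt_iff₀ hε]
    constructor
    · rintro ⟨_, h2⟩; linarith
    · intro h; exact ⟨hξ, by linarith⟩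
  have hsum : (∑ k ∈ Finset.Icc 1 (K - 1), (gridCell L K k).indicator (fun _ => g n k) ξ) =
      ∑ k ∈ Finset.Icc 1 (K - 1), if ⌊ξ / mesh L K + 1 / 2⌋₊ = k then g n k else 0 := by
    refine Finset.sum_congr rfl fun k hk => ?_
    simp only [indicator, hmem k (Finset.mem_Icc.1 hk).1]
  rw [hsum, Finset.sum_ite_eq]
  simp only [interpolation, indicator, h0, Finset.mem_Icc]
  generalize ⌊ξ / mesh L K + 1 / 2⌋₊ = m
  by_cases hm : m = 0
  · simp [hm]
  · by_cases hmK : m < K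
    · simp [hm, hmK, show 1 ≤ m ∧ m ≤ K - 1 by omega]
    · simp [hm, hmK, show ¬ (1 ≤ m ∧ m ≤ K - 1) by omega]

/-- There are two sources of error: oscillation of φ within a cell, weighted by mass at most 1, and
the half cell at 0, absent from the grid sum, whose contribution is at most B·G·ε. -/
theorem abs_integral_interpolation_sub_le (hK : 1 < K) (hLK : L ∣ K) (g : ℕ → ℕ → ℝ) (n : ℕ)
    (hu : ∀ k ∈ Finset.Icc 1 (K - 1), 0 ≤ g n k) (hX : discreteX L K g n ≤ 1) {φ : ℝ → ℝ}
    (hφ : ContinuousOn φ (Icc (0 : ℝ) L)) {η B G : ℝ} (hη0 : 0 ≤ η)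
    (hη : ∀ x ∈ Icc (0 : ℝ) L, ∀ y ∈ Icc (0 : ℝ) L, |x - y| ≤ mesh L K → |φ x - φ y| ≤ η)
    (hB : ∀ x ∈ Icc (0 : ℝ) L, |φ x| ≤ B) (hG : n ≤ 5 → |g n 1| ≤ G) (hG0 : 0 ≤ G) :
    |(∫ ξ in Icc 0 (L : ℝ), φ ξ * interpolation L K g n ξ) - gridSum L K φ (g n)|
      ≤ η + B * G * mesh L K := by
  have hK0 : 0 < K := by omega
  have hε := mesh_pos hK0 hLK
  have hεL : mesh L K / 2 ≤ L := by
    have := (gridPoint_mem hK0 hLK (show 1 ≤ K by omega)).2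
    rw [gridPoint] at this
    push_cast at this
    linarith
  have hcell : ∀ k ∈ Finset.Icc 1 (K - 1), gridCell L K k ⊆ Icc (0 : ℝ) L := by
    intro k hk x hx
    obtain ⟨hk1, hk2⟩ := Finset.mem_Icc.1 hk
    obtain ⟨i, rfl⟩ : ∃ i, k = i + 1 := ⟨k - 1, by omega⟩
    have m0 := (gridPoint_mem hK0 hLK (show i ≤ K by omega)).1
    have m2 := (gridPoint_mem hK0 hLK (show i + 1 + 1 ≤ K by omega)).2
    have s1 := gridPoint_succ (L := L) (K := K) i
    have s2 := gridPoint_succ (L := L) (K := K) (i + 1)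
    rw [gridCell] at hx
    exact ⟨by linarith [hx.1], by linarith [hx.2]⟩
  have hhalf : Ico 0 (mesh L K / 2) ⊆ Icc (0 : ℝ) L := fun x hx => ⟨hx.1, hx.2.le.trans hεL⟩
  set G1 : ℝ := if n ≤ 5 then g n 1 else 0 with hG1
  have hint : IntegrableOn φ (Icc (0 : ℝ) L) := hφ.integrableOn_Icc
  have e1 : ∫ ξ in Icc 0 (L : ℝ), φ ξ * interpolation L K g n ξ =
      ∑ k ∈ Finset.Icc 1 (K - 1), (∫ ξ in gridCell L K k, φ ξ) * g n k
        + (∫ ξ in Ico 0 (mesh L K / 2), φ ξ) * G1 := by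
    have : ∀ ξ ∈ Icc 0 (L : ℝ), φ ξ * interpolation L K g n ξ =
        (∑ k ∈ Finset.Icc 1 (K - 1), (gridCell L K k).indicator (fun ξ => φ ξ * g n k) ξ)
        + (Ico 0 (mesh L K / 2)).indicator (fun ξ => φ ξ * G1) ξ := by
      intro ξ hξ
      rw [interpolation_eq hK0 hLK g n hξ.1, mul_add, Finset.mul_sum]
      congr 1
      · exact Finset.sum_congr rfl fun k _ => by simp [indicator]
      · simp [indicator, hG1]
    rw [setIntegral_congr_fun measurableSet_Icc this, integral_add, integral_finsetSum]
    · congr 1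
      · refine Finset.sum_congr rfl fun k hk => ?_
        rw [setIntegral_indicator (measurableSet_gridCell L K k), inter_eq_right.2 (hcell k hk),
          integral_mul_const]
      · rw [setIntegral_indicator measurableSet_Ico, inter_eq_right.2 hhalf, integral_mul_const]
    · exact fun k hk => (hint.mul_const _).indicator (measurableSet_gridCell L K k)
    · exact integrable_finsetSum _ fun k hk =>
        (hint.mul_const _).indicator (measurableSet_gridCell L K k)
    · exact (hint.mul_const _).indicator measurableSet_Ico
  have e2 : ∑ k ∈ Finset.Icc 1 (K - 1), (∫ ξ in gridCell L K k, φ ξ) * g n k =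
      mesh L K * ∑ k ∈ Finset.Icc 1 (K - 1), ((∫ ξ in gridCell L K k, φ ξ) / mesh L K) * g n k := by
    rw [Finset.mul_sum]
    exact Finset.sum_congr rfl fun k _ => by field_simp
  have h1 := abs_gridSum_sub_gridSum_le hK0 hLK (u := g n)
    (v := fun k => (∫ ξ in gridCell L K k, φ ξ) / mesh L K)
    (w := fun k => φ (gridPoint L K k)) hu hX hη0 (by
      intro k hk
      have hvol : volume.real (gridCell L K k) = mesh L K := by
        rw [gridCell, Measure.real, Real.volume_Ico, ENNReal.toReal_ofReal] <;> linarith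
      have hkm := gridPoint_mem hK0 hLK
        (show k ≤ K by have := Finset.mem_Icc.1 hk; omega)
      have hi : IntegrableOn φ (gridCell L K k) := hint.mono_set (hcell k hk)
      have : (∫ ξ in gridCell L K k, φ ξ) / mesh L K - φ (gridPoint L K k) =
          (∫ ξ in gridCell L K k, (φ ξ - φ (gridPoint L K k))) / mesh L K := by
        rw [integral_sub hi (integrableOn_const (volume_gridCell_ne_top L K k) (by simp)),
          setIntegral_const, hvol, smul_eq_mul]
        field_simp
      rw [this, abs_div, abs_of_pos hε, div_le_iff₀ hε, ← hvol]
      refine norm_setIntegral_le_of_norm_le_const (f := fun ξ => φ ξ - φ (gridPoint L K k)) (volume_gridCell_ne_top L K k).lt_top fun x hx => ?_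
      refine hη x (hcell k hk hx) _ hkm ?_
      rw [gridCell] at hx
      rw [abs_le]
      constructor <;> linarith [hx.1, hx.2])
  have h2 : |(∫ ξ in Ico 0 (mesh L K / 2), φ ξ) * G1| ≤ B * G * mesh L K := by
    have hB0 : 0 ≤ B := (abs_nonneg _).trans (hB 0 ⟨le_rfl, by positivity⟩)
    have h3 : |∫ ξ in Ico 0 (mesh L K / 2), φ ξ| ≤ B * mesh L K := by
      refine (norm_setIntegral_le_of_norm_le_const (f := φ) (C := B)
        measure_Ico_lt_top fun x hx => hB x (hhalf hx)).trans ?_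
      rw [Measure.real, Real.volume_Ico, ENNReal.toReal_ofReal (by linarith)]
      exact mul_le_mul_of_nonneg_left (by linarith) hB0
    have h4 : |G1| ≤ G := by
      rw [hG1]; split_ifs with h
      · exact hG h
      · simpa using hG0
    rw [abs_mul]
    calc _ ≤ (B * mesh L K) * G := mul_le_mul h3 h4 (abs_nonneg _) (by positivity)
      _ = _ := by ring
  rw [e1, e2, gridSum, add_sub_right_comm]
  exact (abs_add_le _ _).trans (add_le_add h1 h2)

end convergence

/-! ### Convergence of grid sums to integrals against the limit measures -/

section limit

variable {β : ℝ} {N L : ℕ} {K : ℕ → ℕ} {g : ℕ → ℕ → ℕ → ℝ} {μ : ℕ → Measure ℝ} {gbar : ℕ → ℝ}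

theorem interpolation_zero {L K n : ℕ} (hn : n ≤ 5) (g : ℕ → ℕ → ℝ) :
    interpolation L K g n 0 = g n 1 := by
  have : ⌊(1 : ℝ) / 2⌋₊ = 0 := by rw [Nat.floor_eq_zero]; norm_num
  simp only [interpolation, zero_div, zero_add, this, if_true, hn]

theorem tendsto_mesh (hK : Tendsto K atTop atTop) :
    Tendsto (fun j => mesh L (K j)) atTop (𝓝 0) :=
  (tendsto_const_div_atTop_nhds_zero_nat (L : ℝ)).comp hK

theorem discreteX_nonneg {K : ℕ} {g : ℕ → ℕ → ℝ} (hs : IsNormalizedSteadyState β N L K g) {n : ℕ}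
    (hn : n ∈ Finset.Icc 2 N) : 0 ≤ discreteX L K g n :=
  mul_nonneg (by unfold mesh; positivity) (Finset.sum_nonneg fun k hk => hs.nonneg n hn k hk)

theorem discreteX_le_one {K : ℕ} {g : ℕ → ℕ → ℝ} (hs : IsNormalizedSteadyState β N L K g) {n : ℕ}
    (hn : n ∈ Finset.Icc 2 N) : discreteX L K g n ≤ 1 := by
  rw [← hs.normalized]
  exact Finset.single_le_sum (fun m hm => discreteX_nonneg hs hm) hn

/-- Uniform continuity on `[0, L]` at the scale of the mesh. -/
theorem eventually_abs_sub_le (hK : Tendsto K atTop atTop) {φ : ℝ → ℝ}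
    (hφ : ContinuousOn φ (Icc (0 : ℝ) L)) {η : ℝ} (hη : 0 < η) :
    ∀ᶠ j in atTop, ∀ x ∈ Icc (0 : ℝ) L, ∀ y ∈ Icc (0 : ℝ) L, |x - y| ≤ mesh L (K j) →
      |φ x - φ y| ≤ η := by
  obtain ⟨δ, hδ, h⟩ := Metric.uniformContinuousOn_iff.1
    (isCompact_Icc.uniformContinuousOn_of_continuous hφ) η hη
  filter_upwards [(tendsto_mesh (L := L) hK).eventually_lt_const hδ] with j hj x hx y hy hxy
  exact (h x hx y hy (lt_of_le_of_lt hxy hj)).le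

theorem integral_eq_of_eqOn_Icc {ν : Measure ℝ} {a b : ℝ} (hν : ν (Icc a b)ᶜ = 0) {f h : ℝ → ℝ}
    (hfh : EqOn f h (Icc a b)) : ∫ x, f x ∂ν = ∫ x, h x ∂ν := by
  rw [← restrict_Icc_of_compl hν]
  exact setIntegral_congr_fun measurableSet_Icc hfh

/-- Regularity is required only on [0, L], so that powers of ξ-c with c < 0 can serve as test
functions later. The bound on g_n^1 needed for the half cell comes from its convergence to ḡ_n. -/
theorem tendsto_gridSum (hKL : ∀ j, 0 < K j ∧ L ∣ K j) (hK : Tendsto K atTop atTop)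
    (hs : ∀ j, IsNormalizedSteadyState β N L (K j) (g j))
    (hbar : ∀ n ∈ Finset.Icc 2 5,
      Tendsto (fun j => interpolation L (K j) (g j) n 0) atTop (𝓝 (gbar n)))
    (hμ : ∀ n ∈ Finset.Icc 2 N, IsFiniteMeasure (μ n) ∧ μ n (Icc 0 (L : ℝ))ᶜ = 0 ∧
      ∀ φ : ℝ → ℝ, Continuous φ →
        Tendsto (fun j => ∫ ξ in Icc 0 (L : ℝ), φ ξ * interpolation L (K j) (g j) n ξ)
          atTop (𝓝 (∫ ξ, φ ξ ∂(μ n)))) {n : ℕ} (hn : n ∈ Finset.Icc 2 N) {φ : ℝ → ℝ}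
    (hφ : ContinuousOn φ (Icc (0 : ℝ) L)) :
    Tendsto (fun j => gridSum L (K j) φ (g j n)) atTop (𝓝 (∫ ξ, φ ξ ∂(μ n))) := by
  obtain ⟨-, hsupp, hlim⟩ := hμ n hn
  have hL0 : (0 : ℝ) ≤ L := L.cast_nonneg
  set ψ : ℝ → ℝ := IccExtend hL0 ((Icc (0 : ℝ) L).domRestrict φ)
  have hψ : Continuous ψ := hφ.domRestrict.Icc_extend'
  have hψφ : EqOn ψ φ (Icc (0 : ℝ) L) := fun x hx => IccExtend_of_mem hL0 _ hx
  have h1 := hlim ψ hψ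
  rw [integral_eq_of_eqOn_Icc hsupp hψφ] at h1
  have h2 : ∀ j, ∫ ξ in Icc 0 (L : ℝ), ψ ξ * interpolation L (K j) (g j) n ξ =
      ∫ ξ in Icc 0 (L : ℝ), φ ξ * interpolation L (K j) (g j) n ξ := fun j =>
    setIntegral_congr_fun measurableSet_Icc fun x hx => by simp only [hψφ hx]
  simp_rw [h2] at h1
  obtain ⟨B, hB⟩ := isCompact_Icc.exists_bound_of_continuousOn hφ
  have hG : ∀ᶠ j in atTop, n ≤ 5 → |g j n 1| ≤ |gbar n| + 1 := by
    by_cases h5 : n ≤ 5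
    · have h := (hbar n (Finset.mem_Icc.2 ⟨(Finset.mem_Icc.1 hn).1, h5⟩)).abs
      simp_rw [interpolation_zero h5] at h
      filter_upwards [h.eventually_le_const (lt_add_one _)] with j hj _ using hj
    · exact Eventually.of_forall fun j h => absurd h h5
  have hdiff : Tendsto (fun j => (∫ ξ in Icc 0 (L : ℝ), φ ξ * interpolation L (K j) (g j) n ξ) -
      gridSum L (K j) φ (g j n)) atTop (𝓝 0) := by
    rw [Metric.tendsto_nhds]
    intro η hη
    have hm : Tendsto (fun j => B * (|gbar n| + 1) * mesh L (K j)) atTop (𝓝 0) := by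
      simpa using (tendsto_mesh (L := L) hK).const_mul (B * (|gbar n| + 1))
    filter_upwards [hG, hm.eventually_lt_const (half_pos hη), hK.eventually_gt_atTop 1,
      eventually_abs_sub_le hK hφ (half_pos hη)] with j hj1 hj2 hj3 hj4
    rw [Real.dist_eq, sub_zero]
    refine (abs_integral_interpolation_sub_le hj3 (hKL j).2 (g j) n ((hs j).nonneg n hn)
      (discreteX_le_one (hs j) hn) hφ (half_pos hη).le hj4 hB hj1 (by positivity)).trans_lt ?_
    linarith
  simpa using h1.sub hdiff

theorem tendsto_sum_dualUpwind (hKL : ∀ j, 0 < K j ∧ L ∣ K j) (hK : Tendsto K atTop atTop)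
    (hs : ∀ j, IsNormalizedSteadyState β N L (K j) (g j))
    (hbar : ∀ n ∈ Finset.Icc 2 5,
      Tendsto (fun j => interpolation L (K j) (g j) n 0) atTop (𝓝 (gbar n)))
    (hμ : ∀ n ∈ Finset.Icc 2 N, IsFiniteMeasure (μ n) ∧ μ n (Icc 0 (L : ℝ))ᶜ = 0 ∧
      ∀ φ : ℝ → ℝ, Continuous φ →
        Tendsto (fun j => ∫ ξ in Icc 0 (L : ℝ), φ ξ * interpolation L (K j) (g j) n ξ)
          atTop (𝓝 (∫ ξ, φ ξ ∂(μ n)))) {n : ℕ} (hn : n ∈ Finset.Icc 2 N) {φ φ' : ℝ → ℝ}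
    (hφ : ∀ ξ ∈ Icc (0 : ℝ) L, HasDerivAt φ (φ' ξ) ξ) (hφ' : ContinuousOn φ' (Icc (0 : ℝ) L)) :
    Tendsto (fun j => mesh L (K j) * ∑ k ∈ Finset.Icc 1 (K j - 1),
        dualUpwind L (K j) n φ k * g j n k) atTop
      (𝓝 (∫ ξ, ((ξ + 6 - n) * φ' ξ - φ ξ) ∂(μ n))) := by
  have hφc : ContinuousOn φ (Icc (0 : ℝ) L) :=
    fun x hx => (hφ x hx).continuousAt.continuousWithinAt
  have hψ : ContinuousOn (fun ξ : ℝ => (ξ + 6 - n) * φ' ξ - φ ξ) (Icc (0 : ℝ) L) := by fun_prop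
  have h1 := tendsto_gridSum hKL hK hs hbar hμ hn hψ
  have hdiff : Tendsto (fun j => mesh L (K j) * ∑ k ∈ Finset.Icc 1 (K j - 1),
        dualUpwind L (K j) n φ k * g j n k -
      gridSum L (K j) (fun ξ : ℝ => (ξ + 6 - n) * φ' ξ - φ ξ) (g j n)) atTop (𝓝 0) := by
    rw [Metric.tendsto_nhds]
    intro η hη
    set C : ℝ := L + 6 + n
    have hC0 : 0 ≤ C := by positivity
    -- The divisor cancels the factor 1 + C in `abs_dualUpwind_sub_le`; C bounds |ξ + 6 - n| on [0,
    -- L].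
    have hη1 : 0 < η / 2 / (1 + C) := by positivity
    filter_upwards [eventually_abs_sub_le hK hφc hη1, eventually_abs_sub_le hK hφ' hη1]
      with j hj1 hj2
    have hKj := (hKL j).1
    rw [Real.dist_eq, sub_zero]
    refine (abs_gridSum_sub_gridSum_le hKj (hKL j).2 ((hs j).nonneg n hn)
      (discreteX_le_one (hs j) hn) (by positivity : 0 ≤ η / 2 / (1 + C) * (1 + C))
      fun k hk => ?_).trans_lt ?_
    · refine abs_dualUpwind_sub_le hKj (hKL j).2 hφ hj1 hj2 ?_ hk
      have := gridPoint_mem hKj (hKL j).2 (show k ≤ K j by have := Finset.mem_Icc.1 hk; omega)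
      have hn0 : (0 : ℝ) ≤ n := n.cast_nonneg
      rw [abs_le]
      simp only [C]
      constructor <;> linarith [this.1, this.2]
    · field_simp
      linarith
  simpa using hdiff.add h1

/-- The properties of the limit measures that determine the profile. -/
structure IsMeasureProfile (β : ℝ) (N L : ℕ) (Γ : ℝ) (gbar : ℕ → ℝ) (μ : ℕ → Measure ℝ) :
    Prop where
  finite : ∀ n ∈ Finset.Icc 2 N, IsFiniteMeasure (μ n)
  supp : ∀ n ∈ Finset.Icc 2 N, μ n (Icc 0 (L : ℝ))ᶜ = 0
  gbar_nonneg : ∀ n ∈ Finset.Icc 2 5, 0 ≤ gbar n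
  mass : ∑ n ∈ Finset.Icc 2 N, (μ n).real univ = 1
  defect : ∑ n ∈ Finset.Icc 2 N, ((n : ℝ) - 6) * (μ n).real univ = 0
  weight : Γ = (∑ n ∈ Finset.Icc (2 : ℕ) 5, ((n : ℝ) - 6) ^ 2 * gbar n) /
    (β * N * (μ N).real univ - 2 * (β + 1) * (μ 2).real univ +
      ∑ n ∈ Finset.Icc 2 N, (n : ℝ) * (μ n).real univ)
  weak : ∀ n ∈ Finset.Icc 2 N, ∀ φ φ' : ℝ → ℝ,
    (∀ ξ ∈ Icc (0 : ℝ) L, HasDerivAt φ (φ' ξ) ξ) → ContinuousOn φ' (Icc (0 : ℝ) L) →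
    ∫ ξ, ((ξ + 6 - n) * φ' ξ - φ ξ) ∂(μ n) + max (6 - (n : ℝ)) 0 * gbar n * φ 0 =
      Γ * coupling β N (fun m => ∫ ξ, φ ξ ∂(μ m)) n

/-- With zero defect, the denominator of the coupling weight is positive. -/
theorem den_pos (hβ0 : 0 < β) (hβ2 : β < 2) (hN : 2 < N) {X : ℕ → ℝ}
    (hX0 : ∀ n ∈ Finset.Icc 2 N, 0 ≤ X n) (hX1 : ∑ n ∈ Finset.Icc 2 N, X n = 1)
    (hX : ∑ n ∈ Finset.Icc 2 N, ((n : ℝ) - 6) * X n = 0) :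
    0 < β * N * X N - 2 * (β + 1) * X 2 + ∑ n ∈ Finset.Icc 2 N, (n : ℝ) * X n := by
  have h6 : ∑ n ∈ Finset.Icc 2 N, (n : ℝ) * X n = 6 := by
    have : ∑ n ∈ Finset.Icc 2 N, ((n : ℝ) - 6) * X n =
        ∑ n ∈ Finset.Icc 2 N, (n : ℝ) * X n - 6 * ∑ n ∈ Finset.Icc 2 N, X n := by
      rw [Finset.mul_sum, ← Finset.sum_sub_distrib]
      exact Finset.sum_congr rfl fun n _ => by ring
    linarith
  have hN0 : 0 ≤ β * N * X N :=
    mul_nonneg (by positivity) (hX0 N (Finset.mem_Icc.2 ⟨hN.le, le_rfl⟩))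
  have h2 : X 2 ≤ 1 := by
    rw [← hX1]; exact Finset.single_le_sum hX0 (Finset.mem_Icc.2 ⟨le_rfl, hN.le⟩)
  have h20 := hX0 2 (Finset.mem_Icc.2 ⟨le_rfl, hN.le⟩)
  -- What remains is at least 6 - 2(β+1) X_2 ≥ 6 - 2(β+1), positive because β < 2.
  rw [h6]
  nlinarith

end limit

/-! ### Uniform bounds and the limit equations -/

section limit

variable {β : ℝ} {N L K : ℕ} {g : ℕ → ℕ → ℝ}

theorem gridSum_one (L K : ℕ) (u : ℕ → ℝ) :
    gridSum L K (fun _ => 1) u = mesh L K * ∑ k ∈ Finset.Icc 1 (K - 1), u k := by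
  simp [gridSum]

theorem abs_sign_le_one (x : ℝ) : |Real.sign x| ≤ 1 := by
  rcases Real.sign_apply_eq x with h | h | h <;> simp [h]

theorem coupling_gridSum (hN : 2 < N) (φ : ℝ → ℝ) (n : ℕ) :
    mesh L K * ∑ k ∈ Finset.Icc 1 (K - 1), φ (gridPoint L K k) * coupling β N (fun m => g m k) n =
      coupling β N (fun m => gridSum L K φ (g m)) n := by
  simp_rw [coupling_eq β hN, gridSum, Finset.mul_sum]
  rw [← Finset.sum_add_distrib, ← Finset.sum_sub_distrib]
  exact Finset.sum_congr rfl fun k _ => by ring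

theorem abs_discreteQ_le (hK : 0 < K) (hLK : L ∣ K) (hs : IsNormalizedSteadyState β N L K g) :
    |discreteQ N L K g| ≤ 1 := by
  have hε := mesh_pos hK hLK
  rw [discreteQ, abs_mul, abs_of_pos hε, ← hs.normalized]
  simp_rw [discreteX]
  rw [← Finset.mul_sum]
  refine mul_le_mul_of_nonneg_left ((Finset.abs_sum_le_sum_abs _ _).trans
    (Finset.sum_le_sum fun n hn => (Finset.abs_sum_le_sum_abs _ _).trans
      (Finset.sum_le_sum fun k hk => ?_))) hε.le
  rw [abs_mul, abs_of_nonneg (hs.nonneg n hn k hk)]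
  exact mul_le_of_le_one_left (hs.nonneg n hn k hk) (abs_sign_le_one _)

/-- Every moment is at most 1, so the bound depends on the coefficients of J alone. The
ε²-correction in the denominator of Γ^ε is therefore O(ε). -/
theorem abs_sum_sign_coupling_le (hβ : 0 < β) (hN : 2 < N) (hK : 0 < K) (hLK : L ∣ K)
    (hs : IsNormalizedSteadyState β N L K g) :
    |mesh L K * ∑ n ∈ Finset.Icc 2 N, ∑ k ∈ Finset.Icc 1 (K - 1),
        Real.sign (gridPoint L K k + 6 - n) * coupling β N (fun m => g m k) n| ≤
      ∑ n ∈ Finset.Icc 2 N, (upCoeff β N n + downCoeff β n + |kappa β N n|) := by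
  have hε := mesh_pos hK hLK
  rw [Finset.mul_sum]
  refine (Finset.abs_sum_le_sum_abs _ _).trans (Finset.sum_le_sum fun n hn => ?_)
  obtain ⟨hn2, hnN⟩ := Finset.mem_Icc.1 hn
  have hA := upCoeff_nonneg hβ N n
  have hB := downCoeff_nonneg hβ hn2
  have hterm : ∀ {C : ℝ} (m : ℕ), 0 ≤ C → (C ≠ 0 → m ∈ Finset.Icc 2 N) →
      mesh L K * ∑ k ∈ Finset.Icc 1 (K - 1), |C * g m k| ≤ C := by
    intro C m hC hm
    rcases eq_or_ne C 0 with rfl | hC0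
    · simp
    · have hm' := hm hC0
      have : ∑ k ∈ Finset.Icc 1 (K - 1), |C * g m k| = C * ∑ k ∈ Finset.Icc 1 (K - 1), g m k := by
        rw [Finset.mul_sum]
        exact Finset.sum_congr rfl fun k hk =>
          abs_of_nonneg (mul_nonneg hC (hs.nonneg m hm' k hk))
      rw [this, mul_left_comm]
      exact mul_le_of_le_one_right hC (discreteX_le_one hs hm')
  rw [abs_mul, abs_of_pos hε]
  calc mesh L K * |∑ k ∈ Finset.Icc 1 (K - 1),
        Real.sign (gridPoint L K k + 6 - n) * coupling β N (fun m => g m k) n|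
      ≤ mesh L K * ∑ k ∈ Finset.Icc 1 (K - 1), (|upCoeff β N n * g (n + 1) k| +
          |downCoeff β n * g (n - 1) k| + |(|kappa β N n|) * g n k|) := by
        refine mul_le_mul_of_nonneg_left ((Finset.abs_sum_le_sum_abs _ _).trans
          (Finset.sum_le_sum fun k hk => ?_)) hε.le
        rw [abs_mul]
        refine (mul_le_of_le_one_left (abs_nonneg _) (abs_sign_le_one _)).trans ?_
        rw [coupling_eq β hN]
        refine (abs_sub _ _).trans (add_le_add (abs_add_le _ _) ?_)
        rw [abs_mul, abs_mul, abs_abs]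
    _ ≤ _ := by
        rw [Finset.sum_add_distrib, Finset.sum_add_distrib, mul_add, mul_add]
        refine add_le_add (add_le_add (hterm _ hA fun h => ?_) (hterm _ hB fun h => ?_))
          (hterm _ (abs_nonneg _) fun _ => hn)
        · refine Finset.mem_Icc.2 ⟨by omega, ?_⟩
          by_contra hlt
          exact h (by rw [upCoeff, if_pos (by omega)])
        · refine Finset.mem_Icc.2 ⟨?_, by omega⟩
          by_contra hlt
          exact h (by rw [downCoeff, if_pos (by omega)])

/-- The steady equation is paired with φ on the grid and each side is identified through uniqueness
of limits. The quotient defining Γ^ε converges because mass and defect pass to the limit and keep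
the limiting denominator positive. -/
theorem IsSteadyStateLimit.isMeasureProfile (hβ0 : 0 < β) (hβ2 : β < 2) (hN : 6 < N)
    (hL : N < L + 6) {Γ : ℝ} {gbar : ℕ → ℝ} {μ : ℕ → Measure ℝ}
    (h : IsSteadyStateLimit β N L Γ gbar μ) : IsMeasureProfile β N L Γ gbar μ := by
  obtain ⟨K, g, hKL, hK, hs, hΓ, hbar, hμ⟩ := h
  have hN2 : 2 < N := by omega
  have hmesh : Tendsto (fun j => mesh L (K j)) atTop (𝓝 0) := tendsto_mesh hK
  have hX : ∀ n ∈ Finset.Icc 2 N,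
      Tendsto (fun j => discreteX L (K j) (g j) n) atTop (𝓝 ((μ n).real univ)) := by
    intro n hn
    have := tendsto_gridSum hKL hK hs hbar hμ hn (continuousOn_const (c := (1 : ℝ)))
    simpa [gridSum_one, discreteX] using this
  have hbar1 : ∀ n ∈ Finset.Icc 2 5, Tendsto (fun j => g j n 1) atTop (𝓝 (gbar n)) := by
    intro n hn
    simpa only [interpolation_zero (Finset.mem_Icc.1 hn).2] using hbar n hn
  have hX0 : ∀ n ∈ Finset.Icc 2 N, 0 ≤ (μ n).real univ := fun n _ => measureReal_nonneg
  have hmass : ∑ n ∈ Finset.Icc 2 N, (μ n).real univ = 1 := by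
    refine tendsto_nhds_unique (tendsto_finsetSum _ hX) ?_
    simp [(hs _).normalized]
  have hdefect : ∑ n ∈ Finset.Icc 2 N, ((n : ℝ) - 6) * (μ n).real univ = 0 := by
    refine tendsto_nhds_unique (tendsto_finsetSum _ fun n hn => (hX n hn).const_mul _) ?_
    have hQ : Tendsto (fun j => -(mesh L (K j) * discreteQ N L (K j) (g j))) atTop (𝓝 0) := by
      rw [← neg_zero]
      refine Tendsto.neg (squeeze_zero_norm (a := fun j => mesh L (K j)) (fun j => ?_) hmesh)
      have hε := mesh_pos (hKL j).1 (hKL j).2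
      rw [Real.norm_eq_abs, abs_mul, abs_of_pos hε]
      exact mul_le_of_le_one_right hε.le (abs_discreteQ_le (hKL j).1 (hKL j).2 (hs j))
    refine hQ.congr fun j => ?_
    have := (hs j).defect
    rw [discreteP] at this
    linarith
  have hden := den_pos hβ0 hβ2 hN2 hX0 hmass hdefect
  have hdenlim : Tendsto (fun j => discreteGammaDen β N L (K j) (g j)) atTop
      (𝓝 (β * N * (μ N).real univ - 2 * (β + 1) * (μ 2).real univ +
        ∑ n ∈ Finset.Icc 2 N, (n : ℝ) * (μ n).real univ)) := by
    have h2 : Tendsto (fun j => mesh L (K j) ^ 2 * ∑ n ∈ Finset.Icc 2 N,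
        ∑ k ∈ Finset.Icc 1 (K j - 1), Real.sign (gridPoint L (K j) k + 6 - n) *
          coupling β N (fun m => g j m k) n) atTop (𝓝 0) := by
      refine squeeze_zero_norm (a := fun j => mesh L (K j) *
        ∑ n ∈ Finset.Icc 2 N, (upCoeff β N n + downCoeff β n + |kappa β N n|)) (fun j => ?_)
        (by simpa using hmesh.mul_const _)
      have hε := mesh_pos (hKL j).1 (hKL j).2
      rw [pow_two, mul_assoc, Real.norm_eq_abs, abs_mul, abs_of_pos hε]
      exact mul_le_mul_of_nonneg_left
        (abs_sum_sign_coupling_le hβ0 hN2 (hKL j).1 (hKL j).2 (hs j)) hε.le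
    have h1 : Tendsto (fun j => β * N * discreteX L (K j) (g j) N -
        2 * (β + 1) * discreteX L (K j) (g j) 2 +
          ∑ n ∈ Finset.Icc 2 N, (n : ℝ) * discreteX L (K j) (g j) n) atTop
        (𝓝 (β * N * (μ N).real univ - 2 * (β + 1) * (μ 2).real univ +
        ∑ n ∈ Finset.Icc 2 N, (n : ℝ) * (μ n).real univ)) :=
      (((hX N (Finset.mem_Icc.2 ⟨by omega, le_rfl⟩)).const_mul _).sub
        ((hX 2 (Finset.mem_Icc.2 ⟨le_rfl, by omega⟩)).const_mul _)).add
        (tendsto_finsetSum _ fun n hn => (hX n hn).const_mul _)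
    have h3 := h1.sub h2
    rw [sub_zero] at h3
    refine h3.congr fun j => ?_
    rw [discreteGammaDen, sum_defect_mul_coupling β hN2]
  have hnumlim : Tendsto (fun j => discreteGammaNum L (K j) (g j)) atTop
      (𝓝 (∑ n ∈ Finset.Icc (2 : ℕ) 5, ((n : ℝ) - 6) ^ 2 * gbar n)) := by
    refine tendsto_finsetSum _ fun n hn => ?_
    have h1 : Tendsto (fun j => (6 - (n : ℝ)) * (6 - (n : ℝ) - mesh L (K j))) atTop
        (𝓝 (((n : ℝ) - 6) ^ 2)) := by
      have := (hmesh.const_sub (6 - (n : ℝ))).const_mul (6 - (n : ℝ))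
      rw [sub_zero] at this
      convert this using 2
      ring
    exact h1.mul (hbar1 n hn)
  refine ⟨fun n hn => (hμ n hn).1, fun n hn => (hμ n hn).2.1, fun n hn => ?_, hmass, hdefect,
    tendsto_nhds_unique hΓ (hnumlim.div hdenlim hden.ne'), fun n hn φ φ' hφ hφ' => ?_⟩
  · refine ge_of_tendsto (hbar1 n hn) ?_
    filter_upwards [hK.eventually_gt_atTop 1] with j hj
    obtain ⟨hn2, hn5⟩ := Finset.mem_Icc.1 hn
    exact (hs j).nonneg n (Finset.mem_Icc.2 ⟨hn2, by omega⟩) 1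
      (Finset.mem_Icc.2 ⟨le_rfl, by omega⟩)
  · have hφc : ContinuousOn φ (Icc (0 : ℝ) L) :=
      fun x hx => (hφ x hx).continuousAt.continuousWithinAt
    have h1 := tendsto_sum_dualUpwind hKL hK hs hbar hμ hn hφ hφ'
    have h2 : Tendsto (fun j => max (6 - (n : ℝ)) 0 * φ 0 * g j n 1) atTop
        (𝓝 (max (6 - (n : ℝ)) 0 * φ 0 * gbar n)) := by
      by_cases h5 : n ≤ 5
      · exact (hbar1 n (Finset.mem_Icc.2 ⟨(Finset.mem_Icc.1 hn).1, h5⟩)).const_mul _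
      · have h6 : (6 : ℝ) ≤ n := by exact_mod_cast (by omega : 6 ≤ n)
        simp [max_eq_right (sub_nonpos.2 h6)]
    have h3 : Tendsto (fun j => coupling β N (fun m => gridSum L (K j) φ (g j m)) n) atTop
        (𝓝 (coupling β N (fun m => ∫ ξ, φ ξ ∂(μ m)) n)) :=
      tendsto_coupling hN2 (fun m hm => tendsto_gridSum hKL hK hs hbar hμ hm hφc) hn
    have h4 := tendsto_nhds_unique ((h1.add h2).congr fun j => ?_) (hΓ.mul h3)
    · rw [← h4]; ring
    · rw [← sum_mul_upwind (hKL j).1 (hKL j).2 hL (hs j).left_boundary (hs j).right_boundary hn φ,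
        ← coupling_gridSum hN2, mul_left_comm, Finset.mul_sum (a := discreteGamma _ _ _ _ _)]
      congr 1
      refine Finset.sum_congr rfl fun k hk => ?_
      rw [(hs j).steady n hn k hk]
      ring

end limit

/-! ### The gain measure, global identities and the support -/

/-- The gain term `Γ (J μ + κ μ)_n`. -/
noncomputable def source (β : ℝ) (N : ℕ) (Γ : ℝ) (μ : ℕ → Measure ℝ) (n : ℕ) : Measure ℝ :=
  ENNReal.ofReal (Γ * upCoeff β N n) • μ (n + 1) + ENNReal.ofReal (Γ * downCoeff β n) • μ (n - 1)

theorem hasDerivAt_max_zero_sq (x : ℝ) :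
    HasDerivAt (fun y : ℝ => max y 0 ^ 2) (2 * max x 0) x := by
  rcases lt_trichotomy x 0 with hx | rfl | hx
  · rw [max_eq_right hx.le, mul_zero]
    refine (hasDerivAt_const x (0 : ℝ)).congr_of_eventuallyEq ?_
    filter_upwards [Iio_mem_nhds hx] with y hy
    simp [max_eq_right (le_of_lt (mem_Iio.1 hy))]
  · rw [max_self, mul_zero, hasDerivAt_iff_isLittleO_nhds_zero]
    simp only [zero_add, max_self, smul_zero, sub_zero, ne_eq, OfNat.ofNat_ne_zero,
      not_false_eq_true, zero_pow]
    refine Asymptotics.IsBigO.trans_isLittleO (g := fun y : ℝ => y ^ 2) ?_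
      (Asymptotics.isLittleO_pow_id one_lt_two)
    refine Asymptotics.IsBigO.of_bound 1 (Eventually.of_forall fun y => ?_)
    rw [one_mul, norm_pow, norm_pow]
    refine pow_le_pow_left₀ (norm_nonneg _) ?_ 2
    rw [Real.norm_eq_abs, Real.norm_eq_abs, abs_of_nonneg (le_max_right y 0)]
    exact max_le (le_abs_self y) (abs_nonneg y)
  · rw [max_eq_left hx.le]
    refine ((hasDerivAt_pow 2 x).congr_deriv (by simp)).congr_of_eventuallyEq ?_
    filter_upwards [Ioi_mem_nhds hx] with y hy
    simp [max_eq_left (le_of_lt (mem_Ioi.1 hy))]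

section profile

variable {β : ℝ} {N L : ℕ} {Γ : ℝ} {gbar : ℕ → ℝ} {μ : ℕ → Measure ℝ}

/-- Only the measures with indices in `[2, N]` matter. -/
theorem IsMeasureProfile.congr (hN : 2 < N) (h : IsMeasureProfile β N L Γ gbar μ)
    {ν : ℕ → Measure ℝ} (hν : ∀ n ∈ Finset.Icc 2 N, ν n = μ n) :
    IsMeasureProfile β N L Γ gbar ν := by
  have hsum : ∀ w : ℕ → ℝ, ∑ n ∈ Finset.Icc 2 N, w n * (ν n).real univ =
      ∑ n ∈ Finset.Icc 2 N, w n * (μ n).real univ := fun w =>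
    Finset.sum_congr rfl fun n hn => by rw [hν n hn]
  refine ⟨fun n hn => hν n hn ▸ h.finite n hn, fun n hn => hν n hn ▸ h.supp n hn, h.gbar_nonneg,
    by rw [← h.mass]; exact Finset.sum_congr rfl fun n hn => by rw [hν n hn],
    by rw [hsum]; exact h.defect, ?_, fun n hn φ φ' hφ hφ' => ?_⟩
  · rw [hsum, hν N (Finset.mem_Icc.2 ⟨hN.le, le_rfl⟩), hν 2 (Finset.mem_Icc.2 ⟨le_rfl, hN.le⟩)]
    exact h.weight
  · rw [hν n hn, h.weak n hn φ φ' hφ hφ', coupling_eq β hN, coupling_eq β hN, hν n hn]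
    obtain ⟨hn2, hnN⟩ := Finset.mem_Icc.1 hn
    congr 3
    · by_cases h1 : n = N
      · simp [upCoeff, h1]
      · rw [hν (n + 1) (Finset.mem_Icc.2 (by omega))]
    · by_cases h1 : n = 2
      · simp [downCoeff, h1]
      · rw [hν (n - 1) (Finset.mem_Icc.2 (by omega))]

theorem IsMeasureProfile.isFiniteMeasure (h : IsMeasureProfile β N L Γ gbar μ)
    (h0 : ∀ n ∉ Finset.Icc 2 N, μ n = 0) (n : ℕ) : IsFiniteMeasure (μ n) := by
  by_cases hn : n ∈ Finset.Icc 2 N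
  · exact h.finite n hn
  · rw [h0 n hn]; infer_instance

theorem IsMeasureProfile.compl_Icc (h : IsMeasureProfile β N L Γ gbar μ)
    (h0 : ∀ n ∉ Finset.Icc 2 N, μ n = 0) (n : ℕ) : μ n (Icc 0 (L : ℝ))ᶜ = 0 := by
  by_cases hn : n ∈ Finset.Icc 2 N
  · exact h.supp n hn
  · rw [h0 n hn]; simp

theorem IsMeasureProfile.measure_Iio (h : IsMeasureProfile β N L Γ gbar μ)
    (h0 : ∀ n ∉ Finset.Icc 2 N, μ n = 0) (n : ℕ) : μ n (Iio 0) = 0 :=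
  measure_mono_null (fun x hx (hx' : x ∈ Icc (0 : ℝ) L) => not_lt.2 hx'.1 hx) (h.compl_Icc h0 n)

theorem source_null {n : ℕ} {E : Set ℝ} (h1 : μ (n + 1) E = 0) (h2 : μ (n - 1) E = 0) :
    source β N Γ μ n E = 0 := by
  simp [source, h1, h2]

theorem source_pos_up (hβ : 0 < β) (hΓ : 0 < Γ) {n : ℕ} (hn : n ≠ N) {E : Set ℝ}
    (h : 0 < μ (n + 1) E) : 0 < source β N Γ μ n E := by
  rw [source, Measure.add_apply, Measure.smul_apply, smul_eq_mul]
  refine (ENNReal.mul_pos ?_ h.ne').trans_le le_self_add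
  exact (ENNReal.ofReal_pos.2 (mul_pos hΓ (upCoeff_pos hβ hn))).ne'

theorem source_pos_down (hβ : 0 < β) (hΓ : 0 < Γ) {n : ℕ} (hn : 2 < n) {E : Set ℝ}
    (h : 0 < μ (n - 1) E) : 0 < source β N Γ μ n E := by
  rw [source, Measure.add_apply, Measure.smul_apply, Measure.smul_apply, smul_eq_mul, smul_eq_mul]
  refine (ENNReal.mul_pos ?_ h.ne').trans_le le_add_self
  exact (ENNReal.ofReal_pos.2 (mul_pos hΓ (downCoeff_pos hβ hn))).ne'

theorem IsMeasureProfile.isFiniteMeasure_source (h : IsMeasureProfile β N L Γ gbar μ)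
    (h0 : ∀ n ∉ Finset.Icc 2 N, μ n = 0) (n : ℕ) : IsFiniteMeasure (source β N Γ μ n) := by
  have := h.isFiniteMeasure h0 (n + 1)
  have := h.isFiniteMeasure h0 (n - 1)
  have := Measure.smul_finite (μ (n + 1)) (c := ENNReal.ofReal (Γ * upCoeff β N n))
    ENNReal.ofReal_ne_top
  have := Measure.smul_finite (μ (n - 1)) (c := ENNReal.ofReal (Γ * downCoeff β n))
    ENNReal.ofReal_ne_top
  rw [source]
  infer_instance

theorem IsMeasureProfile.source_compl_Icc (h : IsMeasureProfile β N L Γ gbar μ)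
    (h0 : ∀ n ∉ Finset.Icc 2 N, μ n = 0) (n : ℕ) : source β N Γ μ n (Icc 0 (L : ℝ))ᶜ = 0 :=
  source_null (h.compl_Icc h0 _) (h.compl_Icc h0 _)

/-- The weak equation, with the loss term on the left hand side. -/
theorem IsMeasureProfile.weak_source (hβ : 0 < β) (hN : 2 < N)
    (h : IsMeasureProfile β N L Γ gbar μ) (hΓ : 0 ≤ Γ) (h0 : ∀ n ∉ Finset.Icc 2 N, μ n = 0)
    {n : ℕ} (hn : n ∈ Finset.Icc 2 N) {φ φ' : ℝ → ℝ}
    (hφ : ∀ ξ ∈ Icc (0 : ℝ) L, HasDerivAt φ (φ' ξ) ξ) (hφ' : ContinuousOn φ' (Icc (0 : ℝ) L)) :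
    ∫ ξ, ((ξ - ((n : ℝ) - 6)) * φ' ξ + (Γ * kappa β N n - 1) * φ ξ) ∂(μ n) =
      ∫ ξ, φ ξ ∂(source β N Γ μ n) - max (6 - (n : ℝ)) 0 * gbar n * φ 0 := by
  have hfin := h.isFiniteMeasure h0
  have hφc : ContinuousOn φ (Icc (0 : ℝ) L) :=
    fun x hx => (hφ x hx).continuousAt.continuousWithinAt
  have hi : ∀ m, Integrable φ (μ m) := fun m => integrable_of_compl_Icc (h.compl_Icc h0 m) hφc
  have hi' : Integrable (fun ξ => (ξ + 6 - n) * φ' ξ - φ ξ) (μ n) :=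
    integrable_of_compl_Icc (h.compl_Icc h0 n) (by fun_prop)
  have hw := h.weak n hn φ φ' hφ hφ'
  rw [coupling_eq β hN] at hw
  have e1 : ∫ ξ, ((ξ - ((n : ℝ) - 6)) * φ' ξ + (Γ * kappa β N n - 1) * φ ξ) ∂(μ n) =
      ∫ ξ, ((ξ + 6 - n) * φ' ξ - φ ξ) ∂(μ n) + Γ * kappa β N n * ∫ ξ, φ ξ ∂(μ n) := by
    rw [← integral_const_mul, ← integral_add hi' ((hi n).const_mul _)]
    exact integral_congr_ae (Eventually.of_forall fun ξ => by simp only; ring)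
  have e2 : ∫ ξ, φ ξ ∂(source β N Γ μ n) = Γ * upCoeff β N n * ∫ ξ, φ ξ ∂(μ (n + 1)) +
      Γ * downCoeff β n * ∫ ξ, φ ξ ∂(μ (n - 1)) := by
    rw [source, integral_add_measure ((hi _).smul_measure ENNReal.ofReal_ne_top)
      ((hi _).smul_measure ENNReal.ofReal_ne_top), integral_smul_measure, integral_smul_measure,
      ENNReal.toReal_ofReal (mul_nonneg hΓ (upCoeff_nonneg hβ _ _)),
      ENNReal.toReal_ofReal (mul_nonneg hΓ (downCoeff_nonneg hβ (Finset.mem_Icc.1 hn).1)),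
      smul_eq_mul, smul_eq_mul]
  rw [e1, e2]
  linear_combination hw

/-- Testing with φ = 1 and summing over n cancels the coupling and leaves Σ(6-n)_+ ḡ_n = total mass
= 1. Only classes n ≤ 5 have a positive coefficient. -/
theorem IsMeasureProfile.exists_gbar_pos (hN : 2 < N) (h : IsMeasureProfile β N L Γ gbar μ) :
    ∃ n ∈ Finset.Icc 2 5, 0 < gbar n := by
  have hw : ∀ n ∈ Finset.Icc 2 N, -(μ n).real univ + max (6 - (n : ℝ)) 0 * gbar n =
      Γ * coupling β N (fun m => ∫ _, (1 : ℝ) ∂(μ m)) n := by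
    intro n hn
    have := h.weak n hn (fun _ => 1) (fun _ => 0) (fun ξ _ => hasDerivAt_const ξ 1)
      continuousOn_const
    rw [← this]
    simp
  have hsum := Finset.sum_congr rfl hw
  rw [Finset.sum_add_distrib, Finset.sum_neg_distrib, h.mass, ← Finset.mul_sum,
    sum_coupling β hN, mul_zero] at hsum
  have hpos : 0 < ∑ n ∈ Finset.Icc 2 N, max (6 - (n : ℝ)) 0 * gbar n := by linarith
  obtain ⟨n, hn, hn'⟩ := Finset.exists_lt_of_sum_lt (by simpa using hpos :
    ∑ n ∈ Finset.Icc 2 N, (0 : ℝ) < ∑ n ∈ Finset.Icc 2 N, max (6 - (n : ℝ)) 0 * gbar n)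
  have h5 : n ≤ 5 := by
    by_contra hlt
    have : (6 : ℝ) ≤ n := by exact_mod_cast (by omega : 6 ≤ n)
    rw [max_eq_right (by linarith), zero_mul] at hn'
    exact lt_irrefl _ hn'
  exact ⟨n, Finset.mem_Icc.2 ⟨(Finset.mem_Icc.1 hn).1, h5⟩,
    pos_of_mul_pos_right hn' (le_max_right _ _)⟩

theorem IsMeasureProfile.num_pos (hN : 2 < N) (h : IsMeasureProfile β N L Γ gbar μ) :
    0 < ∑ n ∈ Finset.Icc (2 : ℕ) 5, ((n : ℝ) - 6) ^ 2 * gbar n := by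
  obtain ⟨n, hn, hpos⟩ := h.exists_gbar_pos hN
  refine Finset.sum_pos' (fun m hm => mul_nonneg (sq_nonneg _) (h.gbar_nonneg m hm))
    ⟨n, hn, mul_pos (sq_pos_of_neg ?_) hpos⟩
  have : (n : ℝ) ≤ 5 := by exact_mod_cast (Finset.mem_Icc.1 hn).2
  linarith

theorem IsMeasureProfile.den_pos (hβ0 : 0 < β) (hβ2 : β < 2) (hN : 2 < N)
    (h : IsMeasureProfile β N L Γ gbar μ) :
    0 < β * N * (μ N).real univ - 2 * (β + 1) * (μ 2).real univ +
      ∑ n ∈ Finset.Icc 2 N, (n : ℝ) * (μ n).real univ :=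
  Fradkov.den_pos hβ0 hβ2 hN (fun _ _ => measureReal_nonneg) h.mass h.defect

theorem IsMeasureProfile.weight_pos (hβ0 : 0 < β) (hβ2 : β < 2) (hN : 2 < N)
    (h : IsMeasureProfile β N L Γ gbar μ) : 0 < Γ := by
  rw [h.weight]
  exact div_pos (h.num_pos hN) (h.den_pos hβ0 hβ2 hN)

/-- The measures do not charge `(N - 6, ∞)`. -/
theorem IsMeasureProfile.measure_Ioi (hN : 6 < N) (h : IsMeasureProfile β N L Γ gbar μ)
    (h0 : ∀ n ∉ Finset.Icc 2 N, μ n = 0) (n : ℕ) : μ n (Ioi ((N : ℝ) - 6)) = 0 := by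
  by_cases hn : n ∈ Finset.Icc 2 N
  swap
  · rw [h0 n hn]; simp
  have hN6 : (6 : ℝ) < N := by exact_mod_cast hN
  set φ : ℝ → ℝ := fun x => max (x - ((N : ℝ) - 6)) 0 ^ 2 with hφd
  set φ' : ℝ → ℝ := fun x => 2 * max (x - ((N : ℝ) - 6)) 0 with hφ'd
  have hφ : ∀ x, HasDerivAt φ (φ' x) x := fun x =>
    (hasDerivAt_max_zero_sq (x - ((N : ℝ) - 6))).comp_sub_const x _
  have hφc : Continuous φ := by fun_prop
  have hφ'c : Continuous φ' := by fun_prop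
  have hφ0 : φ 0 = 0 := by
    simp [hφd, max_eq_right (by linarith : 6 - (N : ℝ) ≤ 0)]
  -- With y = x - (N-6) > 0, x + 6 - m ≥ y gives 2y² - y² = φ. The summed equations say that
  -- nonnegative integrals add up to 0, so each vanishes and with it the integral of φ.
  have hge : ∀ m ∈ Finset.Icc 2 N, ∀ x, φ x ≤ (x + 6 - m) * φ' x - φ x := by
    intro m hm x
    have hmN : (m : ℝ) ≤ N := by exact_mod_cast (Finset.mem_Icc.1 hm).2
    simp only [hφd, hφ'd]
    rcases le_total (x - ((N : ℝ) - 6)) 0 with hx | hx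
    · simp [max_eq_right hx]
    · rw [max_eq_left hx]; nlinarith
  have hsum := Finset.sum_congr rfl fun m hm =>
    h.weak m hm φ φ' (fun x _ => hφ x) hφ'c.continuousOn
  rw [← Finset.mul_sum, sum_coupling β (by omega), mul_zero] at hsum
  simp only [hφ0, mul_zero, add_zero] at hsum
  have hnn : ∀ m ∈ Finset.Icc 2 N, 0 ≤ ∫ x, ((x + 6 - m) * φ' x - φ x) ∂(μ m) := fun m hm =>
    integral_nonneg fun x => (sq_nonneg _).trans (hge m hm x)
  have hn0 := (Finset.sum_eq_zero_iff_of_nonneg hnn).1 hsum n hn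
  have := h.isFiniteMeasure h0 n
  have hi : Integrable φ (μ n) := integrable_of_compl_Icc (h.supp n hn) hφc.continuousOn
  have hi' : Integrable (fun x => (x + 6 - n) * φ' x - φ x) (μ n) :=
    integrable_of_compl_Icc (h.supp n hn) (by fun_prop)
  have hz : ∫ x, φ x ∂(μ n) = 0 :=
    le_antisymm (hn0 ▸ integral_mono hi hi' (hge n hn)) (integral_nonneg fun x => sq_nonneg _)
  rw [integral_eq_zero_iff_of_nonneg (fun x => sq_nonneg _) hi] at hz
  refine measure_mono_null (fun x hx => ?_) (ae_iff.1 hz)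
  have hx' : 0 < x - ((N : ℝ) - 6) := sub_pos.2 hx
  simp only [mem_ofPred_eq, Pi.zero_apply, max_eq_left hx'.le]
  positivity

/-! ### Densities, atoms and the trace -/

theorem IsMeasureProfile.restrict_Ioi (hβ : 0 < β) (hN : 2 < N)
    (h : IsMeasureProfile β N L Γ gbar μ) (hΓ : 0 ≤ Γ) (h0 : ∀ n ∉ Finset.Icc 2 N, μ n = 0)
    {n : ℕ} (hn : n ∈ Finset.Icc 2 N) :
    (μ n).restrict (Ioi (max ((n : ℝ) - 6) 0)) =
      (volume.restrict (Ioi (max ((n : ℝ) - 6) 0))).withDensity fun ξ => ENNReal.ofReal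
        (rightDensity (Γ * kappa β N n) ((n : ℝ) - 6) (source β N Γ μ n) ξ) := by
  have := h.isFiniteMeasure h0 n
  have := h.isFiniteMeasure_source h0 n
  refine restrict_Ioi_eq_withDensity_rightDensity (le_max_left _ _) _ _ (h.supp n hn)
    (h.source_compl_Icc h0 n) fun δ hδ φ φ' hφ hφ' hφ0 => ?_
  rw [h.weak_source hβ hN hΓ h0 hn (fun ξ _ => hφ ξ) hφ'.continuousOn,
    hφ0 0 ((le_max_right _ _).trans hδ.le), mul_zero, sub_zero]

theorem IsMeasureProfile.restrict_Iio (hβ : 0 < β) (hN : 2 < N)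
    (h : IsMeasureProfile β N L Γ gbar μ) (hΓ : 0 ≤ Γ) (h0 : ∀ n ∉ Finset.Icc 2 N, μ n = 0)
    {n : ℕ} (hn : n ∈ Finset.Icc 6 N) :
    (μ n).restrict (Iio ((n : ℝ) - 6)) =
      (volume.restrict (Iio ((n : ℝ) - 6))).withDensity fun ξ => ENNReal.ofReal
        (leftDensity (Γ * kappa β N n) ((n : ℝ) - 6) (source β N Γ μ n) ξ) := by
  obtain ⟨hn6, hnN⟩ := Finset.mem_Icc.1 hn
  have hn2 : n ∈ Finset.Icc 2 N := Finset.mem_Icc.2 ⟨by omega, hnN⟩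
  have hn6' : (6 : ℝ) ≤ n := by exact_mod_cast hn6
  have := h.isFiniteMeasure h0 n
  have := h.isFiniteMeasure_source h0 n
  refine restrict_Iio_eq_withDensity_leftDensity _ _ (h.supp n hn2)
    (h.source_compl_Icc h0 n) fun δ hδ φ φ' hφ hφ' hφ0 => ?_
  rw [h.weak_source hβ hN hΓ h0 hn2 (fun ξ _ => hφ ξ) hφ'.continuousOn,
    max_eq_right (by linarith), zero_mul, zero_mul, sub_zero]

/-- The trace of the `n`-th density at `0`, in integrated form. -/
theorem IsMeasureProfile.integral_source_eq_trace (hβ : 0 < β) (hN : 2 < N)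
    (h : IsMeasureProfile β N L Γ gbar μ) (hΓ : 0 ≤ Γ) (h0 : ∀ n ∉ Finset.Icc 2 N, μ n = 0)
    {n : ℕ} (hn : n ∈ Finset.Icc 2 N) (hn5 : n ≤ 5) :
    ∫ s, (s - ((n : ℝ) - 6)) ^ (1 - Γ * kappa β N n) ∂(source β N Γ μ n) =
      (6 - (n : ℝ)) * gbar n * (6 - (n : ℝ)) ^ (1 - Γ * kappa β N n) := by
  have hn5' : (n : ℝ) ≤ 5 := by exact_mod_cast hn5
  set c : ℝ := (n : ℝ) - 6 with hc
  set σ := Γ * kappa β N n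
  have hpos : ∀ ξ ∈ Icc (0 : ℝ) L, 0 < ξ - c := fun ξ hξ => by linarith [hξ.1]
  -- This power is annihilated by (ξ-c)∂ + (σ-1), so only source and boundary term remain. It is
  -- smooth on [0, L] because c ≤ -1.
  have hw := h.weak_source hβ hN hΓ h0 hn (φ := fun ξ => (ξ - c) ^ (1 - σ))
    (φ' := fun ξ => (1 - σ) * (ξ - c) ^ (1 - σ - 1))
    (fun ξ hξ => (Real.hasDerivAt_rpow_const (Or.inl (hpos ξ hξ).ne')).comp_sub_const ξ c)
    (ContinuousOn.mul continuousOn_const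
      (ContinuousOn.rpow_const (by fun_prop) fun ξ hξ => Or.inl (hpos ξ hξ).ne'))
  have hz : ∫ ξ, ((ξ - c) * ((1 - σ) * (ξ - c) ^ (1 - σ - 1)) + (σ - 1) * (ξ - c) ^ (1 - σ)) ∂(μ n)
      = ∫ _, (0 : ℝ) ∂(μ n) := by
    refine integral_eq_of_eqOn_Icc (h.supp n hn) fun ξ hξ => ?_
    have := hpos ξ hξ
    rw [Real.rpow_sub_one this.ne']
    field_simp
    ring
  rw [hz, integral_zero, max_eq_left (by linarith)] at hw
  simp only [zero_sub, hc, neg_sub] at hw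
  linarith

theorem tendsto_inv_one_add_mul_sq {y : ℝ} (hy : y ≠ 0) :
    Tendsto (fun k : ℕ => 1 / (1 + (k : ℝ) * y ^ 2)) atTop (𝓝 0) := by
  refine tendsto_const_nhds.div_atTop (tendsto_atTop_add_const_left _ 1 ?_)
  exact tendsto_natCast_atTop_atTop.atTop_mul_const (by positivity)

/-- Take φ_k = x/(1+kx²): it vanishes at 0 and tends to 0, while φ_k' is bounded and tends to the
indicator of {0}. The boundary term drops out, and the limit reads -c μ_n({0}) = 0 with c ≠ 0. -/
theorem IsMeasureProfile.measure_singleton_zero (hβ : 0 < β) (hN : 2 < N)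
    (h : IsMeasureProfile β N L Γ gbar μ) (hΓ : 0 ≤ Γ) (h0 : ∀ n ∉ Finset.Icc 2 N, μ n = 0)
    {n : ℕ} (hn : n ∈ Finset.Icc 2 N) (hn6 : n ≠ 6) : μ n {0} = 0 := by
  have hfin := h.isFiniteMeasure h0 n
  have hfinS := h.isFiniteMeasure_source h0 n
  set c : ℝ := (n : ℝ) - 6 with hc
  set σ := Γ * kappa β N n
  have hc0 : c ≠ 0 := by
    rw [hc, sub_ne_zero]; exact_mod_cast hn6
  have hden : ∀ (k : ℕ) (x : ℝ), 0 < 1 + (k : ℝ) * x ^ 2 := fun k x => by positivity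
  set φ : ℕ → ℝ → ℝ := fun k x => x / (1 + k * x ^ 2) with hφd
  set φ' : ℕ → ℝ → ℝ := fun k x => (1 - k * x ^ 2) / (1 + k * x ^ 2) ^ 2 with hφ'd
  have hφ : ∀ k x, HasDerivAt (φ k) (φ' k x) x := by
    intro k x
    have h1 : HasDerivAt (fun x : ℝ => 1 + (k : ℝ) * x ^ 2) ((k : ℝ) * (2 * x)) x := by
      simpa using ((hasDerivAt_pow 2 x).const_mul (k : ℝ)).const_add 1
    refine ((hasDerivAt_id x).div h1 (hden k x).ne').congr_deriv ?_
    simp only [hφ'd, id]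
    congr 1
    ring
  have hφ'c : ∀ k, Continuous (φ' k) := fun k =>
    Continuous.div (by fun_prop) (by fun_prop) fun x => (pow_pos (hden k x) 2).ne'
  have hφc : ∀ k, Continuous (φ k) := fun k =>
    Continuous.div (by fun_prop) (by fun_prop) fun x => (hden k x).ne'
  have hb : ∀ k x, |φ k x| ≤ |x| := fun k x => by
    simp only [hφd]
    rw [abs_div, abs_of_pos (hden k x)]
    exact div_le_self (abs_nonneg _) (by have : 0 ≤ (k : ℝ) * x ^ 2 := by positivity
                                         linarith)
  have hb2 : ∀ k x, |φ' k x| ≤ 1 / (1 + (k : ℝ) * x ^ 2) := fun k x => by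
    simp only [hφ'd]
    rw [abs_div, abs_of_pos (pow_pos (hden k x) 2), div_le_div_iff₀ (pow_pos (hden k x) 2)
      (hden k x), pow_two (1 + (k : ℝ) * x ^ 2), one_mul]
    refine mul_le_mul_of_nonneg_right ?_ (hden k x).le
    have : 0 ≤ (k : ℝ) * x ^ 2 := by positivity
    rw [abs_le]
    constructor <;> linarith
  have hb1 : ∀ k x, |φ' k x| ≤ 1 := fun k x => (hb2 k x).trans
    (by rw [div_le_one (hden k x)]; have : 0 ≤ (k : ℝ) * x ^ 2 := by positivity
        linarith)
  have hlim : ∀ x, Tendsto (fun k => φ k x) atTop (𝓝 0) := by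
    intro x
    rcases eq_or_ne x 0 with rfl | hx
    · simp [hφd]
    · simpa [hφd, div_eq_mul_inv] using (tendsto_inv_one_add_mul_sq hx).const_mul x
  have hlim' : ∀ x ≠ 0, Tendsto (fun k => φ' k x) atTop (𝓝 0) := fun x hx =>
    squeeze_zero_norm (fun k => hb2 k x) (tendsto_inv_one_add_mul_sq hx)
  have hL : Tendsto (fun k => ∫ x, ((x - c) * φ' k x + (σ - 1) * φ k x) ∂(μ n)) atTop
      (𝓝 (∫ x, ({0} : Set ℝ).indicator (fun _ => -c) x ∂(μ n))) := by
    refine tendsto_integral_of_dominated_convergence (fun x => |x - c| + |σ - 1| * |x|)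
      (fun k => ?_) ?_ (fun k => Eventually.of_forall fun x => ?_)
      (Eventually.of_forall fun x => ?_)
    · have := hφc k
      have := hφ'c k
      exact Continuous.aestronglyMeasurable (by fun_prop)
    · exact integrable_of_compl_Icc (h.supp n hn) (by fun_prop)
    · refine (abs_add_le _ _).trans (add_le_add ?_ ?_)
      · rw [abs_mul]; exact mul_le_of_le_one_right (abs_nonneg _) (hb1 k x)
      · rw [abs_mul]; exact mul_le_mul_of_nonneg_left (hb k x) (abs_nonneg _)
    · rcases eq_or_ne x 0 with rfl | hx
      · simp [hφd, hφ'd]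
      · simpa [hx] using ((hlim' x hx).const_mul (x - c)).add ((hlim x).const_mul (σ - 1))
  have hR : Tendsto (fun k => ∫ x, φ k x ∂(source β N Γ μ n)) atTop (𝓝 0) := by
    rw [← integral_zero ℝ ℝ (μ := source β N Γ μ n)]
    refine tendsto_integral_of_dominated_convergence (fun x => |x|)
      (fun k => (hφc k).aestronglyMeasurable) ?_ (fun k => Eventually.of_forall fun x => hb k x)
      (Eventually.of_forall hlim)
    exact integrable_of_compl_Icc (h.source_compl_Icc h0 n) (by fun_prop)
  have heq := tendsto_nhds_unique (hL.congr fun k => by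
    rw [h.weak_source hβ hN hΓ h0 hn (fun x _ => hφ k x) (hφ'c k).continuousOn]
    simp [hφd]) hR
  rw [integral_indicator_const _ (measurableSet_singleton 0), smul_eq_mul, mul_eq_zero] at heq
  exact (measureReal_eq_zero_iff).1 (heq.resolve_right (neg_ne_zero.2 hc0))

/-- For φ_k = 1/(1+k(x-c)²) the transport term (x-c)φ_k' is bounded and tends to 0 everywhere, c
included, so only the zeroth-order terms see the atom. -/
theorem IsMeasureProfile.atom_eq (hβ : 0 < β) (hN : 2 < N)
    (h : IsMeasureProfile β N L Γ gbar μ) (hΓ : 0 ≤ Γ) (h0 : ∀ n ∉ Finset.Icc 2 N, μ n = 0)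
    {n : ℕ} (hn : n ∈ Finset.Icc 6 N) :
    (Γ * kappa β N n - 1) * (μ n).real {(n : ℝ) - 6} =
      (source β N Γ μ n).real {(n : ℝ) - 6} := by
  obtain ⟨hn6, hnN⟩ := Finset.mem_Icc.1 hn
  have hn2 : n ∈ Finset.Icc 2 N := Finset.mem_Icc.2 ⟨by omega, hnN⟩
  have hn6' : (6 : ℝ) ≤ n := by exact_mod_cast hn6
  have hfin := h.isFiniteMeasure h0 n
  have hfinS := h.isFiniteMeasure_source h0 n
  set c : ℝ := (n : ℝ) - 6 with hc
  set σ := Γ * kappa β N n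
  have hden : ∀ (k : ℕ) (x : ℝ), 0 < 1 + (k : ℝ) * (x - c) ^ 2 := fun k x => by positivity
  set φ : ℕ → ℝ → ℝ := fun k x => 1 / (1 + k * (x - c) ^ 2) with hφd
  set φ' : ℕ → ℝ → ℝ := fun k x => -(2 * k * (x - c)) / (1 + k * (x - c) ^ 2) ^ 2 with hφ'd
  have hφ : ∀ k x, HasDerivAt (φ k) (φ' k x) x := by
    intro k x
    have h1 : HasDerivAt (fun x : ℝ => 1 + (k : ℝ) * (x - c) ^ 2) ((k : ℝ) * (2 * (x - c))) x := by
      simpa using ((((hasDerivAt_id x).sub_const c).pow 2).const_mul (k : ℝ)).const_add 1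
    refine ((hasDerivAt_const x (1 : ℝ)).div h1 (hden k x).ne').congr_deriv ?_
    simp only [hφ'd]
    congr 1
    ring
  have hφ'c : ∀ k, Continuous (φ' k) := fun k =>
    Continuous.div (by fun_prop) (by fun_prop) fun x => (pow_pos (hden k x) 2).ne'
  have hφc : ∀ k, Continuous (φ k) := fun k =>
    Continuous.div (by fun_prop) (by fun_prop) fun x => (hden k x).ne'
  have hb : ∀ k x, |φ k x| ≤ 1 := fun k x => by
    simp only [hφd]
    rw [abs_of_pos (div_pos one_pos (hden k x)), div_le_one (hden k x)]
    have : 0 ≤ (k : ℝ) * (x - c) ^ 2 := by positivity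
    linarith
  have hb2 : ∀ k x, |(x - c) * φ' k x| ≤ 2 * φ k x := fun k x => by
    have hk : 0 ≤ (k : ℝ) * (x - c) ^ 2 := by positivity
    have e : (x - c) * φ' k x =
        -(2 * (k * (x - c) ^ 2)) / (1 + k * (x - c) ^ 2) ^ 2 := by
      simp only [hφ'd]; ring
    rw [e]
    simp only [hφd]
    rw [abs_div, abs_neg, abs_of_nonneg (by positivity), abs_of_pos (pow_pos (hden k x) 2),
      mul_one_div, div_le_div_iff₀ (pow_pos (hden k x) 2) (hden k x)]
    nlinarith
  have hlim : ∀ x ≠ c, Tendsto (fun k => φ k x) atTop (𝓝 0) := fun x hx =>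
    tendsto_inv_one_add_mul_sq (sub_ne_zero.2 hx)
  have hlimφ : ∀ x, Tendsto (fun k => φ k x) atTop
      (𝓝 (({c} : Set ℝ).indicator (fun _ => 1) x)) := by
    intro x
    rcases eq_or_ne x c with rfl | hx
    · simp [hφd]
    · simpa [hx] using hlim x hx
  have hlim' : ∀ x, Tendsto (fun k => (x - c) * φ' k x) atTop (𝓝 0) := by
    intro x
    rcases eq_or_ne x c with rfl | hx
    · simp
    · exact squeeze_zero_norm (fun k => hb2 k x) (by simpa using (hlim x hx).const_mul 2)
  have hL : Tendsto (fun k => ∫ x, ((x - c) * φ' k x + (σ - 1) * φ k x) ∂(μ n)) atTop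
      (𝓝 (∫ x, ({c} : Set ℝ).indicator (fun _ => σ - 1) x ∂(μ n))) := by
    refine tendsto_integral_of_dominated_convergence (fun x => 2 + |σ - 1|)
      (fun k => ?_) (integrable_const _) (fun k => Eventually.of_forall fun x => ?_)
      (Eventually.of_forall fun x => ?_)
    · have := hφc k
      have := hφ'c k
      exact Continuous.aestronglyMeasurable (by fun_prop)
    · refine (abs_add_le _ _).trans (add_le_add ?_ ?_)
      · refine (hb2 k x).trans ?_
        linarith [le_abs_self (φ k x), hb k x]
      · rw [abs_mul]; exact mul_le_of_le_one_right (abs_nonneg _) (hb k x)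
    · have := (hlim' x).add ((hlimφ x).const_mul (σ - 1))
      rcases eq_or_ne x c with rfl | hx
      · simpa using this
      · simpa [hx] using this
  have hR : Tendsto (fun k => ∫ x, φ k x ∂(source β N Γ μ n)) atTop
      (𝓝 (∫ x, ({c} : Set ℝ).indicator (fun _ => 1) x ∂(source β N Γ μ n))) :=
    tendsto_integral_of_dominated_convergence (fun x => 1)
      (fun k => (hφc k).aestronglyMeasurable) (integrable_const _)
      (fun k => Eventually.of_forall fun x => hb k x) (Eventually.of_forall hlimφ)
  have heq := tendsto_nhds_unique (hL.congr fun k => by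
    rw [h.weak_source hβ hN hΓ h0 hn2 (fun x _ => hφ k x) (hφ'c k).continuousOn,
      max_eq_right (by linarith), zero_mul, zero_mul, sub_zero]) hR
  rw [integral_indicator_const _ (measurableSet_singleton c),
    integral_indicator_const _ (measurableSet_singleton c), smul_eq_mul, smul_eq_mul,
    mul_one] at heq
  rw [← heq, mul_comm]

end profile

/-! ### Positivity -/

/-- Monotonicity of the tail integral gives measurability while atoms of S, and hence jumps, are not
yet excluded. -/
theorem aemeasurable_rightDensity {S : Measure ℝ} [IsFiniteMeasure S] {a b : ℝ}
    (hS : S (Icc a b)ᶜ = 0) {σ c r : ℝ} (hr : c ≤ r) :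
    AEMeasurable (rightDensity σ c S) (volume.restrict (Ioi r)) := by
  refine AEMeasurable.mul (Measurable.aemeasurable (by fun_prop))
    (aemeasurable_restrict_of_antitoneOn measurableSet_Ioi fun x hx y hy hxy => ?_)
  have hcx : c < x := lt_of_le_of_lt hr hx
  exact setIntegral_mono_set (integrableOn_Ioi_sub_rpow hS _ hcx)
    ((ae_restrict_mem measurableSet_Ioi).mono fun s hs =>
      Real.rpow_nonneg (by have := mem_Ioi.1 hs; linarith) _)
    (Ioi_subset_Ioi hxy).eventuallyLE

theorem aemeasurable_leftDensity {S : Measure ℝ} [IsFiniteMeasure S] {a b : ℝ}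
    (hS : S (Icc a b)ᶜ = 0) {σ c : ℝ} :
    AEMeasurable (leftDensity σ c S) (volume.restrict (Iio c)) := by
  refine AEMeasurable.mul (Measurable.aemeasurable (by fun_prop))
    (aemeasurable_restrict_of_monotoneOn measurableSet_Iio fun x hx y hy hxy => ?_)
  exact setIntegral_mono_set (integrableOn_Iio_sub_rpow hS _ hy)
    ((ae_restrict_mem measurableSet_Iio).mono fun s hs =>
      Real.rpow_nonneg (by have := mem_Iio.1 hs; have := mem_Iio.1 hy; linarith) _)
    (Iio_subset_Iio hxy).eventuallyLE

theorem measure_Ioo_pos_of_withDensity {μ : Measure ℝ} {U : Set ℝ} {ρ : ℝ → ℝ}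
    (hm : AEMeasurable ρ (volume.restrict U))
    (hμ : μ.restrict U = (volume.restrict U).withDensity fun ξ => ENNReal.ofReal (ρ ξ))
    {a b : ℝ} (hab : a < b) (hU : Ioo a b ⊆ U) (hpos : ∀ ξ ∈ Ioo a b, 0 < ρ ξ) :
    0 < μ (Ioo a b) := by
  have h1 := congrArg (fun ν : Measure ℝ => ν (Ioo a b)) hμ
  simp only [Measure.restrict_apply measurableSet_Ioo, withDensity_apply _ measurableSet_Ioo,
    Measure.restrict_restrict measurableSet_Ioo, inter_eq_left.2 hU] at h1
  rw [h1, pos_iff_ne_zero, Ne, lintegral_eq_zero_iff' ((hm.mono_measure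
    (Measure.restrict_mono hU le_rfl)).ennreal_ofReal)]
  intro h0
  have h2 : ∀ᵐ ξ ∂(volume.restrict (Ioo a b)), False := by
    filter_upwards [h0, ae_restrict_mem measurableSet_Ioo] with ξ h3 h4
    exact (ENNReal.ofReal_pos.2 (hpos ξ h4)).ne' h3
  rw [Filter.eventually_false_iff_eq_bot, ae_eq_bot, Measure.restrict_eq_zero,
    Real.volume_Ioo] at h2
  exact (ENNReal.ofReal_pos.2 (sub_pos.2 hab)).ne' h2

theorem exists_measure_Ioi_pos {μ : Measure ℝ} {a : ℝ} (h : 0 < μ (Ioi a)) :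
    ∃ t > a, 0 < μ (Ioi t) := by
  by_contra! hcon
  have hU : Ioi a = ⋃ m : ℕ, Ioi (a + 1 / ((m : ℝ) + 1)) := by
    ext x
    simp only [mem_Ioi, mem_iUnion]
    constructor
    · intro hx
      obtain ⟨m, hm⟩ := exists_nat_one_div_lt (sub_pos.2 hx)
      exact ⟨m, by linarith⟩
    · rintro ⟨m, hm⟩
      have : 0 < 1 / ((m : ℝ) + 1) := by positivity
      linarith
  refine h.ne' ?_
  rw [hU]
  refine measure_iUnion_null fun m => nonpos_iff_eq_zero.1 (hcon _ ?_)
  have : 0 < 1 / ((m : ℝ) + 1) := by positivity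
  linarith

section profile

variable {β : ℝ} {N L : ℕ} {Γ : ℝ} {gbar : ℕ → ℝ} {μ : ℕ → Measure ℝ}

/-- The density at ξ integrates the source over (ξ, ∞), so source mass beyond t makes it positive at
every admissible ξ before t. Left of c the mirror statement holds. -/
theorem IsMeasureProfile.pos_of_source_Ioi (hβ : 0 < β) (hN : 2 < N)
    (h : IsMeasureProfile β N L Γ gbar μ) (hΓ : 0 ≤ Γ) (h0 : ∀ n ∉ Finset.Icc 2 N, μ n = 0)
    {n : ℕ} (hn : n ∈ Finset.Icc 2 N) {t a b : ℝ} (ht : 0 < source β N Γ μ n (Ioi t))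
    (ha : max ((n : ℝ) - 6) 0 ≤ a) (hab : a < b) (hbt : b ≤ t) : 0 < μ n (Ioo a b) := by
  have := h.isFiniteMeasure_source h0 n
  refine measure_Ioo_pos_of_withDensity
    (aemeasurable_rightDensity (h.source_compl_Icc h0 n) (le_max_left _ _))
    (h.restrict_Ioi hβ hN hΓ h0 hn) hab (fun x hx => lt_of_le_of_lt ha hx.1) fun ξ hξ => ?_
  refine rightDensity_pos (h.source_compl_Icc h0 n)
    (lt_of_le_of_lt ((le_max_left _ _).trans ha) hξ.1) (ht.trans_le (measure_mono ?_))
  exact Ioi_subset_Ioi (hξ.2.le.trans hbt)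

theorem IsMeasureProfile.pos_of_source_Iio (hβ : 0 < β) (hN : 2 < N)
    (h : IsMeasureProfile β N L Γ gbar μ) (hΓ : 0 ≤ Γ) (h0 : ∀ n ∉ Finset.Icc 2 N, μ n = 0)
    {n : ℕ} (hn : n ∈ Finset.Icc 6 N) {t a b : ℝ} (ht : 0 < source β N Γ μ n (Iio t))
    (hta : t ≤ a) (hab : a < b) (hb : b ≤ (n : ℝ) - 6) : 0 < μ n (Ioo a b) := by
  have := h.isFiniteMeasure_source h0 n
  refine measure_Ioo_pos_of_withDensity (aemeasurable_leftDensity (h.source_compl_Icc h0 n))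
    (h.restrict_Iio hβ hN hΓ h0 hn) hab (fun x hx => lt_of_lt_of_le hx.2 hb) fun ξ hξ => ?_
  refine leftDensity_pos (h.source_compl_Icc h0 n) (lt_of_lt_of_le hξ.2 hb)
    (ht.trans_le (measure_mono ?_))
  exact Iio_subset_Iio (hta.trans hξ.1.le)

/-- Some class `n ≤ 6` has grains of arbitrarily small area. -/
theorem IsMeasureProfile.exists_charge (hβ : 0 < β) (hN : 6 < N)
    (h : IsMeasureProfile β N L Γ gbar μ) (hΓ : 0 < Γ) (h0 : ∀ n ∉ Finset.Icc 2 N, μ n = 0) :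
    ∃ n ∈ Finset.Icc 2 6, ∀ η > 0, 0 < μ n (Iio η) := by
  obtain ⟨n, hn, hpos⟩ := h.exists_gbar_pos (by omega)
  obtain ⟨hn2, hn5⟩ := Finset.mem_Icc.1 hn
  have hnN : n ∈ Finset.Icc 2 N := Finset.mem_Icc.2 (by omega)
  have hn5' : (n : ℝ) ≤ 5 := by exact_mod_cast hn5
  have htr := h.integral_source_eq_trace hβ (by omega) hΓ.le h0 hnN hn5
  have hne : source β N Γ μ n ≠ 0 := by
    intro hS
    rw [hS, integral_zero_measure] at htr
    have : 0 < (6 - (n : ℝ)) * gbar n * (6 - (n : ℝ)) ^ (1 - Γ * kappa β N n) :=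
      mul_pos (mul_pos (by linarith) hpos) (Real.rpow_pos_of_pos (by linarith) _)
    linarith
  -- An atom of a neighbour at 0 already settles the claim for that neighbour, of index at most 6.
  -- Otherwise the nonzero source lives on (0, ∞) and fills a right neighbourhood of 0 for class n.
  have hatom : ∀ m : ℕ, m ≤ 6 → μ m {0} ≠ 0 →
      ∃ n ∈ Finset.Icc 2 6, ∀ η > 0, 0 < μ n (Iio η) := by
    intro m hm hm0
    have hmN : m ∈ Finset.Icc 2 N := by
      by_contra hcon
      exact hm0 (by rw [h0 m hcon]; simp)
    refine ⟨m, Finset.mem_Icc.2 ⟨(Finset.mem_Icc.1 hmN).1, hm⟩, fun η hη => ?_⟩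
    exact (pos_iff_ne_zero.2 hm0).trans_le (measure_mono (by simpa using hη))
  by_cases ha : μ (n + 1) {0} = 0
  swap
  · exact hatom _ (by omega) ha
  by_cases hb : μ (n - 1) {0} = 0
  swap
  · exact hatom _ (by omega) hb
  have hSpos : 0 < source β N Γ μ n (Ioi 0) := by
    rw [pos_iff_ne_zero]
    intro hS
    refine hne (Measure.measure_univ_eq_zero.1 ?_)
    have hu : (univ : Set ℝ) = Iio 0 ∪ ({0} ∪ Ioi 0) := by
      ext x
      simp
    rw [hu]
    exact measure_union_null (source_null (h.measure_Iio h0 _) (h.measure_Iio h0 _))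
      (measure_union_null (source_null ha hb) hS)
  obtain ⟨t, ht, hSt⟩ := exists_measure_Ioi_pos hSpos
  refine ⟨n, Finset.mem_Icc.2 ⟨hn2, by omega⟩, fun η hη => ?_⟩
  refine (h.pos_of_source_Ioi hβ (by omega) hΓ.le h0 hnN hSt (a := 0) (b := min t η)
    (by rw [max_eq_right (by linarith)]) (lt_min ht hη) (min_le_left _ _)).trans_le
    (measure_mono fun x hx => hx.2.trans_le (min_le_right _ _))

/-- If n ≤ 5, the singular point of class n+1 is at most 0 and any source mass in (0, ∞) fills the
interval down to 0. If n ≥ 6, it is positive, and source mass below t fills the interval from t up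
to it. -/
theorem IsMeasureProfile.charge_succ (hβ : 0 < β) (hN : 2 < N)
    (h : IsMeasureProfile β N L Γ gbar μ) (hΓ : 0 < Γ) (h0 : ∀ n ∉ Finset.Icc 2 N, μ n = 0)
    {n : ℕ} (hn2 : 2 ≤ n) (hnN : n < N) (hc : ∀ η > 0, 0 < μ n (Iio η)) :
    ∀ η > 0, 0 < μ (n + 1) (Iio η) := by
  intro η hη
  have hn1 : n + 1 ∈ Finset.Icc 2 N := Finset.mem_Icc.2 (by omega)
  rcases le_or_gt n 5 with hn5 | hn5
  · have hn5' : (n : ℝ) ≤ 5 := by exact_mod_cast hn5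
    have hz := h.measure_singleton_zero hβ hN hΓ.le h0 (Finset.mem_Icc.2 ⟨hn2, hnN.le⟩)
      (by omega : n ≠ 6)
    have hpos : 0 < μ n (Ioi 0) := by
      rw [pos_iff_ne_zero]
      intro hS
      refine (hc 1 one_pos).ne' (measure_mono_null (t := Iio 0 ∪ ({0} ∪ Ioi 0)) (fun x _ => ?_)
        (measure_union_null (h.measure_Iio h0 _) (measure_union_null hz hS)))
      simp
    obtain ⟨t, ht, hμt⟩ := exists_measure_Ioi_pos hpos
    refine (h.pos_of_source_Ioi hβ hN hΓ.le h0 hn1 (a := 0) (b := min t η)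
      (source_pos_down hβ hΓ (by omega) hμt)
      (by push_cast; rw [max_eq_right (by linarith)]) (lt_min ht hη) (min_le_left _ _)).trans_le
      (measure_mono fun x hx => hx.2.trans_le (min_le_right _ _))
  · have hn6 : (6 : ℝ) ≤ n := by exact_mod_cast hn5
    set t : ℝ := min η ((n : ℝ) + 1 - 6) / 2 with htd
    have ht : 0 < t := half_pos (lt_min hη (by linarith))
    have htη : 2 * t ≤ η := by rw [htd]; linarith [min_le_left η ((n : ℝ) + 1 - 6)]
    have htc : 2 * t ≤ (n : ℝ) + 1 - 6 := by
      rw [htd]; linarith [min_le_right η ((n : ℝ) + 1 - 6)]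
    refine (h.pos_of_source_Iio hβ hN hΓ.le h0 (n := n + 1) (Finset.mem_Icc.2 (by omega))
      (t := t) (a := t) (b := 2 * t) (source_pos_down hβ hΓ (by omega) (hc t ht)) le_rfl
      (by linarith) (by push_cast; exact htc)).trans_le
      (measure_mono fun x hx => hx.2.trans_le htη)

theorem IsMeasureProfile.charge_pred_top (hβ : 0 < β) (hN : 6 < N)
    (h : IsMeasureProfile β N L Γ gbar μ) (hΓ : 0 < Γ) (h0 : ∀ n ∉ Finset.Icc 2 N, μ n = 0) :
    ∀ η > 0, 0 < μ (N - 1) (Iio η) := by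
  obtain ⟨n, hn, hc⟩ := h.exists_charge hβ hN hΓ h0
  obtain ⟨hn2, hn6⟩ := Finset.mem_Icc.1 hn
  have : ∀ m, n ≤ m → m ≤ N - 1 → ∀ η > 0, 0 < μ m (Iio η) := by
    intro m hm
    induction m, hm using Nat.le_induction with
    | base => exact fun _ => hc
    | succ m hm ih =>
      intro hmN
      exact h.charge_succ hβ (by omega) hΓ h0 (by omega) (by omega) (ih (by omega))
  exact this (N - 1) (by omega) le_rfl

/-- Descending induction from N: positivity of class n+1 on (0, N-6) feeds the source of class n on
both sides. Class N is fed from N-1 near 0, which suffices because its singular point N-6 is the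
right end of the interval. -/
theorem IsMeasureProfile.source_pos_and_pos (hβ : 0 < β) (hN : 6 < N)
    (h : IsMeasureProfile β N L Γ gbar μ) (hΓ : 0 < Γ) (h0 : ∀ n ∉ Finset.Icc 2 N, μ n = 0)
    {n : ℕ} (hn2 : 2 ≤ n) (hnN : n ≤ N) :
    (n ≠ N → ∀ t, 0 < t → t < (N : ℝ) - 6 → 0 < source β N Γ μ n (Ioi t)) ∧
    (∀ t > 0, 0 < source β N Γ μ n (Iio t)) ∧
    ∀ a b, 0 < a → a < b → b ≤ (N : ℝ) - 6 → 0 < μ n (Ioo a b) := by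
  have hN6 : (6 : ℝ) < N := by exact_mod_cast hN
  have step : ∀ n, 2 ≤ n → n ≤ N →
      (n ≠ N → ∀ t, 0 < t → t < (N : ℝ) - 6 → 0 < source β N Γ μ n (Ioi t)) →
      (∀ t > 0, 0 < source β N Γ μ n (Iio t)) →
      ∀ a b, 0 < a → a < b → b ≤ (N : ℝ) - 6 → 0 < μ n (Ioo a b) := by
    intro n hn2 hnN hr hl a b ha hab hb
    rcases le_or_gt ((n : ℝ) - 6) a with hca | hca
    · have hnN' : n ≠ N := by
        rintro rfl
        linarith
      refine (h.pos_of_source_Ioi hβ (by omega) hΓ.le h0 (Finset.mem_Icc.2 ⟨hn2, hnN⟩)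
        (hr hnN' ((a + b) / 2) (by linarith) (by linarith)) (max_le hca ha.le)
        (by linarith : a < (a + b) / 2) le_rfl).trans_le (measure_mono fun x hx => ?_)
      exact ⟨hx.1, by linarith [hx.2]⟩
    · have hn6 : 6 ≤ n := by
        have : (6 : ℝ) < n := by linarith
        exact_mod_cast this.le
      refine (h.pos_of_source_Iio hβ (by omega) hΓ.le h0 (Finset.mem_Icc.2 ⟨hn6, hnN⟩)
        (hl a ha) le_rfl (lt_min hab hca) (min_le_right _ _)).trans_le (measure_mono fun x hx => ?_)
      exact ⟨hx.1, hx.2.trans_le (min_le_left _ _)⟩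
  refine Nat.decreasingInduction' (P := fun n => 2 ≤ n →
    (n ≠ N → ∀ t, 0 < t → t < (N : ℝ) - 6 → 0 < source β N Γ μ n (Ioi t)) ∧
    (∀ t > 0, 0 < source β N Γ μ n (Iio t)) ∧
    ∀ a b, 0 < a → a < b → b ≤ (N : ℝ) - 6 → 0 < μ n (Ioo a b)) (m := n) (n := N)
    (fun k hkN hnk ih hk2 => ?_) hnN (fun _ => ?_) hn2
  · obtain ⟨-, -, hμ⟩ := ih (by omega)
    have hr : k ≠ N → ∀ t, 0 < t → t < (N : ℝ) - 6 → 0 < source β N Γ μ k (Ioi t) :=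
      fun hne t ht htN => source_pos_up hβ hΓ hne
        ((hμ t _ ht htN le_rfl).trans_le (measure_mono fun x hx => hx.1))
    have hl : ∀ t > 0, 0 < source β N Γ μ k (Iio t) := fun t ht => by
      refine source_pos_up hβ hΓ hkN.ne ((hμ (min t ((N : ℝ) - 6) / 2) (min t ((N : ℝ) - 6)) ?_ ?_
        (min_le_right _ _)).trans_le (measure_mono fun x hx => hx.2.trans_le (min_le_left _ _)))
      · exact half_pos (lt_min ht (by linarith))
      · exact half_lt_self (lt_min ht (by linarith))
    exact ⟨hr, hl, step k hk2 hkN.le hr hl⟩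
  · have hr : N ≠ N → ∀ t, 0 < t → t < (N : ℝ) - 6 → 0 < source β N Γ μ N (Ioi t) :=
      fun hne => absurd rfl hne
    have hl : ∀ t > 0, 0 < source β N Γ μ N (Iio t) := fun t ht =>
      source_pos_down hβ hΓ (by omega) (h.charge_pred_top hβ hN hΓ h0 t ht)
    exact ⟨hr, hl, step N (by omega) le_rfl hr hl⟩

/-- The dissipative effect of the coupling beats the concentration at `ξ = n - 6`. -/
theorem IsMeasureProfile.one_lt (hβ : 0 < β) (hN : 6 < N)
    (h : IsMeasureProfile β N L Γ gbar μ) (hΓ : 0 < Γ) (h0 : ∀ n ∉ Finset.Icc 2 N, μ n = 0)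
    {n : ℕ} (hn : n ∈ Finset.Icc 6 N) : 1 < Γ * kappa β N n := by
  obtain ⟨hn6, hnN⟩ := Finset.mem_Icc.1 hn
  have hn2 : n ∈ Finset.Icc 2 N := Finset.mem_Icc.2 (by omega)
  have hN6 : (6 : ℝ) < N := by exact_mod_cast hN
  have := h.isFiniteMeasure h0 n
  have := h.isFiniteMeasure_source h0 n
  obtain ⟨hr, hl, -⟩ := h.source_pos_and_pos hβ hN hΓ h0 (by omega : 2 ≤ n) hnN
  -- For n = 6 the singular point is 0 and nothing lies to its left, so the mass argument runs on
  -- the right. For n = N only the left side is available.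
  rcases eq_or_lt_of_le hn6 with rfl | hn7
  · have hd := h.restrict_Ioi hβ (by omega) hΓ.le h0 hn2
    rw [max_eq_left (by norm_num)] at hd
    refine one_lt_of_rightDensity (h.source_compl_Icc h0 6) (ξ := ((N : ℝ) - 6) / 2) ?_ hd
      (hr hN.ne _ (by linarith) (by linarith))
    push_cast
    linarith
  · have hn7' : (6 : ℝ) < n := by exact_mod_cast hn7
    exact one_lt_of_leftDensity (h.source_compl_Icc h0 n) (ξ := ((n : ℝ) - 6) / 2) (by linarith)
      (h.restrict_Iio hβ (by omega) hΓ.le h0 hn) (hl _ (by linarith))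

theorem measure_singleton_of_withDensity {μ : Measure ℝ} {U : Set ℝ} {D : ℝ → ℝ≥0∞}
    (hμ : μ.restrict U = (volume.restrict U).withDensity D) {x : ℝ} (hx : x ∈ U) : μ {x} = 0 := by
  have h1 : μ.restrict U {x} = 0 := by
    rw [hμ]
    exact withDensity_absolutelyContinuous _ _ (measure_mono_null (Subset.refl _) (by simp))
  rwa [Measure.restrict_apply (measurableSet_singleton x),
    inter_eq_left.2 (singleton_subset_iff.2 hx)] at h1

/-- Away from c and 0 the measure has a density. At 0 the separate test function argument applies,
since x = 0 ≠ c excludes n = 6. -/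
theorem IsMeasureProfile.measure_singleton_of_ne (hβ : 0 < β) (hN : 2 < N)
    (h : IsMeasureProfile β N L Γ gbar μ) (hΓ : 0 ≤ Γ) (h0 : ∀ n ∉ Finset.Icc 2 N, μ n = 0)
    {n : ℕ} {x : ℝ} (hx : x ≠ (n : ℝ) - 6) : μ n {x} = 0 := by
  by_cases hn : n ∈ Finset.Icc 2 N
  swap
  · rw [h0 n hn]; simp
  rcases lt_trichotomy x 0 with hx0 | rfl | hx0
  · exact measure_mono_null (singleton_subset_iff.2 hx0) (h.measure_Iio h0 n)
  · refine h.measure_singleton_zero hβ hN hΓ h0 hn fun h6 => hx ?_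
    rw [h6]; norm_num
  · rcases lt_or_gt_of_ne hx with hlt | hgt
    · have hn6 : 6 ≤ n := by
        have : (6 : ℝ) < n := by linarith
        exact_mod_cast this.le
      exact measure_singleton_of_withDensity (h.restrict_Iio hβ hN hΓ h0
        (Finset.mem_Icc.2 ⟨hn6, (Finset.mem_Icc.1 hn).2⟩)) hlt
    · exact measure_singleton_of_withDensity (h.restrict_Ioi hβ hN hΓ h0 hn) (max_lt hgt hx0)

theorem IsMeasureProfile.measure_singleton (hβ : 0 < β) (hN : 6 < N)
    (h : IsMeasureProfile β N L Γ gbar μ) (hΓ : 0 < Γ) (h0 : ∀ n ∉ Finset.Icc 2 N, μ n = 0)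
    (n : ℕ) (x : ℝ) : μ n {x} = 0 := by
  by_cases hx : x = (n : ℝ) - 6
  swap
  · exact h.measure_singleton_of_ne hβ (by omega) hΓ.le h0 hx
  by_cases hn : n ∈ Finset.Icc 2 N
  swap
  · rw [h0 n hn]; simp
  obtain ⟨hn2, hnN⟩ := Finset.mem_Icc.1 hn
  subst hx
  rcases lt_or_ge n 6 with hn6 | hn6
  · have : (n : ℝ) < 6 := by exact_mod_cast hn6
    exact measure_mono_null (singleton_subset_iff.2 (show (n : ℝ) - 6 ∈ Iio 0 by
      rw [mem_Iio]; linarith)) (h.measure_Iio h0 n)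
  · have hfin := h.isFiniteMeasure h0 n
    have hat := h.atom_eq hβ (by omega) hΓ.le h0 (Finset.mem_Icc.2 ⟨hn6, hnN⟩)
    -- The neighbours can have atoms only at c ± 1, so they do not charge c.
    have hS : source β N Γ μ n {(n : ℝ) - 6} = 0 := by
      refine source_null (h.measure_singleton_of_ne hβ (by omega) hΓ.le h0 ?_)
        (h.measure_singleton_of_ne hβ (by omega) hΓ.le h0 ?_)
      · push_cast; intro h; linarith
      · rw [Nat.cast_sub (by omega)]; push_cast; intro h; linarith
    rw [Measure.real, Measure.real, hS, ENNReal.toReal_zero, mul_eq_zero] at hat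
    have := h.one_lt hβ hN hΓ h0 (Finset.mem_Icc.2 ⟨hn6, hnN⟩)
    rcases hat with hat | hat
    · linarith
    · exact (ENNReal.toReal_eq_zero_iff _).1 hat |>.resolve_right (measure_ne_top _ _)

end profile

/-! ### The profile -/

/-- The variation of constants formula on both sides of the singular point. -/
noncomputable def twoSidedDensity (σ c : ℝ) (S : Measure ℝ) (ξ : ℝ) : ℝ :=
  if ξ < c then leftDensity σ c S ξ else if c < ξ then rightDensity σ c S ξ else 0

/-- The densities of the limit measures, with the traces as values at `0`. -/
noncomputable def limitProfile (β : ℝ) (N : ℕ) (Γ : ℝ) (gbar : ℕ → ℝ) (μ : ℕ → Measure ℝ) (n : ℕ)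
    (ξ : ℝ) : ℝ :=
  if n ∈ Finset.Icc 2 N ∧ 0 ≤ ξ then
    if ξ = 0 then (if n ≤ 5 then gbar n else 0)
    else twoSidedDensity (Γ * kappa β N n) ((n : ℝ) - 6) (source β N Γ μ n) ξ
  else 0

theorem twoSidedDensity_nonneg (σ c : ℝ) (S : Measure ℝ) (ξ : ℝ) :
    0 ≤ twoSidedDensity σ c S ξ := by
  unfold twoSidedDensity
  split_ifs with h1 h2
  · exact leftDensity_nonneg h1.le
  · exact rightDensity_nonneg h2.le
  · exact le_rfl

theorem twoSidedDensity_of_lt {σ c : ℝ} {S : Measure ℝ} {ξ : ℝ} (h : ξ < c) :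
    twoSidedDensity σ c S ξ = leftDensity σ c S ξ := if_pos h

theorem twoSidedDensity_of_gt {σ c : ℝ} {S : Measure ℝ} {ξ : ℝ} (h : c < ξ) :
    twoSidedDensity σ c S ξ = rightDensity σ c S ξ := by
  rw [twoSidedDensity, if_neg h.not_gt, if_pos h]

theorem continuousAt_twoSidedDensity {S : Measure ℝ} [IsFiniteMeasure S] [NullSingletonClass S]
    {a b : ℝ} (hS : S (Icc a b)ᶜ = 0) (σ : ℝ) {c ξ : ℝ} (h : ξ ≠ c) :
    ContinuousAt (twoSidedDensity σ c S) ξ := by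
  rcases lt_or_gt_of_ne h with h | h
  · refine ((continuousOn_leftDensity hS σ c).continuousAt (Iio_mem_nhds h)).congr ?_
    filter_upwards [Iio_mem_nhds h] with y hy using (twoSidedDensity_of_lt hy).symm
  · refine ((continuousOn_rightDensity hS σ c).continuousAt (Ioi_mem_nhds h)).congr ?_
    filter_upwards [Ioi_mem_nhds h] with y hy using (twoSidedDensity_of_gt hy).symm

theorem measurable_twoSidedDensity {S : Measure ℝ} [IsFiniteMeasure S] [NullSingletonClass S]
    {a b : ℝ} (hS : S (Icc a b)ᶜ = 0) (σ c : ℝ) : Measurable (twoSidedDensity σ c S) :=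
  measurable_of_continuousOn_compl_singleton c fun _ h =>
    (continuousAt_twoSidedDensity hS σ h).continuousWithinAt

theorem hasDerivAt_twoSidedDensity {s : ℝ → ℝ} (hs : Measurable s) (hs0 : ∀ x, 0 ≤ s x)
    {S : Measure ℝ} [IsFiniteMeasure S] (hSs : S = volume.withDensity fun x => ENNReal.ofReal (s x))
    {a b : ℝ} (hS : S (Icc a b)ᶜ = 0) {σ c ξ : ℝ} (hξ : ξ ≠ c) (hc : ContinuousAt s ξ) :
    HasDerivAt (twoSidedDensity σ c S)
      (((σ - 2) * twoSidedDensity σ c S ξ - s ξ) / (ξ - c)) ξ := by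
  rcases lt_or_gt_of_ne hξ with h | h
  · rw [twoSidedDensity_of_lt h]
    refine (hasDerivAt_leftDensity hs hs0 hSs hS h hc).congr_of_eventuallyEq ?_
    filter_upwards [Iio_mem_nhds h] with y hy using twoSidedDensity_of_lt hy
  · rw [twoSidedDensity_of_gt h]
    refine (hasDerivAt_rightDensity hs hs0 hSs hS h hc).congr_of_eventuallyEq ?_
    filter_upwards [Ioi_mem_nhds h] with y hy using twoSidedDensity_of_gt hy

section profile

variable {β : ℝ} {N L : ℕ} {Γ : ℝ} {gbar : ℕ → ℝ} {μ : ℕ → Measure ℝ}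

theorem limitProfile_of_pos {n : ℕ} (hn : n ∈ Finset.Icc 2 N) {ξ : ℝ} (hξ : 0 < ξ) :
    limitProfile β N Γ gbar μ n ξ =
      twoSidedDensity (Γ * kappa β N n) ((n : ℝ) - 6) (source β N Γ μ n) ξ := by
  rw [limitProfile, if_pos ⟨hn, hξ.le⟩, if_neg hξ.ne']

theorem limitProfile_zero {n : ℕ} (hn : n ∈ Finset.Icc 2 N) :
    limitProfile β N Γ gbar μ n 0 = if n ≤ 5 then gbar n else 0 := by
  rw [limitProfile, if_pos ⟨hn, le_rfl⟩, if_pos rfl]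

theorem limitProfile_of_neg (n : ℕ) {ξ : ℝ} (hξ : ξ < 0) : limitProfile β N Γ gbar μ n ξ = 0 := by
  rw [limitProfile, if_neg fun h => not_le.2 hξ h.2]

theorem limitProfile_of_notMem {n : ℕ} (hn : n ∉ Finset.Icc 2 N) (ξ : ℝ) :
    limitProfile β N Γ gbar μ n ξ = 0 := by
  rw [limitProfile, if_neg fun h => hn h.1]

theorem IsMeasureProfile.limitProfile_nonneg (h : IsMeasureProfile β N L Γ gbar μ) (n : ℕ)
    (ξ : ℝ) : 0 ≤ limitProfile β N Γ gbar μ n ξ := by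
  unfold limitProfile
  split_ifs with h1 h2 h3
  · exact h.gbar_nonneg n (Finset.mem_Icc.2 ⟨(Finset.mem_Icc.1 h1.1).1, h3⟩)
  · exact le_rfl
  · exact twoSidedDensity_nonneg _ _ _ _
  · exact le_rfl

theorem IsMeasureProfile.nullSingletonClass_source (hβ : 0 < β) (hN : 6 < N)
    (h : IsMeasureProfile β N L Γ gbar μ) (hΓ : 0 < Γ) (h0 : ∀ n ∉ Finset.Icc 2 N, μ n = 0)
    (n : ℕ) : NullSingletonClass (source β N Γ μ n) :=
  ⟨fun x => source_null (h.measure_singleton hβ hN hΓ h0 _ x) (h.measure_singleton hβ hN hΓ h0 _ x)⟩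

theorem IsMeasureProfile.measurable_limitProfile (hβ : 0 < β) (hN : 6 < N)
    (h : IsMeasureProfile β N L Γ gbar μ) (hΓ : 0 < Γ) (h0 : ∀ n ∉ Finset.Icc 2 N, μ n = 0)
    (n : ℕ) : Measurable (limitProfile β N Γ gbar μ n) := by
  have := h.isFiniteMeasure_source h0 n
  have := h.nullSingletonClass_source hβ hN hΓ h0 n
  unfold limitProfile
  refine Measurable.ite ?_ (Measurable.ite (measurableSet_singleton 0) measurable_const
    (measurable_twoSidedDensity (h.source_compl_Icc h0 n) _ _)) measurable_const
  by_cases hn : n ∈ Finset.Icc 2 N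
  · simpa [hn] using measurableSet_le (measurable_const (a := (0 : ℝ))) measurable_id
  · simp [hn]

theorem IsMeasureProfile.continuousAt_limitProfile (hβ : 0 < β) (hN : 6 < N)
    (h : IsMeasureProfile β N L Γ gbar μ) (hΓ : 0 < Γ) (h0 : ∀ n ∉ Finset.Icc 2 N, μ n = 0)
    (n : ℕ) {ξ : ℝ} (hξ : 0 < ξ) (hξn : ξ ≠ (n : ℝ) - 6) :
    ContinuousAt (limitProfile β N Γ gbar μ n) ξ := by
  have := h.isFiniteMeasure_source h0 n
  have := h.nullSingletonClass_source hβ hN hΓ h0 n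
  by_cases hn : n ∈ Finset.Icc 2 N
  · refine (continuousAt_twoSidedDensity (h.source_compl_Icc h0 n) (Γ * kappa β N n) hξn).congr ?_
    filter_upwards [Ioi_mem_nhds hξ] with y hy using (limitProfile_of_pos hn hy).symm
  · exact continuousAt_const.congr
      (Eventually.of_forall fun y => (limitProfile_of_notMem hn y).symm)

/-- The one-sided formulas cover (0, c) and (max c 0, ∞); the negative axis and the points 0 and c
are null for both measures. -/
theorem IsMeasureProfile.eq_withDensity (hβ : 0 < β) (hN : 6 < N)
    (h : IsMeasureProfile β N L Γ gbar μ) (hΓ : 0 < Γ) (h0 : ∀ n ∉ Finset.Icc 2 N, μ n = 0)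
    (n : ℕ) :
    μ n = volume.withDensity fun ξ => ENNReal.ofReal (limitProfile β N Γ gbar μ n ξ) := by
  by_cases hn : n ∈ Finset.Icc 2 N
  swap
  · simp [h0 n hn, limitProfile_of_notMem hn]
  set c : ℝ := (n : ℝ) - 6 with hc
  set ν := volume.withDensity fun ξ => ENNReal.ofReal (limitProfile β N Γ gbar μ n ξ) with hν
  have hνs : ∀ x, ν {x} = 0 := fun x => withDensity_absolutelyContinuous _ _ (by simp)
  have hsing : ∀ x : ℝ, (μ n).restrict {x} = ν.restrict {x} := fun x => by
    rw [Measure.restrict_eq_zero.2 (hνs x),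
      Measure.restrict_eq_zero.2 (h.measure_singleton hβ hN hΓ h0 n x)]
  have h1 : (μ n).restrict (Iio 0) = ν.restrict (Iio 0) := by
    rw [Measure.restrict_eq_zero.2 (h.measure_Iio h0 n), eq_comm, Measure.restrict_eq_zero, hν,
      withDensity_apply _ measurableSet_Iio]
    exact (setLIntegral_congr_fun measurableSet_Iio
      fun x hx => by rw [limitProfile_of_neg n hx, ENNReal.ofReal_zero]).trans (by simp)
  have h2 : (μ n).restrict (Ioi (max c 0)) = ν.restrict (Ioi (max c 0)) := by
    rw [h.restrict_Ioi hβ (by omega) hΓ.le h0 hn, hν, restrict_withDensity measurableSet_Ioi]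
    refine withDensity_congr_ae ((ae_restrict_mem measurableSet_Ioi).mono fun x hx => ?_)
    have hx' := max_lt_iff.1 (mem_Ioi.1 hx)
    simp only
    rw [limitProfile_of_pos hn hx'.2, twoSidedDensity_of_gt hx'.1]
  have h3 : (μ n).restrict (Ioo 0 c) = ν.restrict (Ioo 0 c) := by
    rcases le_or_gt c 0 with hc0 | hc0
    · simp [Ioo_eq_empty_of_le hc0]
    · have hn6 : 6 ≤ n := by
        have : (6 : ℝ) < n := by linarith
        exact_mod_cast this.le
      have hd := h.restrict_Iio hβ (by omega) hΓ.le h0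
        (Finset.mem_Icc.2 ⟨hn6, (Finset.mem_Icc.1 hn).2⟩)
      have hd' := congrArg (fun ρ : Measure ℝ => ρ.restrict (Ioo 0 c)) hd
      simp only [Measure.restrict_restrict measurableSet_Ioo,
        inter_eq_left.2 (Ioo_subset_Iio_self : Ioo 0 c ⊆ Iio c), ← hc,
        restrict_withDensity (measurableSet_Ioo : MeasurableSet (Ioo 0 c))] at hd'
      rw [hd', hν, restrict_withDensity measurableSet_Ioo]
      refine withDensity_congr_ae ((ae_restrict_mem measurableSet_Ioo).mono fun x hx => ?_)
      simp only
      rw [limitProfile_of_pos hn hx.1, twoSidedDensity_of_lt hx.2]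
  have hu : (univ : Set ℝ) = Iio 0 ∪ ({0} ∪ (Ioo 0 c ∪ ({c} ∪ Ioi (max c 0)))) := by
    refine (eq_univ_of_forall fun x => ?_).symm
    simp only [mem_union, mem_Iio, mem_singleton_iff, mem_Ioo, mem_Ioi, max_lt_iff]
    rcases lt_trichotomy x 0 with hx | hx | hx
    · exact Or.inl hx
    · exact Or.inr (Or.inl hx)
    · rcases lt_trichotomy x c with hxc | hxc | hxc <;> simp [hx, hxc]
  rw [← Measure.restrict_univ (μ := μ n), ← Measure.restrict_univ (μ := ν), hu]
  exact Measure.restrict_union_congr.2 ⟨h1, Measure.restrict_union_congr.2 ⟨hsing 0,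
    Measure.restrict_union_congr.2 ⟨h3, Measure.restrict_union_congr.2 ⟨hsing c, h2⟩⟩⟩⟩

/-- The density of the gain term. -/
noncomputable def sourceDensity (β : ℝ) (N : ℕ) (Γ : ℝ) (g : ℕ → ℝ → ℝ) (n : ℕ) (ξ : ℝ) : ℝ :=
  Γ * upCoeff β N n * g (n + 1) ξ + Γ * downCoeff β n * g (n - 1) ξ

theorem source_eq_withDensity (hβ : 0 < β) (hΓ : 0 ≤ Γ) {g : ℕ → ℝ → ℝ}
    (hg : ∀ n, Measurable (g n)) (hg0 : ∀ n ξ, 0 ≤ g n ξ)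
    (hμ : ∀ n, μ n = volume.withDensity fun ξ => ENNReal.ofReal (g n ξ)) {n : ℕ} (hn : 2 ≤ n) :
    source β N Γ μ n =
      volume.withDensity fun ξ => ENNReal.ofReal (sourceDensity β N Γ g n ξ) := by
  have hA := mul_nonneg hΓ (upCoeff_nonneg hβ N n)
  have hB := mul_nonneg hΓ (downCoeff_nonneg hβ hn)
  have hm1 := hg (n + 1)
  have hm2 := hg (n - 1)
  rw [source, hμ (n + 1), hμ (n - 1), ← withDensity_smul _ (by fun_prop),
    ← withDensity_smul _ (by fun_prop), ← withDensity_add_left (by fun_prop)]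
  congr 1
  funext ξ
  simp only [Pi.add_apply, Pi.smul_apply, smul_eq_mul, sourceDensity]
  rw [ENNReal.ofReal_add (mul_nonneg hA (hg0 _ _)) (mul_nonneg hB (hg0 _ _)),
    ENNReal.ofReal_mul hA, ENNReal.ofReal_mul hB]

/-- The ODE expresses the derivative through g_n and its two neighbours. The points n-7 and n-5 are
removed because the neighbours may be discontinuous there. -/
theorem IsMeasureProfile.contDiffOn_limitProfile (hβ : 0 < β) (hN : 6 < N)
    (h : IsMeasureProfile β N L Γ gbar μ) (hΓ : 0 < Γ) (h0 : ∀ n ∉ Finset.Icc 2 N, μ n = 0)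
    {n : ℕ} (hn : n ∈ Finset.Icc 2 N) :
    ContDiffOn ℝ 1 (limitProfile β N Γ gbar μ n)
      (Ioo (0 : ℝ) ((N : ℝ) - 6) \ {(n : ℝ) - 7, (n : ℝ) - 6, (n : ℝ) - 5}) := by
  have hn2 := (Finset.mem_Icc.1 hn).1
  have := h.isFiniteMeasure_source h0 n
  set g := limitProfile β N Γ gbar μ with hg
  set O : Set ℝ := Ioo (0 : ℝ) ((N : ℝ) - 6) \ {(n : ℝ) - 7, (n : ℝ) - 6, (n : ℝ) - 5} with hO
  have hOo : IsOpen O := isOpen_Ioo.sdiff (toFinite _).isClosed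
  have hgm := h.measurable_limitProfile hβ hN hΓ h0
  have hg0 := h.limitProfile_nonneg
  have hSs := source_eq_withDensity (N := N) hβ hΓ.le hgm hg0 (h.eq_withDensity hβ hN hΓ h0) hn2
  have hmem : ∀ ξ ∈ O, 0 < ξ ∧ ξ ≠ ((n - 1 : ℕ) : ℝ) - 6 ∧ ξ ≠ (n : ℝ) - 6 ∧
      ξ ≠ ((n + 1 : ℕ) : ℝ) - 6 := by
    intro ξ hξ
    simp only [hO, Set.mem_sdiff, mem_Ioo, mem_insert_iff, mem_singleton_iff, not_or] at hξ
    obtain ⟨⟨hξ0, -⟩, h7, h6, h5⟩ := hξ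
    refine ⟨hξ0, fun e => h7 ?_, h6, fun e => h5 ?_⟩
    · rw [e, Nat.cast_sub (by omega)]; push_cast; ring
    · rw [e]; push_cast; ring
  have hsc : ∀ ξ ∈ O, ContinuousAt (sourceDensity β N Γ g n) ξ := by
    intro ξ hξ
    obtain ⟨hξ0, h7, -, h5⟩ := hmem ξ hξ
    exact ((h.continuousAt_limitProfile hβ hN hΓ h0 (n + 1) hξ0 h5).const_mul _).add
      ((h.continuousAt_limitProfile hβ hN hΓ h0 (n - 1) hξ0 h7).const_mul _)
  have hder : ∀ ξ ∈ O, HasDerivAt (g n) (((Γ * kappa β N n - 2) * g n ξ -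
      sourceDensity β N Γ g n ξ) / (ξ - ((n : ℝ) - 6))) ξ := by
    intro ξ hξ
    obtain ⟨hξ0, -, h6, -⟩ := hmem ξ hξ
    have hgn1 := hgm (n + 1)
    have hgn2 := hgm (n - 1)
    have hd := hasDerivAt_twoSidedDensity (σ := Γ * kappa β N n)
      (by fun_prop) (fun x => add_nonneg
        (mul_nonneg (mul_nonneg hΓ.le (upCoeff_nonneg hβ _ _)) (hg0 _ _))
        (mul_nonneg (mul_nonneg hΓ.le (downCoeff_nonneg hβ hn2)) (hg0 _ _))) hSs
      (h.source_compl_Icc h0 n) h6 (hsc ξ hξ)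
    rw [← limitProfile_of_pos (gbar := gbar) hn hξ0] at hd
    refine hd.congr_of_eventuallyEq ?_
    filter_upwards [Ioi_mem_nhds hξ0] with y hy using limitProfile_of_pos hn hy
  rw [show (1 : WithTop ℕ∞) = 0 + 1 by simp, contDiffOn_succ_iff_deriv_of_isOpen hOo]
  refine ⟨fun ξ hξ => (hder ξ hξ).differentiableAt.differentiableWithinAt, by simp, ?_⟩
  rw [contDiffOn_zero]
  refine ContinuousOn.congr (fun ξ hξ => ?_) fun ξ hξ => (hder ξ hξ).deriv
  obtain ⟨hξ0, -, h6, -⟩ := hmem ξ hξ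
  exact ((((h.continuousAt_limitProfile hβ hN hΓ h0 n hξ0 h6).const_mul _).sub
    (hsc ξ hξ)).div
    (continuousAt_id.sub continuousAt_const) (sub_ne_zero.2 h6)).continuousWithinAt

theorem IsMeasureProfile.limitProfile_pos (hβ : 0 < β) (hN : 6 < N)
    (h : IsMeasureProfile β N L Γ gbar μ) (hΓ : 0 < Γ) (h0 : ∀ n ∉ Finset.Icc 2 N, μ n = 0)
    {n : ℕ} (hn : n ∈ Finset.Icc 2 N) {ξ : ℝ} (hξ0 : 0 < ξ) (hξN : ξ < (N : ℝ) - 6)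
    (hξn : ξ ≠ (n : ℝ) - 6) : 0 < limitProfile β N Γ gbar μ n ξ := by
  obtain ⟨hn2, hnN⟩ := Finset.mem_Icc.1 hn
  have := h.isFiniteMeasure_source h0 n
  obtain ⟨hr, hl, -⟩ := h.source_pos_and_pos hβ hN hΓ h0 hn2 hnN
  rw [limitProfile_of_pos hn hξ0]
  rcases lt_or_gt_of_ne hξn with hlt | hgt
  · rw [twoSidedDensity_of_lt hlt]
    exact leftDensity_pos (h.source_compl_Icc h0 n) hlt (hl ξ hξ0)
  · rw [twoSidedDensity_of_gt hgt]
    refine rightDensity_pos (h.source_compl_Icc h0 n) hgt (hr ?_ ξ hξ0 hξN)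
    rintro rfl
    linarith

theorem IsMeasureProfile.limitProfile_eq_zero (hN : 6 < N)
    (h : IsMeasureProfile β N L Γ gbar μ) (h0 : ∀ n ∉ Finset.Icc 2 N, μ n = 0)
    {n : ℕ} (hn : n ∈ Finset.Icc 2 N) {ξ : ℝ} (hξ : (N : ℝ) - 6 < ξ) :
    limitProfile β N Γ gbar μ n ξ = 0 := by
  have hN6 : (6 : ℝ) < N := by exact_mod_cast hN
  have hnN : (n : ℝ) ≤ N := by exact_mod_cast (Finset.mem_Icc.1 hn).2
  have hS : source β N Γ μ n (Ioi ξ) = 0 :=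
    measure_mono_null (Ioi_subset_Ioi hξ.le)
      (source_null (h.measure_Ioi hN h0 _) (h.measure_Ioi hN h0 _))
  rw [limitProfile_of_pos hn (by linarith), twoSidedDensity_of_gt (by linarith), rightDensity,
    Measure.restrict_eq_zero.2 hS, integral_zero_measure, mul_zero]

/-- The variation of constants formula is continuous at 0 when c ≠ 0. For n ≥ 7 its value there is
0, as the source does not charge the negative axis; for n ≤ 5 the integrated trace identity
evaluates it to ḡ_n. -/
theorem IsMeasureProfile.tendsto_limitProfile_zero (hβ : 0 < β) (hN : 6 < N)
    (h : IsMeasureProfile β N L Γ gbar μ) (hΓ : 0 < Γ) (h0 : ∀ n ∉ Finset.Icc 2 N, μ n = 0)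
    {n : ℕ} (hn : n ∈ Finset.Icc 2 N) (hn6 : n ≠ 6) :
    Tendsto (limitProfile β N Γ gbar μ n) (𝓝[>] 0) (𝓝 (limitProfile β N Γ gbar μ n 0)) := by
  have := h.isFiniteMeasure_source h0 n
  have := h.nullSingletonClass_source hβ hN hΓ h0 n
  have hne : (0 : ℝ) ≠ (n : ℝ) - 6 := by
    intro e
    have : (n : ℝ) = 6 := by linarith
    exact hn6 (by exact_mod_cast this)
  have hS0 : source β N Γ μ n (Iio 0) = 0 := source_null (h.measure_Iio h0 _) (h.measure_Iio h0 _)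
  have hval : limitProfile β N Γ gbar μ n 0 =
      twoSidedDensity (Γ * kappa β N n) ((n : ℝ) - 6) (source β N Γ μ n) 0 := by
    rw [limitProfile_zero hn]
    rcases lt_or_gt_of_ne hne with hlt | hgt
    · have h6 : ¬ n ≤ 5 := by
        intro h5
        have : (n : ℝ) ≤ 5 := by exact_mod_cast h5
        linarith
      rw [if_neg h6, twoSidedDensity_of_lt hlt, leftDensity, Measure.restrict_eq_zero.2 hS0,
        integral_zero_measure, mul_zero]
    · have h6 : n ≤ 5 := by
        have : (n : ℝ) < 6 := by linarith
        have : n < 6 := by exact_mod_cast this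
        omega
      have htr := h.integral_source_eq_trace hβ (by omega) hΓ.le h0 hn h6
      have hrestr : (source β N Γ μ n).restrict (Ioi 0) = source β N Γ μ n := by
        rw [Measure.restrict_eq_self_of_ae_mem]
        have : source β N Γ μ n (Ioi 0)ᶜ = 0 := by
          rw [compl_Ioi, ← Iio_union_right]
          exact measure_union_null hS0 (MeasureTheory.measure_singleton 0)
        exact measure_eq_zero_iff_ae_notMem.1 this |>.mono fun x hx => by simpa using hx
      have hx : 0 < 6 - (n : ℝ) := by linarith
      rw [if_pos h6, twoSidedDensity_of_gt hgt, rightDensity, hrestr, htr, zero_sub, neg_sub]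
      have e : (6 - (n : ℝ)) ^ (Γ * kappa β N n - 2) * (6 - (n : ℝ)) ^ (1 - Γ * kappa β N n) =
          1 / (6 - n) := by
        rw [← Real.rpow_add hx, show Γ * kappa β N n - 2 + (1 - Γ * kappa β N n) = -1 by ring,
          Real.rpow_neg_one, one_div]
      rw [show ∀ A B C D : ℝ, A * (B * C * D) = B * C * (A * D) by intros; ring, e]
      field_simp
  rw [hval]
  refine (((continuousAt_twoSidedDensity (h.source_compl_Icc h0 n) (Γ * kappa β N n)
    hne).tendsto).mono_left nhdsWithin_le_nhds).congr' ?_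
  filter_upwards [self_mem_nhdsWithin] with y hy using (limitProfile_of_pos hn hy).symm

/-- Integrals against the limit measures, in terms of the profile. -/
theorem IsMeasureProfile.setIntegral_limitProfile_mul (hβ : 0 < β) (hN : 6 < N)
    (h : IsMeasureProfile β N L Γ gbar μ) (hΓ : 0 < Γ) (h0 : ∀ n ∉ Finset.Icc 2 N, μ n = 0)
    (n : ℕ) {ψ : ℝ → ℝ} (hψ : Continuous ψ) :
    IntegrableOn (fun ξ => limitProfile β N Γ gbar μ n ξ * ψ ξ) (Ioi 0) ∧
    ∫ ξ in Ioi (0 : ℝ), limitProfile β N Γ gbar μ n ξ * ψ ξ = ∫ ξ, ψ ξ ∂(μ n) := by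
  have hfin := h.isFiniteMeasure h0 n
  have hd := h.eq_withDensity hβ hN hΓ h0 n
  have hm := h.measurable_limitProfile hβ hN hΓ h0 n
  have hn0 := h.limitProfile_nonneg n
  have hi : IntegrableOn ψ (Ioi 0) (μ n) :=
    (integrable_of_compl_Icc (h.compl_Icc h0 n) hψ.continuousOn).integrableOn
  refine ⟨integrableOn_withDensity_ofReal hm hn0 measurableSet_Ioi (hd ▸ hi), ?_⟩
  rw [← setIntegral_withDensity_ofReal hm hn0 ψ measurableSet_Ioi, ← hd]
  congr 1
  rw [Measure.restrict_eq_self_of_ae_mem]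
  have : μ n (Ioi 0)ᶜ = 0 := by
    rw [compl_Ioi, ← Iio_union_right]
    exact measure_union_null (h.measure_Iio h0 n) (h.measure_singleton hβ hN hΓ h0 n 0)
  exact measure_eq_zero_iff_ae_notMem.1 this |>.mono fun x hx => by simpa using hx

theorem IsMeasureProfile.momentX_limitProfile (hβ : 0 < β) (hN : 6 < N)
    (h : IsMeasureProfile β N L Γ gbar μ) (hΓ : 0 < Γ) (h0 : ∀ n ∉ Finset.Icc 2 N, μ n = 0)
    (n : ℕ) : momentX (limitProfile β N Γ gbar μ) n = (μ n).real univ := by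
  have := (h.setIntegral_limitProfile_mul hβ hN hΓ h0 n (continuous_const (y := (1 : ℝ)))).2
  simpa [momentX] using this

theorem IsMeasureProfile.gammaNum_limitProfile (hN : 6 < N) :
    gammaNum (limitProfile β N Γ gbar μ) =
      ∑ n ∈ Finset.Icc (2 : ℕ) 5, ((n : ℝ) - 6) ^ 2 * gbar n := by
  refine Finset.sum_congr rfl fun n hn => ?_
  obtain ⟨hn2, hn5⟩ := Finset.mem_Icc.1 hn
  rw [limitProfile_zero (Finset.mem_Icc.2 (by omega)), if_pos hn5]

theorem IsMeasureProfile.gammaDen_limitProfile (hβ : 0 < β) (hN : 6 < N)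
    (h : IsMeasureProfile β N L Γ gbar μ) (hΓ : 0 < Γ) (h0 : ∀ n ∉ Finset.Icc 2 N, μ n = 0) :
    gammaDen β N (limitProfile β N Γ gbar μ) =
      β * N * (μ N).real univ - 2 * (β + 1) * (μ 2).real univ +
        ∑ n ∈ Finset.Icc 2 N, (n : ℝ) * (μ n).real univ := by
  simp only [gammaDen, h.momentX_limitProfile hβ hN hΓ h0]

theorem IsMeasureProfile.gamma_limitProfile (hβ : 0 < β) (hN : 6 < N)
    (h : IsMeasureProfile β N L Γ gbar μ) (hΓ : 0 < Γ) (h0 : ∀ n ∉ Finset.Icc 2 N, μ n = 0) :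
    gamma β N (limitProfile β N Γ gbar μ) = Γ := by
  rw [gamma, gammaNum_limitProfile hN, h.gammaDen_limitProfile hβ hN hΓ h0]
  exact h.weight.symm

theorem IsMeasureProfile.isWeakProfile (hβ : 0 < β) (hβ2 : β < 2) (hN : 6 < N)
    (h : IsMeasureProfile β N L Γ gbar μ) (hΓ : 0 < Γ) (h0 : ∀ n ∉ Finset.Icc 2 N, μ n = 0) :
    IsWeakProfile β N (limitProfile β N Γ gbar μ) where
  nonneg n _ ξ _ := h.limitProfile_nonneg n ξ
  nontrivial := by
    simp only [h.momentX_limitProfile hβ hN hΓ h0, h.mass, one_pos]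
  integrable n _ := by
    simpa using (h.setIntegral_limitProfile_mul hβ hN hΓ h0 n
      (continuous_const (y := (1 : ℝ)))).1
  area_finite n _ := by
    simpa only [mul_comm, id] using (h.setIntegral_limitProfile_mul hβ hN hΓ h0 n continuous_id).1
  trace n hn hn6 := h.tendsto_limitProfile_zero hβ hN hΓ h0 hn hn6
  boundary n hn := by
    obtain ⟨hn7, hnN⟩ := Finset.mem_Icc.1 hn
    rw [limitProfile_zero (Finset.mem_Icc.2 (by omega)), if_neg (by omega)]
  gammaNum_pos := by
    rw [gammaNum_limitProfile hN]
    exact h.num_pos (by omega)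
  gammaDen_pos := by
    rw [h.gammaDen_limitProfile hβ hN hΓ h0]
    exact h.den_pos hβ hβ2 (by omega)
  weak n hn φ hφ _ := by
    have hN2 : 2 < N := by omega
    have hφ'c : Continuous (deriv φ) := hφ.continuous_deriv (by simp)
    have hφc := hφ.continuous
    have hw := h.weak n hn φ (deriv φ)
      (fun ξ _ => (hφ.differentiable (by simp)).differentiableAt.hasDerivAt) hφ'c.continuousOn
    have hI := fun m => h.setIntegral_limitProfile_mul hβ hN hΓ h0 m hφc
    rw [h.gamma_limitProfile hβ hN hΓ h0,
      (h.setIntegral_limitProfile_mul hβ hN hΓ h0 n (by fun_prop)).2]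
    -- The profile takes the default value 0 at ξ = 0 for n ≥ 6. This is harmless here because the
    -- prefactor (6-n)_+ vanishes.
    have hbd : max (6 - (n : ℝ)) 0 * limitProfile β N Γ gbar μ n 0 =
        max (6 - (n : ℝ)) 0 * gbar n := by
      rw [limitProfile_zero hn]
      split_ifs with h5
      · rfl
      · have : (6 : ℝ) ≤ n := by exact_mod_cast (by omega : 6 ≤ n)
        rw [max_eq_right (by linarith), zero_mul, zero_mul]
    rw [hbd, hw]
    congr 1
    have e : ∀ ξ, coupling β N (fun m => limitProfile β N Γ gbar μ m ξ) n * φ ξ =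
        upCoeff β N n * (limitProfile β N Γ gbar μ (n + 1) ξ * φ ξ) +
          downCoeff β n * (limitProfile β N Γ gbar μ (n - 1) ξ * φ ξ) -
          kappa β N n * (limitProfile β N Γ gbar μ n ξ * φ ξ) := fun ξ => by
      rw [coupling_eq β hN2]; ring
    simp_rw [e]
    rw [integral_sub (((hI _).1.const_mul _).fun_add ((hI _).1.const_mul _)) ((hI _).1.const_mul _),
      integral_add ((hI _).1.const_mul _) ((hI _).1.const_mul _), integral_const_mul,
      integral_const_mul, integral_const_mul, (hI _).2, (hI _).2, (hI _).2, coupling_eq β hN2]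

end profile

end Fradkov

/-! ### Assembly -/

theorem mainTheorem4 (β : ℝ) (hβ0 : 0 < β) (hβ2 : β < 2) (N L : ℕ) (hN : 6 < N)
    (hL : N < L + 6) (Γ : ℝ) (gbar : ℕ → ℝ) (μ : ℕ → Measure ℝ)
    (hlim : Fradkov.IsSteadyStateLimit β N L Γ gbar μ) :
    (∀ n ∈ Finset.Icc 6 N, 1 < Γ * Fradkov.kappa β N n ∧ μ n {(n : ℝ) - 6} = 0) ∧
    ∃ g : ℕ → ℝ → ℝ,
      (∀ n ∈ Finset.Icc 2 N,
        μ n = (volume.restrict (Ioi (0 : ℝ))).withDensity (fun ξ => ENNReal.ofReal (g n ξ)) ∧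
        (∀ ξ ∈ Ioo (0 : ℝ) ((N : ℝ) - 6) \ {(n : ℝ) - 6}, 0 < g n ξ) ∧
        ContinuousOn (g n) (Ioo (0 : ℝ) ((N : ℝ) - 6) \ {(n : ℝ) - 6}) ∧
        ContDiffOn ℝ 1 (g n)
          (Ioo (0 : ℝ) ((N : ℝ) - 6) \ {(n : ℝ) - 7, (n : ℝ) - 6, (n : ℝ) - 5}) ∧
        (∀ ξ : ℝ, (N : ℝ) - 6 < ξ → g n ξ = 0)) ∧
      Fradkov.IsWeakProfile β N g ∧
      (∀ n ∈ Finset.Icc 2 5, g n 0 = gbar n) ∧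
      Γ = Fradkov.gamma β N g := by
  -- Nothing is known about μ outside 2, …, N. Setting it to zero there makes `source` a finite
  -- measure for every index.
  set ν : ℕ → Measure ℝ := fun n => if n ∈ Finset.Icc 2 N then μ n else 0 with hν
  have hνμ : ∀ n ∈ Finset.Icc 2 N, ν n = μ n := fun n hn => if_pos hn
  have h0 : ∀ n ∉ Finset.Icc 2 N, ν n = 0 := fun n hn => if_neg hn
  have h : Fradkov.IsMeasureProfile β N L Γ gbar ν :=
    (hlim.isMeasureProfile hβ0 hβ2 hN hL).congr (by omega) hνμ
  have hΓ : 0 < Γ := h.weight_pos hβ0 hβ2 (by omega)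
  refine ⟨fun n hn => ⟨h.one_lt hβ0 hN hΓ h0 hn, ?_⟩, Fradkov.limitProfile β N Γ gbar ν,
    fun n hn => ⟨?_, fun ξ hξ => h.limitProfile_pos hβ0 hN hΓ h0 hn hξ.1.1 hξ.1.2 hξ.2,
      fun ξ hξ => (h.continuousAt_limitProfile hβ0 hN hΓ h0 n hξ.1.1 hξ.2).continuousWithinAt,
      h.contDiffOn_limitProfile hβ0 hN hΓ h0 hn,
      fun ξ hξ => h.limitProfile_eq_zero hN h0 hn hξ⟩,
    h.isWeakProfile hβ0 hβ2 hN hΓ h0, fun n hn => ?_, (h.gamma_limitProfile hβ0 hN hΓ h0).symm⟩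
  · obtain ⟨hn6, hnN⟩ := Finset.mem_Icc.1 hn
    rw [← hνμ n (Finset.mem_Icc.2 (by omega))]
    exact h.measure_singleton hβ0 hN hΓ h0 n _
  · rw [← hνμ n hn, ← restrict_withDensity measurableSet_Ioi, ← h.eq_withDensity hβ0 hN hΓ h0 n,
      Measure.restrict_eq_self_of_ae_mem]
    have : ν n (Ioi 0)ᶜ = 0 := by
      rw [compl_Ioi, ← Iio_union_right]
      exact measure_union_null (h.measure_Iio h0 n) (h.measure_singleton hβ0 hN hΓ h0 n 0)
    exact measure_eq_zero_iff_ae_notMem.1 this |>.mono fun x hx => by simpa using hx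
  · obtain ⟨hn2, hn5⟩ := Finset.mem_Icc.1 hn
    rw [Fradkov.limitProfile_zero (Finset.mem_Icc.2 (by omega)), if_pos hn5]
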